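/- **Setting.** Let $S$ be a complex manifold, $\alpha:Z\to S$ a differentiable fibre bundle, $T_S\subset T_{S_{\mathbb C}}$ the $(1,0)$-vectors. An integrable complex structure on $T_{Z_{\mathbb R}/S}$ is a smooth complex subbundle $T_{rel}\subset T_{Z_{\mathbb C}/S}=\ker(d\alpha)$ with $T_{rel}\oplus\bar T_{rel}=T_{Z_{\mathbb C}/S}$ and $[T_{rel},T_{rel}]\subset T_{rel}$; then $(\alpha,T_{rel})$ is a complex fibre bundle. A $\bar\partial$-operator (resp. an almost connection) on $(\alpha,T_{rel})$ is a differentiable bundle map $D$ from $\alpha^*\bar T_S$ (resp. $\alpha^*T_S$) to $T_{Z_{\mathbb C}}/\bar T_{rel}$ lifting the inclusion into $\alpha^*T_{S_{\mathbb C}}$. It satisfies the local lifting condition if near every point of $Z$ it has a smooth lifting $\tilde D$ to $T_{Z_{\mathbb C}}$ with $[\bar T_{rel},\tilde D(a)]\subset\bar T_{rel}$ for all local vector fields $a$ on $S$ of the respective type; a connection with this property is called holomorphic along the vertical direction. For a $\bar\partial$-operator $D$ let $\bar T_D\subset T_{Z_{\mathbb C}}$ be the inverse image of $\mathrm{im}\,D$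 and $T_D$ its conjugate. $D$ is integrable if $T_D$ is a complex structure on $(\alpha,T_{rel})$, i.e. a smooth subbundle with $T_{rel}\subset T_D$, $T_D\oplus\bar T_D=T_{Z_{\mathbb C}}$, $d\alpha(T_D)\subset\alpha^*T_S$, $[T_D,T_D]\subset T_D$; equivalently (Newlander–Nirenberg) $\alpha$ becomes a holomorphic fibration with $\bar\partial$-operator $D$ and holomorphic relative tangent bundle $T_{rel}$. Let $T_A,T_B$ be two integrable complex structures on $T_{Z_{\mathbb R}/S}$ and $\beta$ a real smooth automorphism of $T_{Z_{\mathbb C}}$ with $\beta(T_A)=T_B$ that induces the identity on $\alpha^*T_{S_{\mathbb C}}$ and preserves the local lifting condition: a $\bar\partial$-operator or almost connection $D$ on $(\alpha,T_A)$ satisfies it if and only if $\beta\circ D$ satisfies it on $(\alpha,T_B)$. Let $f:X\to S$ be a holomorphic fibration with underlying complex fibre bundle $(\alpha,T_A)$ and $\bar\partial$-operator $\bar\partial_f$, and let $\nabla:f^*T_S\to T_X$ be a flat holomorphic connection (a holomorphic splitting whose image is closed under brackets). Let $\omega$ be a hermitian metric on $f$: a closed real two-form on $Z$ whose restriction to each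 fibre is of type $(1,1)$ and positive definite. Let $\partial_\omega:\alpha^*T_S\to T_X$ be its Chern connection, the unique splitting with $\omega(\partial_\omega(\cdot),\bar T_A)=0$, and put $$\theta_\omega:=\tfrac12\,\beta\circ(\nabla-\partial_\omega):\alpha^*T_S\to T_B .$$ Assume that $\omega$ is allowable: it is preserved by $\beta$, $\partial_\omega$ is holomorphic along the vertical direction, and $\omega$ is $\theta_\omega$-adapted. The last condition means the following. For $s\in S$ let $\mathfrak{aut}_s$ be the Lie algebra of the group of holomorphic isometries of the fibre $Z_s$ with complex structure $T_B|_{Z_s}$ and metric $\omega|_{Z_s}$ (complete vector fields preserving both, identified with their $(1,0)$-parts); its dimension is finite and independent of $s$, and for every $v\in T_S(s)$ the field $\theta_\omega(v)$ on $Z_s$ has the form $x+iy$ with $x,y\in\mathfrak{aut}_s$. Let $\bar\theta_\omega:\alpha^*\bar T_S\to T_B$ be the complex conjugation of $\theta_\omega$ with respect to $\omega$: a smooth bundle map with $\bar\theta_\omega(\bar v)=-(x-iy)$ on $Z_s$ for some such $x,y$ with $\theta_\omega(v)=x+iy$, for every $v\in T_S(s)$. Put $$\bar\partial_\omega:=\beta\circ\bar\partial_f-\bar\theta_\omega,\qquad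 D''_\omega:=\bar\partial_\omega+\theta_\omega:\alpha^*T_{S_{\mathbb C}}\to T_{Z_{\mathbb C}}/\bar T_B .$$ **Proposition.** There is a unique tensor $G_\omega=G^{0,2}+G^{1,1}+G^{2,0}\in\Gamma(S,\Omega^2_{S_{\mathbb C}}\otimes f_*T_{X/S})$, i.e. a smooth two-form on $S$ with values in vertical fields of type $T_A$ that are holomorphic along the fibres of $f$, such that for every smooth local lifting $L$ of $\bar\partial_\omega$ to $T_{Z_{\mathbb C}}$ - $\beta G_\omega(a,b)\equiv[L(a),L(b)]$ modulo $\bar T_{\bar\partial_\omega}$ for local smooth $(0,1)$-fields $a,b$ on $S$, - $\beta G_\omega(a,b)\equiv[\theta_\omega(a),L(b)]$ modulo $\bar T_B$ for local holomorphic $(1,0)$-fields $a$ and smooth $(0,1)$-fields $b$, - $\beta G_\omega(a,b)=[\theta_\omega(a),\theta_\omega(b)]$ for local smooth $(1,0)$-fields $a,b$. Moreover $G_\omega=0$ if and only if $(\bar\partial_\omega,\theta_\omega)$ defines a holomorphic Higgs bundle over $S$ with underlying complex fibre bundle $(\alpha,T_B)$, i.e. $\bar\partial_\omega$ is an integrable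 $\bar\partial$-operator on $(\alpha,T_B)$, $\theta_\omega$ maps holomorphic vector fields on $S$ to holomorphic vertical fields for the resulting holomorphic fibration $g:Y\to S$, and $[\theta_\omega,\theta_\omega]=0$. -/

import Mathlib

open Set
open scoped Manifold ContDiff

noncomputable section

namespace NLHodge

/-! ### Complexification of a real vector space -/

/-- The complexification `V ⊗ ℂ = V ⊕ iV` of a real vector space; `⟨x, y⟩` stands for `x + i y`. -/
@[ext]
structure Cx (V : Type*) where
  re : V
  im : V

namespace Cx

section
variable {V W : Type*} [AddCommGroup V] [AddCommGroup W]

instance : Zero (Cx V) := ⟨⟨0, 0⟩⟩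
instance : Add (Cx V) := ⟨fun a b => ⟨a.re + b.re, a.im + b.im⟩⟩
instance : Neg (Cx V) := ⟨fun a => ⟨-a.re, -a.im⟩⟩
instance : Sub (Cx V) := ⟨fun a b => ⟨a.re - b.re, a.im - b.im⟩⟩
instance : SMul ℕ (Cx V) := ⟨fun n a => ⟨n • a.re, n • a.im⟩⟩
instance : SMul ℤ (Cx V) := ⟨fun n a => ⟨n • a.re, n • a.im⟩⟩

@[simp] theorem zero_re : (0 : Cx V).re = 0 := rfl
@[simp] theorem zero_im : (0 : Cx V).im = 0 := rfl
@[simp] theorem add_re (a b : Cx V) : (a + b).re = a.re + b.re := rfl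
@[simp] theorem add_im (a b : Cx V) : (a + b).im = a.im + b.im := rfl
@[simp] theorem neg_re (a : Cx V) : (-a).re = -a.re := rfl
@[simp] theorem neg_im (a : Cx V) : (-a).im = -a.im := rfl
@[simp] theorem sub_re (a b : Cx V) : (a - b).re = a.re - b.re := rfl
@[simp] theorem sub_im (a b : Cx V) : (a - b).im = a.im - b.im := rfl

instance : AddCommGroup (Cx V) :=
  Function.Injective.addCommGroup (fun a : Cx V => (a.re, a.im))
    (fun _ _ h => Cx.ext (congrArg Prod.fst h) (congrArg Prod.snd h))
    rfl (fun _ _ => rfl) (fun _ => rfl) (fun _ _ => rfl) (fun _ _ => rfl) (fun _ _ => rfl)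

/-- Complex conjugation `x + i y ↦ x - i y`. -/
def conj (a : Cx V) : Cx V := ⟨a.re, -a.im⟩

@[simp] theorem conj_re (a : Cx V) : (conj a).re = a.re := rfl
@[simp] theorem conj_im (a : Cx V) : (conj a).im = -a.im := rfl
@[simp] theorem conj_conj (a : Cx V) : conj (conj a) = a := by ext <;> simp

/-- The real vector `x` viewed in `V ⊗ ℂ`. -/
def ofReal (x : V) : Cx V := ⟨x, 0⟩

variable [Module ℝ V] [Module ℝ W]

instance : SMul ℂ (Cx V) :=
  ⟨fun c a => ⟨c.re • a.re - c.im • a.im, c.re • a.im + c.im • a.re⟩⟩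

@[simp] theorem smul_re (c : ℂ) (a : Cx V) : (c • a).re = c.re • a.re - c.im • a.im := rfl
@[simp] theorem smul_im (c : ℂ) (a : Cx V) : (c • a).im = c.re • a.im + c.im • a.re := rfl

instance : Module ℂ (Cx V) where
  one_smul a := by ext <;> simp
  mul_smul c d a := by ext <;> simp <;> module
  smul_zero c := by ext <;> simp
  smul_add c a b := by ext <;> simp <;> module
  add_smul c d a := by ext <;> simp <;> module
  zero_smul a := by ext <;> simp

/-- The complex-conjugate `P̄` of a complex subspace `P ⊆ V ⊗ ℂ`. -/
def conjSub (P : Submodule ℂ (Cx V)) : Submodule ℂ (Cx V) where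
  carrier := {a | conj a ∈ P}
  zero_mem' := by
    have h : conj (0 : Cx V) = 0 := by ext <;> simp
    simp [h]
  add_mem' := by
    intro a b ha hb
    have h : conj (a + b) = conj a + conj b := by ext <;> simp [add_comm]
    simpa [h] using P.add_mem ha hb
  smul_mem' := by
    intro c a ha
    have h : conj (c • a) = (starRingEnd ℂ c) • conj a := by
      ext <;> simp [add_comm]
    simpa [h] using P.smul_mem _ ha

/-- Complex-linear extension of a real linear map. -/
def map (f : V →ₗ[ℝ] W) : Cx V →ₗ[ℂ] Cx W where
  toFun a := ⟨f a.re, f a.im⟩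
  map_add' a b := by ext <;> simp
  map_smul' c a := by ext <;> simp

/-- Complex-bilinear extension of a real bilinear form. -/
def bilin (b : V →ₗ[ℝ] V →ₗ[ℝ] ℝ) (u v : Cx V) : ℂ :=
  ⟨b u.re v.re - b u.im v.im, b u.re v.im + b u.im v.re⟩

end

end Cx

open Cx

/-! ### Complex vector fields and subbundles of the complexified tangent bundle -/

section Real

variable {E : Type*} [NormedAddCommGroup E] [NormedSpace ℝ E]
  {M : Type*} [TopologicalSpace M] [ChartedSpace E M] [IsManifold 𝓘(ℝ, E) ∞ M]

/-- The fibre at `x` of the complexified real tangent bundle `T_{M_ℂ}`. -/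
abbrev TC (E : Type*) [NormedAddCommGroup E] [NormedSpace ℝ E]
    {M : Type*} [TopologicalSpace M] [ChartedSpace E M] (x : M) : Type _ :=
  Cx (TangentSpace 𝓘(ℝ, E) x)

/-- The real vector field `X` is smooth on `U`. -/
def RealSmoothOn (U : Set M) (X : ∀ x : M, TangentSpace 𝓘(ℝ, E) x) : Prop :=
  ContMDiffOn 𝓘(ℝ, E) (𝓘(ℝ, E).tangent) ∞ (fun x => (⟨x, X x⟩ : TangentBundle 𝓘(ℝ, E) M)) U

/-- The complex vector field `X` is smooth on `U`. -/
def SmoothOn (U : Set M) (X : ∀ x : M, TC E x) : Prop :=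
  RealSmoothOn U (fun x => (X x).re) ∧ RealSmoothOn U (fun x => (X x).im)

/-- The complex-bilinear extension of the Lie bracket of vector fields. -/
def bracket (X Y : ∀ x : M, TC E x) (x : M) : TC E x :=
  ⟨VectorField.mlieBracket 𝓘(ℝ, E) (fun y => (X y).re) (fun y => (Y y).re) x
      - VectorField.mlieBracket 𝓘(ℝ, E) (fun y => (X y).im) (fun y => (Y y).im) x,
    VectorField.mlieBracket 𝓘(ℝ, E) (fun y => (X y).re) (fun y => (Y y).im) x
      + VectorField.mlieBracket 𝓘(ℝ, E) (fun y => (X y).im) (fun y => (Y y).re) x⟩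

/-- `X` is a smooth section over the set `U` of the family of subspaces `T`. -/
def IsSectionOn (T : ∀ x : M, Submodule ℂ (TC E x)) (U : Set M) (X : ∀ x : M, TC E x) : Prop :=
  SmoothOn U X ∧ ∀ x ∈ U, X x ∈ T x

/-- The family `T` is a smooth complex subbundle: it has smooth local frames. -/
def IsSmoothSubbundle (T : ∀ x : M, Submodule ℂ (TC E x)) : Prop :=
  ∀ x₀ : M, ∃ U : Set M, IsOpen U ∧ x₀ ∈ U ∧ ∃ (k : ℕ) (e : Fin k → ∀ x : M, TC E x),
    (∀ i, SmoothOn U (e i)) ∧ ∀ x ∈ U, LinearIndependent ℂ (fun i => e i x) ∧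
      Submodule.span ℂ (range fun i => e i x) = T x

/-- `[T, T] ⊆ T`. -/
def Involutive (T : ∀ x : M, Submodule ℂ (TC E x)) : Prop :=
  ∀ (U : Set M) (X Y : ∀ x : M, TC E x), IsOpen U → IsSectionOn T U X → IsSectionOn T U Y →
    ∀ x ∈ U, bracket X Y x ∈ T x

/-- For a field `X` on an open set `U`: the brackets `[T̄, X]` lie in `T̄`, where `T̄` is the
conjugate of `T`. If `T` is the bundle of `(1,0)`-vectors of a complex manifold and `X` is a section
of `T`, this says that `X` is holomorphic. -/
def BracketPreservesConj (T : ∀ x : M, Submodule ℂ (TC E x)) (U : Set M)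
    (X : ∀ x : M, TC E x) : Prop :=
  ∀ (U' : Set M) (u : ∀ x : M, TC E x), IsOpen U' → U' ⊆ U →
    IsSectionOn (fun x => conjSub (T x)) U' u → ∀ x ∈ U', bracket u X x ∈ conjSub (T x)

/-- `X` is a holomorphic section over the open set `U` of the bundle `T` of `(1,0)`-vectors. -/
def IsHolSectionOn (T : ∀ x : M, Submodule ℂ (TC E x)) (U : Set M) (X : ∀ x : M, TC E x) : Prop :=
  IsSectionOn T U X ∧ BracketPreservesConj T U X

/-- `om` is a smooth real two-form. -/
def IsSmoothTwoForm (om : ∀ x : M, TangentSpace 𝓘(ℝ, E) x →ₗ[ℝ] TangentSpace 𝓘(ℝ, E) x →ₗ[ℝ] ℝ) :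
    Prop :=
  (∀ x v, om x v v = 0) ∧
  ∀ (U : Set M) (X Y : ∀ x : M, TangentSpace 𝓘(ℝ, E) x), IsOpen U →
    RealSmoothOn U X → RealSmoothOn U Y →
    ContMDiffOn 𝓘(ℝ, E) 𝓘(ℝ, ℝ) ∞ (fun x => om x (X x) (Y x)) U

/-- `X(f)` at `x`, the derivative of the function `f` along the tangent vector `v` at `x`. -/
def dirDeriv (f : M → ℝ) (x : M) (v : TangentSpace 𝓘(ℝ, E) x) : ℝ :=
  mfderiv 𝓘(ℝ, E) 𝓘(ℝ, ℝ) f x v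

/-- `d om = 0`, by the invariant formula for the exterior derivative of a two-form. -/
def IsClosedTwoForm (om : ∀ x : M, TangentSpace 𝓘(ℝ, E) x →ₗ[ℝ] TangentSpace 𝓘(ℝ, E) x →ₗ[ℝ] ℝ) :
    Prop :=
  ∀ (U : Set M) (X Y W : ∀ x : M, TangentSpace 𝓘(ℝ, E) x), IsOpen U →
    RealSmoothOn U X → RealSmoothOn U Y → RealSmoothOn U W → ∀ x ∈ U,
      dirDeriv (fun y => om y (Y y) (W y)) x (X x)
        - dirDeriv (fun y => om y (X y) (W y)) x (Y x)
        + dirDeriv (fun y => om y (X y) (Y y)) x (W x)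
        - om x (VectorField.mlieBracket 𝓘(ℝ, E) X Y x) (W x)
        + om x (VectorField.mlieBracket 𝓘(ℝ, E) X W x) (Y x)
        - om x (VectorField.mlieBracket 𝓘(ℝ, E) Y W x) (X x) = 0

end Real

/-! ### The complex base manifold -/

section Base

variable {ES : Type*} [NormedAddCommGroup ES] [NormedSpace ℂ ES]
  {S : Type*} [TopologicalSpace S] [ChartedSpace ES S]

/-- A complex manifold is a real smooth manifold. -/
instance isManifold_real [IsManifold 𝓘(ℂ, ES) ω S] : IsManifold 𝓘(ℝ, ES) ∞ S := by
  apply isManifold_of_contDiffOn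
  intro e e' he he'
  have h := (contDiffGroupoid ω 𝓘(ℂ, ES)).compatible he he'
  rw [contDiffGroupoid, mem_groupoid_of_pregroupoid] at h
  have h1 : ContDiffOn ℂ ω (𝓘(ℂ, ES) ∘ (e.symm.trans e') ∘ 𝓘(ℂ, ES).symm)
      (𝓘(ℂ, ES).symm ⁻¹' (e.symm.trans e').source ∩ range 𝓘(ℂ, ES)) := h.1
  exact (h1.restrict_scalars ℝ).of_le le_top

/-- The complex structure on the real tangent space of `S` (multiplication by `i`). -/
def tangentI (s : S) : TangentSpace 𝓘(ℝ, ES) s →ₗ[ℝ] TangentSpace 𝓘(ℝ, ES) s :=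
  show ES →ₗ[ℝ] ES from
    { toFun := fun v => Complex.I • v
      map_add' := fun v w => smul_add _ v w
      map_smul' := fun r v => smul_comm _ r v }

/-- The projection `T_{S_ℂ} → T_S` to the `(1,0)`-part, `v ↦ (v - i J v) / 2`. -/
def p10 (s : S) : TC ES s →ₗ[ℂ] TC ES s :=
  (1 / 2 : ℂ) • (LinearMap.id - Complex.I • Cx.map (tangentI s))

/-- The projection `T_{S_ℂ} → T̄_S` to the `(0,1)`-part, `v ↦ (v + i J v) / 2`. -/
def p01 (s : S) : TC ES s →ₗ[ℂ] TC ES s :=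
  (1 / 2 : ℂ) • (LinearMap.id + Complex.I • Cx.map (tangentI s))

/-- `T_S`, the `(1,0)`-vectors in `T_{S_ℂ}`. -/
def T10 (s : S) : Submodule ℂ (TC ES s) := LinearMap.ker (p01 s)

/-- `T̄_S`, the `(0,1)`-vectors in `T_{S_ℂ}`. -/
def T01 (s : S) : Submodule ℂ (TC ES s) := LinearMap.ker (p10 s)

/-- `a` is a holomorphic vector field of type `(1,0)` on `V`. The real part identifies `T_S` with
the holomorphic tangent bundle of the complex manifold `S`. -/
def IsHolFieldOn [IsManifold 𝓘(ℂ, ES) ω S] (V : Set S) (a : ∀ s : S, TC ES s) : Prop :=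
  (∀ s ∈ V, a s ∈ T10 s) ∧
  ContMDiffOn 𝓘(ℂ, ES) (𝓘(ℂ, ES).tangent) ω
    (fun s => (⟨s, (show ES from (a s).re)⟩ : TangentBundle 𝓘(ℂ, ES) S)) V

end Base

/-! ### Complex fibre bundles -/

section Fibration

variable {ES : Type*} [NormedAddCommGroup ES] [NormedSpace ℂ ES]
  {S : Type*} [TopologicalSpace S] [ChartedSpace ES S] [IsManifold 𝓘(ℂ, ES) ω S]
  {EZ : Type*} [NormedAddCommGroup EZ] [NormedSpace ℝ EZ]
  {Z : Type*} [TopologicalSpace Z] [ChartedSpace EZ Z] [IsManifold 𝓘(ℝ, EZ) ∞ Z]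

/-- `α : Z → S` is a differentiable fibre bundle with typical fibre `F`. -/
def IsSmoothFiberBundle (EF : Type*) [NormedAddCommGroup EF] [NormedSpace ℝ EF]
    (F : Type*) [TopologicalSpace F] [ChartedSpace EF F] (α : Z → S) : Prop :=
  ContMDiff 𝓘(ℝ, EZ) 𝓘(ℝ, ES) ∞ α ∧
  ∀ s : S, ∃ e : Bundle.Trivialization F α, s ∈ e.baseSet ∧
    ContMDiffOn 𝓘(ℝ, EZ) (𝓘(ℝ, ES).prod 𝓘(ℝ, EF)) ∞ e e.source ∧
    ContMDiffOn (𝓘(ℝ, ES).prod 𝓘(ℝ, EF)) 𝓘(ℝ, EZ) ∞ e.toOpenPartialHomeomorph.symm e.target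

/-- The differential of `α` on complexified tangent spaces. -/
def dC (α : Z → S) (z : Z) : TC EZ z →ₗ[ℂ] TC ES (α z) :=
  Cx.map (mfderiv 𝓘(ℝ, EZ) 𝓘(ℝ, ES) α z).toLinearMap

/-- `T` is an integrable complex structure on the real relative tangent bundle of `α`:
`T ⊕ T̄ = T_{Z_ℂ/S}` and `[T, T] ⊆ T`. So `(α, T)` is a complex fibre bundle. -/
structure IsRelComplexStructure (α : Z → S) (T : ∀ z : Z, Submodule ℂ (TC EZ z)) : Prop where
  smooth : IsSmoothSubbundle T
  sup_eq : ∀ z, T z ⊔ conjSub (T z) = LinearMap.ker (dC (ES := ES) α z)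
  disjoint : ∀ z, Disjoint (T z) (conjSub (T z))
  involutive : Involutive T

/-- `T` is a complex structure on the complex fibre bundle `(α, Trel)`. By Newlander-Nirenberg it
makes `α` a holomorphic fibration with holomorphic relative tangent bundle `Trel`. -/
structure IsComplexStructure (α : Z → S) (Trel T : ∀ z : Z, Submodule ℂ (TC EZ z)) : Prop where
  smooth : IsSmoothSubbundle T
  rel_le : ∀ z, Trel z ≤ T z
  isCompl : ∀ z, IsCompl (T z) (conjSub (T z))
  map_le : ∀ z, (T z).map (dC (ES := ES) α z) ≤ T10 (α z)
  involutive : Involutive T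

/-- A morphism `α^* T_{S_ℂ} → T_{Z_ℂ}`, pointwise. Morphisms defined on `α^* T_S` or
on `α^* T̄_S` only are extended by zero to the other summand of `α^* T_{S_ℂ}`. -/
abbrev PreHom (α : Z → S) : Type _ := ∀ z : Z, TC ES (α z) →ₗ[ℂ] TC EZ z

/-- A morphism `α^* T_{S_ℂ} → T_{Z_ℂ} / T̄rel`, pointwise, with the same convention. -/
abbrev PreQuotHom (α : Z → S) (Trel : ∀ z : Z, Submodule ℂ (TC EZ z)) : Type _ :=
  ∀ z : Z, TC ES (α z) →ₗ[ℂ] (TC EZ z ⧸ conjSub (Trel z))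

/-- `L` is smooth over the set `U`. -/
def SmoothHomOn (α : Z → S) (U : Set Z) (L : PreHom (ES := ES) (EZ := EZ) α) : Prop :=
  ∀ (V : Set S) (a : ∀ s : S, TC ES s), IsOpen V → SmoothOn V a →
    SmoothOn (U ∩ α ⁻¹' V) (fun z => L z (a (α z)))

/-- The class of a morphism to `T_{Z_ℂ}` modulo `T̄rel`. -/
def toQuot {α : Z → S} (Trel : ∀ z : Z, Submodule ℂ (TC EZ z))
    (L : PreHom (ES := ES) (EZ := EZ) α) : PreQuotHom (ES := ES) α Trel :=
  fun z => (conjSub (Trel z)).mkQ ∘ₗ L z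

/-- `L` is a smooth lifting to `T_{Z_ℂ}` of `D` over the open set `U`. -/
def IsLiftOn (α : Z → S) (Trel : ∀ z : Z, Submodule ℂ (TC EZ z)) (D : PreQuotHom (ES := ES) α Trel)
    (U : Set Z) (L : PreHom (ES := ES) (EZ := EZ) α) : Prop :=
  IsOpen U ∧ SmoothHomOn α U L ∧ ∀ z ∈ U, toQuot Trel L z = D z

/-- `D` is a differentiable splitting of the projection of `T_{Z_ℂ} / T̄rel` to the summand of
`α^* T_{S_ℂ}` onto which `p` projects. -/
structure IsSplitting (α : Z → S) (Trel : ∀ z : Z, Submodule ℂ (TC EZ z))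
    (p : ∀ s : S, TC ES s →ₗ[ℂ] TC ES s) (D : PreQuotHom (ES := ES) α Trel) : Prop where
  smooth : ∀ z₀ : Z, ∃ U L, z₀ ∈ U ∧ IsLiftOn α Trel D U L
  comp_proj : ∀ z v, D z (p (α z) v) = D z v
  split : ∀ z v w, (conjSub (Trel z)).mkQ w = D z v → dC α z w = p (α z) v

/-- `D` is a `∂̄`-operator on the complex fibre bundle `(α, Trel)`. -/
def IsDbarOperator (α : Z → S) (Trel : ∀ z : Z, Submodule ℂ (TC EZ z))
    (D : PreQuotHom (ES := ES) α Trel) : Prop :=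
  IsSplitting α Trel p01 D

/-- `D` is an almost connection on the complex fibre bundle `(α, Trel)`. -/
def IsAlmostConnection (α : Z → S) (Trel : ∀ z : Z, Submodule ℂ (TC EZ z))
    (D : PreQuotHom (ES := ES) α Trel) : Prop :=
  IsSplitting α Trel p10 D

/-- `T̄`, the inverse image in `T_{Z_ℂ}` of the image of the `∂̄`-operator `D`. -/
def Tbar {α : Z → S} {Trel : ∀ z : Z, Submodule ℂ (TC EZ z)} (D : PreQuotHom (ES := ES) α Trel)
    (z : Z) : Submodule ℂ (TC EZ z) :=
  (LinearMap.range (D z)).comap (conjSub (Trel z)).mkQ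

/-- The almost complex structure `T` corresponding to the `∂̄`-operator `D`. -/
def almostCx {α : Z → S} {Trel : ∀ z : Z, Submodule ℂ (TC EZ z)}
    (D : PreQuotHom (ES := ES) α Trel) (z : Z) : Submodule ℂ (TC EZ z) :=
  conjSub (Tbar D z)

/-- The `∂̄`-operator `D` comes from a complex structure on `(α, Trel)`: it is the `∂̄`-operator
of a holomorphic fibration with underlying complex fibre bundle `(α, Trel)`. -/
def IsHolomorphicFibration (α : Z → S) (Trel : ∀ z : Z, Submodule ℂ (TC EZ z))
    (D : PreQuotHom (ES := ES) α Trel) : Prop :=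
  IsDbarOperator α Trel D ∧ IsComplexStructure (ES := ES) α Trel (almostCx D)

/-- `[T̄rel, im L] ⊆ T̄rel` over `U`. Here `im L` consists of the images of the (pulled back) local
vector fields of the base. -/
def VerticallyHolOn (α : Z → S) (Trel : ∀ z : Z, Submodule ℂ (TC EZ z)) (U : Set Z)
    (L : PreHom (ES := ES) (EZ := EZ) α) : Prop :=
  ∀ (V : Set S) (a : ∀ s : S, TC ES s), IsOpen V → SmoothOn V a →
    BracketPreservesConj Trel (U ∩ α ⁻¹' V) (fun z => L z (a (α z)))

/-- The local lifting condition for a `∂̄`-operator or an almost connection `D`. -/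
def LocalLifting (α : Z → S) (Trel : ∀ z : Z, Submodule ℂ (TC EZ z))
    (D : PreQuotHom (ES := ES) α Trel) : Prop :=
  ∀ z₀ : Z, ∃ U L, z₀ ∈ U ∧ IsLiftOn α Trel D U L ∧ VerticallyHolOn α Trel U L

/-! ### Connections and Higgs fields -/

/-- `C` is an almost connection on `(α, T)`, given as a splitting with values in `T`
(which embeds in `T_{Z_ℂ} / T̄rel`). -/
structure IsConnectionIn (α : Z → S) (T : ∀ z : Z, Submodule ℂ (TC EZ z))
    (C : PreHom (ES := ES) (EZ := EZ) α) : Prop where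
  smooth : SmoothHomOn α univ C
  comp_proj : ∀ z v, C z (p10 (α z) v) = C z v
  mem : ∀ z v, C z v ∈ T z
  split : ∀ z v, dC α z (C z v) = p10 (α z) v

/-- `N` is a flat holomorphic connection on the holomorphic fibration with complex structure `T`,
i.e. a holomorphic transversal foliation. -/
structure IsFlatHolConnection (α : Z → S) (T : ∀ z : Z, Submodule ℂ (TC EZ z))
    (N : PreHom (ES := ES) (EZ := EZ) α) : Prop where
  connection : IsConnectionIn α T N
  holomorphic : ∀ (V : Set S) (a : ∀ s : S, TC ES s), IsOpen V → IsHolFieldOn V a →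
    IsHolSectionOn T (α ⁻¹' V) (fun z => N z (a (α z)))
  flat : Involutive (fun z => LinearMap.range (N z))

/-- `Θ` is an almost Higgs field on `(α, Trel)`: a smooth section of `α^*Ω_S ⊗ Trel`. -/
structure IsAlmostHiggs (α : Z → S) (Trel : ∀ z : Z, Submodule ℂ (TC EZ z))
    (Θ : PreHom (ES := ES) (EZ := EZ) α) : Prop where
  smooth : SmoothHomOn α univ Θ
  comp_proj : ∀ z v, Θ z (p10 (α z) v) = Θ z v
  mem : ∀ z v, Θ z v ∈ Trel z

/-- The `∂̄`-operator `D` and `Θ` define a holomorphic Higgs bundle with underlying complex fibre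
bundle `(α, Trel)`: `D` is integrable, and `Θ` is a holomorphic Higgs field, i.e. it maps
holomorphic vector fields on `V ⊆ S` to holomorphic vertical fields on `α⁻¹ V`, and
`[Θ, Θ] = 0`. -/
structure IsHolHiggsBundle (α : Z → S) (Trel : ∀ z : Z, Submodule ℂ (TC EZ z))
    (D : PreQuotHom (ES := ES) α Trel) (Θ : PreHom (ES := ES) (EZ := EZ) α) : Prop where
  fibration : IsHolomorphicFibration α Trel D
  almostHiggs : IsAlmostHiggs α Trel Θ
  holomorphic : ∀ (V : Set S) (a : ∀ s : S, TC ES s), IsOpen V → IsHolFieldOn V a →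
    IsHolSectionOn (almostCx D) (α ⁻¹' V) (fun z => Θ z (a (α z)))
  integrable : ∀ (V : Set S) (a b : ∀ s : S, TC ES s), IsOpen V →
    IsHolFieldOn V a → IsHolFieldOn V b → ∀ z ∈ α ⁻¹' V,
      bracket (fun z => Θ z (a (α z))) (fun z => Θ z (b (α z))) z = 0

/-! ### Hermitian metrics -/

/-- `om` is a hermitian metric on `(α, Trel)`: a closed real two-form on `Z` whose restriction to
each fibre is of type `(1,1)` and positive definite. -/
structure IsHermitianMetric (α : Z → S) (Trel : ∀ z : Z, Submodule ℂ (TC EZ z))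
    (om : ∀ z : Z, TangentSpace 𝓘(ℝ, EZ) z →ₗ[ℝ] TangentSpace 𝓘(ℝ, EZ) z →ₗ[ℝ] ℝ) : Prop where
  smooth : IsSmoothTwoForm om
  closed : IsClosedTwoForm om
  type11 : ∀ z, ∀ u ∈ Trel z, ∀ v ∈ Trel z, bilin (om z) u v = 0
  pos : ∀ z, ∀ u ∈ Trel z, u ≠ 0 → 0 < (-Complex.I * bilin (om z) u (conj u)).re

/-- `C` is the Chern connection of `om` with respect to `T ⊇ Trel`: the almost connection on
`(α, T)` whose image is orthogonal to `Trel`. -/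
def IsChernConnection (α : Z → S) (Trel T : ∀ z : Z, Submodule ℂ (TC EZ z))
    (om : ∀ z : Z, TangentSpace 𝓘(ℝ, EZ) z →ₗ[ℝ] TangentSpace 𝓘(ℝ, EZ) z →ₗ[ℝ] ℝ)
    (C : PreHom (ES := ES) (EZ := EZ) α) : Prop :=
  IsConnectionIn α T C ∧ ∀ z v, ∀ u ∈ Trel z, bilin (om z) (C z v) (conj u) = 0

/-- `ξ` belongs to the Lie algebra of the group of holomorphic isometries of the fibre
`Z_s = α⁻¹ s` with complex structure `Trel` and metric `om`: it is a smooth vector field on `Z_s`,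
it preserves the complex structure and the Kähler form infinitesimally, and it is complete. -/
def IsFiberAut (α : Z → S) (Trel : ∀ z : Z, Submodule ℂ (TC EZ z))
    (om : ∀ z : Z, TangentSpace 𝓘(ℝ, EZ) z →ₗ[ℝ] TangentSpace 𝓘(ℝ, EZ) z →ₗ[ℝ] ℝ) (s : S)
    (ξ : ∀ z : {z : Z // α z = s}, TangentSpace 𝓘(ℝ, EZ) (z : Z)) : Prop :=
  (∀ z₀ : {z : Z // α z = s}, ∃ (U : Set Z) (X : ∀ z : Z, TangentSpace 𝓘(ℝ, EZ) z),
    IsOpen U ∧ (z₀ : Z) ∈ U ∧ RealSmoothOn U X ∧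
    (∀ z ∈ U, mfderiv 𝓘(ℝ, EZ) 𝓘(ℝ, ES) α z (X z) = 0) ∧
    (∀ z : {z : Z // α z = s}, (z : Z) ∈ U → X z = ξ z) ∧
    (∀ (U' : Set Z) (u : ∀ z : Z, TC EZ z), IsOpen U' → U' ⊆ U →
      IsSectionOn (fun z => conjSub (Trel z)) U' u →
      ∀ z ∈ U', α z = s → bracket (fun z => ofReal (X z)) u z ∈ conjSub (Trel z)) ∧
    (∀ (U' : Set Z) (Y W : ∀ z : Z, TangentSpace 𝓘(ℝ, EZ) z), IsOpen U' → U' ⊆ U →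
      RealSmoothOn U' Y → RealSmoothOn U' W →
      (∀ z ∈ U', mfderiv 𝓘(ℝ, EZ) 𝓘(ℝ, ES) α z (Y z) = 0) →
      (∀ z ∈ U', mfderiv 𝓘(ℝ, EZ) 𝓘(ℝ, ES) α z (W z) = 0) →
      ∀ z ∈ U', α z = s →
        dirDeriv (fun y => om y (Y y) (W y)) z (X z)
          = om z (VectorField.mlieBracket 𝓘(ℝ, EZ) X Y z) (W z)
            + om z (Y z) (VectorField.mlieBracket 𝓘(ℝ, EZ) X W z))) ∧
  (∀ z₀ : {z : Z // α z = s}, ∃ γ : ℝ → {z : Z // α z = s}, γ 0 = z₀ ∧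
    ∀ t, HasMFDerivAt 𝓘(ℝ, ℝ) 𝓘(ℝ, EZ) (fun τ => (γ τ : Z)) t
      ((1 : ℝ →L[ℝ] ℝ).smulRight (ξ (γ t))))

/-- The Lie algebras of the groups of holomorphic isometries of the fibres are finite-dimensional,
of a dimension that does not depend on the fibre. -/
def IsAutoFinite (α : Z → S) (Trel : ∀ z : Z, Submodule ℂ (TC EZ z))
    (om : ∀ z : Z, TangentSpace 𝓘(ℝ, EZ) z →ₗ[ℝ] TangentSpace 𝓘(ℝ, EZ) z →ₗ[ℝ] ℝ) : Prop :=
  ∃ d : ℕ, ∀ s : S,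
    Module.Finite ℝ (Submodule.span ℝ {ξ | IsFiberAut (ES := ES) α Trel om s ξ}) ∧
    Module.finrank ℝ (Submodule.span ℝ {ξ | IsFiberAut (ES := ES) α Trel om s ξ}) = d

/-- `u` is the `(1,0)`-part of (that is, the section of `Trel` corresponding to) the infinitesimal
holomorphic isometry `u + ū` of the fibre over `s`. -/
def IsFiberAut10 (α : Z → S) (Trel : ∀ z : Z, Submodule ℂ (TC EZ z))
    (om : ∀ z : Z, TangentSpace 𝓘(ℝ, EZ) z →ₗ[ℝ] TangentSpace 𝓘(ℝ, EZ) z →ₗ[ℝ] ℝ) (s : S)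
    (u : ∀ z : {z : Z // α z = s}, TC EZ (z : Z)) : Prop :=
  (∀ z : {z : Z // α z = s}, u z ∈ Trel z) ∧ IsFiberAut (ES := ES) α Trel om s (fun z => (u z + conj (u z)).re)

/-- `om` is `Θ`-adapted: it is auto-finite, and `Θ(v)` lies in the complexification of the Lie
algebra of infinitesimal holomorphic isometries of `Z_s`, for each `s` and `v ∈ T_S(s)`.
(The vector `v` is given as the value at `s` of an arbitrary set-theoretic section of `T_S`.) -/
def IsAdapted (α : Z → S) (Trel : ∀ z : Z, Submodule ℂ (TC EZ z))
    (om : ∀ z : Z, TangentSpace 𝓘(ℝ, EZ) z →ₗ[ℝ] TangentSpace 𝓘(ℝ, EZ) z →ₗ[ℝ] ℝ)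
    (Θ : PreHom (ES := ES) (EZ := EZ) α) : Prop :=
  IsAutoFinite (ES := ES) α Trel om ∧
  ∀ (s : S) (v : ∀ s : S, TC ES s), (∀ s, v s ∈ T10 s) →
    ∃ x y : ∀ z : {z : Z // α z = s}, TC EZ (z : Z),
      IsFiberAut10 (ES := ES) α Trel om s x ∧ IsFiberAut10 (ES := ES) α Trel om s y ∧
      ∀ z : {z : Z // α z = s}, Θ z (v (α z)) = x z + Complex.I • y z

/-- `Θbar` is the complex conjugation of `Θ` with respect to `om`: the smooth section of
`α^*Ω̄_S ⊗ Trel` with `Θbar(v̄) = -(x - i y)` on the fibre `Z_s` if `Θ(v) = x + i y`, where `x` and `y`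
are infinitesimal holomorphic isometries of `Z_s`. -/
structure IsComplexConjugation (α : Z → S) (Trel : ∀ z : Z, Submodule ℂ (TC EZ z))
    (om : ∀ z : Z, TangentSpace 𝓘(ℝ, EZ) z →ₗ[ℝ] TangentSpace 𝓘(ℝ, EZ) z →ₗ[ℝ] ℝ)
    (Θ Θbar : PreHom (ES := ES) (EZ := EZ) α) : Prop where
  smooth : SmoothHomOn α univ Θbar
  comp_proj : ∀ z v, Θbar z (p01 (α z) v) = Θbar z v
  conj_eq : ∀ (s : S) (v : ∀ s : S, TC ES s), (∀ s, v s ∈ T10 s) →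
    ∃ x y : ∀ z : {z : Z // α z = s}, TC EZ (z : Z),
      IsFiberAut10 (ES := ES) α Trel om s x ∧ IsFiberAut10 (ES := ES) α Trel om s y ∧
      ∀ z : {z : Z // α z = s}, Θ z (v (α z)) = x z + Complex.I • y z ∧
        Θbar z (conj (v (α z))) = -(x z - Complex.I • y z)

/-! ### The automorphism `β` -/

/-- A real automorphism `β` of `T_{Z_ℂ}` (the complexification of a smooth automorphism of the real
tangent bundle) with `β(TA) = TB` that induces the identity on `α^* T_{S_ℂ}`. -/
structure BundleAut (α : Z → S) (TA TB : ∀ z : Z, Submodule ℂ (TC EZ z)) where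
  toFun : ∀ z : Z, TangentSpace 𝓘(ℝ, EZ) z ≃ₗ[ℝ] TangentSpace 𝓘(ℝ, EZ) z
  smooth : ∀ (U : Set Z) (X : ∀ z : Z, TangentSpace 𝓘(ℝ, EZ) z), IsOpen U →
    RealSmoothOn U X → RealSmoothOn U (fun z => toFun z (X z))
  over_id : ∀ z v, mfderiv 𝓘(ℝ, EZ) 𝓘(ℝ, ES) α z (toFun z v)
    = mfderiv 𝓘(ℝ, EZ) 𝓘(ℝ, ES) α z v
  map_eq : ∀ z, (TA z).map (Cx.map (toFun z).toLinearMap) = TB z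

namespace BundleAut

variable {α : Z → S} {TA TB : ∀ z : Z, Submodule ℂ (TC EZ z)}

/-- `β` on complexified tangent spaces. -/
def C (β : BundleAut (ES := ES) α TA TB) (z : Z) : TC EZ z →ₗ[ℂ] TC EZ z :=
  Cx.map (β.toFun z).toLinearMap

theorem conj_le (β : BundleAut (ES := ES) α TA TB) (z : Z) :
    conjSub (TA z) ≤ (conjSub (TB z)).comap (β.C z) := by
  intro w hw
  have h : conj (β.C z w) = β.C z (conj w) := by
    ext <;> simp [C, Cx.map]
  change conj (β.C z w) ∈ TB z
  rw [h, ← β.map_eq z]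
  exact Submodule.mem_map_of_mem hw

/-- The induced isomorphism `T_{Z_ℂ} / T̄A → T_{Z_ℂ} / T̄B`. -/
def quot (β : BundleAut (ES := ES) α TA TB) (z : Z) :
    (TC EZ z ⧸ conjSub (TA z)) →ₗ[ℂ] (TC EZ z ⧸ conjSub (TB z)) :=
  Submodule.mapQ _ _ (β.C z) (β.conj_le z)

/-- `β ∘ D`. -/
def comp (β : BundleAut (ES := ES) α TA TB) (D : PreQuotHom (ES := ES) α TA) :
    PreQuotHom (ES := ES) α TB :=
  fun z => β.quot z ∘ₗ D z

/-- `β` preserves the local lifting condition of `∂̄`-operators and of almost connections. -/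
def PreservesLocalLifting (β : BundleAut (ES := ES) α TA TB) : Prop :=
  ∀ D : PreQuotHom (ES := ES) α TA, IsDbarOperator α TA D ∨ IsAlmostConnection α TA D →
    (LocalLifting α TA D ↔ LocalLifting α TB (β.comp D))

/-- `β` preserves the two-form `om`. -/
def PreservesForm (β : BundleAut (ES := ES) α TA TB)
    (om : ∀ z : Z, TangentSpace 𝓘(ℝ, EZ) z →ₗ[ℝ] TangentSpace 𝓘(ℝ, EZ) z →ₗ[ℝ] ℝ) : Prop :=
  ∀ z v w, om z (β.toFun z v) (β.toFun z w) = om z v w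

end BundleAut

/-! ### From connections to Higgs fields -/

section Construction

variable {α : Z → S} {TA TB : ∀ z : Z, Submodule ℂ (TC EZ z)}

/-- `θ_ω = ½ β ∘ (∇ - ∂_ω)`, for the connection `N = ∇` and the Chern connection `C = ∂_ω`. -/
def higgsField (β : BundleAut (ES := ES) α TA TB) (N C : PreHom (ES := ES) (EZ := EZ) α) :
    PreHom (ES := ES) (EZ := EZ) α :=
  fun z => (1 / 2 : ℂ) • (β.C z ∘ₗ (N z - C z))

/-- `∂̄_ω = β ∘ ∂̄_f - θ̄_ω`. -/
def dbarOmega (β : BundleAut (ES := ES) α TA TB) (D : PreQuotHom (ES := ES) α TA)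
    (Θbar : PreHom (ES := ES) (EZ := EZ) α) : PreQuotHom (ES := ES) α TB :=
  fun z => β.comp D z - toQuot TB Θbar z

/-- The metric `om` on the flat bundle with Chern connection `C` and connection `N` is allowable. -/
structure IsAllowable (β : BundleAut (ES := ES) α TA TB) (N C : PreHom (ES := ES) (EZ := EZ) α)
    (om : ∀ z : Z, TangentSpace 𝓘(ℝ, EZ) z →ₗ[ℝ] TangentSpace 𝓘(ℝ, EZ) z →ₗ[ℝ] ℝ) : Prop where
  preserved : β.PreservesForm om
  chern : VerticallyHolOn α TA univ C
  adapted : IsAdapted α TB om (higgsField β N C)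

/-- `G` is a smooth section over `S` of `Ω²_{S_ℂ} ⊗ f_* T_{X/S}` where `T_{X/S} = TA`; in adjoint
form, a smooth section over `Z` of `α^*Ω²_{S_ℂ} ⊗ TA` that is holomorphic along the fibres. -/
structure IsFiberHolTwoForm (α : Z → S) (TA : ∀ z : Z, Submodule ℂ (TC EZ z))
    (G : ∀ z : Z, TC ES (α z) →ₗ[ℂ] TC ES (α z) →ₗ[ℂ] TC EZ z) : Prop where
  alternating : ∀ z v, G z v v = 0
  mem : ∀ z v w, G z v w ∈ TA z
  smooth : ∀ (V : Set S) (a b : ∀ s : S, TC ES s), IsOpen V → SmoothOn V a → SmoothOn V b →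
    SmoothOn (α ⁻¹' V) (fun z => G z (a (α z)) (b (α z)))
  holomorphic : ∀ (V : Set S) (a b : ∀ s : S, TC ES s), IsOpen V → SmoothOn V a → SmoothOn V b →
    BracketPreservesConj TA (α ⁻¹' V) (fun z => G z (a (α z)) (b (α z)))

/-- `G = G^{0,2} + G^{1,1} + G^{2,0}` is the curvature tensor of `D'' = D + Θ`, where `D` is
a `∂̄`-operator and `Θ` an almost Higgs field on `(α, TB)`: with `L` any local lifting of `D`,
* `β G(a, b) = [L a, L b]` modulo `T̄_D`, for smooth fields `a`, `b` of type `(0,1)`;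
* `β G(a, b) = [Θ a, L b]` modulo `T̄B`, for `a` holomorphic of type `(1,0)`, `b` smooth of
  type `(0,1)`;
* `β G(a, b) = [Θ a, Θ b]` for smooth fields `a`, `b` of type `(1,0)`. -/
structure IsCurvatureTensor (β : BundleAut (ES := ES) α TA TB) (D : PreQuotHom (ES := ES) α TB)
    (Θ : PreHom (ES := ES) (EZ := EZ) α)
    (G : ∀ z : Z, TC ES (α z) →ₗ[ℂ] TC ES (α z) →ₗ[ℂ] TC EZ z) : Prop where
  isSection : IsFiberHolTwoForm α TA G
  type02 : ∀ (U : Set Z) (L : PreHom (ES := ES) (EZ := EZ) α), IsLiftOn α TB D U L →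
    ∀ (V : Set S) (a b : ∀ s : S, TC ES s), IsOpen V →
      IsSectionOn T01 V a → IsSectionOn T01 V b → ∀ z ∈ U ∩ α ⁻¹' V,
        β.C z (G z (a (α z)) (b (α z)))
          - bracket (fun z => L z (a (α z))) (fun z => L z (b (α z))) z ∈ Tbar D z
  type11 : ∀ (U : Set Z) (L : PreHom (ES := ES) (EZ := EZ) α), IsLiftOn α TB D U L →
    ∀ (V : Set S) (a b : ∀ s : S, TC ES s), IsOpen V →
      IsHolFieldOn V a → IsSectionOn T01 V b → ∀ z ∈ U ∩ α ⁻¹' V,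
        β.C z (G z (a (α z)) (b (α z)))
          - bracket (fun z => Θ z (a (α z))) (fun z => L z (b (α z))) z ∈ conjSub (TB z)
  type20 : ∀ (V : Set S) (a b : ∀ s : S, TC ES s), IsOpen V →
    IsSectionOn T10 V a → IsSectionOn T10 V b → ∀ z ∈ α ⁻¹' V,
      β.C z (G z (a (α z)) (b (α z)))
        = bracket (fun z => Θ z (a (α z))) (fun z => Θ z (b (α z))) z

end Construction

end Fibration

end NLHodge

end

open NLHodge

/-! Write θ for θ_ω, and let L be a smooth local lifting of ∂̄_ω and M = L + θ. The decisive
property of M is that it is holomorphic along the fibres: brackets of sections of T̄_B with M(a)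
stay in T̄_B (`HomPresAt`). Take a, b with constant coefficients in a chart of S. Then [M(a), M(b)]
modulo T̄_B does not depend on L (`bracket_sub_bracket_mem`), and the bracket is vertical because
M(a), M(b) project to commuting fields (`dC_bracket`). Since the vertical bundle is T_B ⊕ T̄_B, the
class is represented by a unique vector of T_B, and β⁻¹ of it is G(a, b) (`exists_isBracketTensor`).

For arbitrary fields the Leibniz rule adds images of derivatives of the coefficients
(`bracket_hom`). For two (0,1)-fields these lie in the image of L, so the formula survives modulo T̄
of ∂̄_ω. For type (1,1) they vanish because θ is vertical and the coefficients of a holomorphic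
field are killed by (0,1)-vectors. For type (2,0) they vanish because θ is vertical, and both sides
lie in T_B, so congruence modulo T̄_B is equality.

Holomorphy of M along the fibres comes from four sources. For ∂̄_f and ∇ it follows from the
holomorphic structure of X, and for ∂_ω from allowability; β transports all three. For θ̄_ω it holds
because infinitesimal isometries preserve the complex structure of the fibre; as these live on
single fibres only, `IsComplexConjugation.homPresAt` compares θ̄_ω with extensions of them.

By the Jacobi identity βG is holomorphic along the fibres for T_B. Going back to T_A is not formal:
β need not respect brackets, and the hypothesis on it concerns only ∂̄-operators and almost
connections. So the vertical form is added to ∂̄_f or ∇, the hypothesis is applied to the sum, and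
the difference is taken (`BundleAut.PreservesLocalLifting.homPresAt_of_comp`).

Uniqueness holds because T_B meets T̄ of ∂̄_ω trivially and β is injective. As for vanishing,
G^{0,2} = 0 together with the local lifting condition says that T̄ of ∂̄_ω is involutive, G^{1,1} =
0 adds that θ of a holomorphic field is holomorphic, and G^{2,0} is [θ, θ].

All smoothness is handled through germs: `SmAt`, `SectAt`, `PresAt` and `FrameAt` replace the
conditions on open sets. -/

section

set_option linter.unusedSectionVars false

open Filter Topology NLHodge.Cx

noncomputable section

namespace NLHodge

/-! ### Conjugation in the complexification of a real vector space. -/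

namespace Cx
variable {V : Type*} [AddCommGroup V] [Module ℝ V]

theorem conj_add (a b : Cx V) : conj (a + b) = conj a + conj b := by ext <;> simp [add_comm]
theorem conj_smul (c : ℂ) (a : Cx V) : conj (c • a) = (starRingEnd ℂ c) • conj a := by
  ext <;> simp [add_comm]
@[simp] theorem conj_zero : conj (0 : Cx V) = 0 := by ext <;> simp
theorem sum_re {ι : Type*} (s : Finset ι) (f : ι → Cx V) : (∑ i ∈ s, f i).re = ∑ i ∈ s, (f i).re :=
  map_sum (⟨⟨Cx.re, rfl⟩, fun _ _ => rfl⟩ : Cx V →+ V) f s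

theorem sum_im {ι : Type*} (s : Finset ι) (f : ι → Cx V) : (∑ i ∈ s, f i).im = ∑ i ∈ s, (f i).im :=
  map_sum (⟨⟨Cx.im, rfl⟩, fun _ _ => rfl⟩ : Cx V →+ V) f s

theorem conj_sum {ι : Type*} (s : Finset ι) (f : ι → Cx V) :
    conj (∑ i ∈ s, f i) = ∑ i ∈ s, conj (f i) :=
  map_sum (⟨⟨conj, conj_zero⟩, conj_add⟩ : Cx V →+ Cx V) f s

theorem mem_conjSub {P : Submodule ℂ (Cx V)} {a : Cx V} : a ∈ conjSub P ↔ conj a ∈ P := Iff.rfl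

@[simp] theorem conjSub_conjSub (P : Submodule ℂ (Cx V)) : conjSub (conjSub P) = P := by
  ext a; simp [mem_conjSub]

end Cx

/-! ### Germs of smooth fields and functions. -/

section Fields

variable {E : Type*} [NormedAddCommGroup E] [NormedSpace ℝ E]
  {M : Type*} [TopologicalSpace M] [ChartedSpace E M] [IsManifold 𝓘(ℝ, E) ∞ M]

/-- The real vector field `X` is smooth on a neighbourhood of `x`. -/
def RSmAt (X : ∀ x : M, TangentSpace 𝓘(ℝ, E) x) (x : M) : Prop :=
  ∀ᶠ y in 𝓝 x, ContMDiffAt 𝓘(ℝ, E) (𝓘(ℝ, E).tangent) ∞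
    (fun x => (⟨x, X x⟩ : TangentBundle 𝓘(ℝ, E) M)) y

/-- The real function `f` is smooth on a neighbourhood of `x`. -/
def RFSmAt (f : M → ℝ) (x : M) : Prop :=
  ∀ᶠ y in 𝓝 x, ContMDiffAt 𝓘(ℝ, E) 𝓘(ℝ, ℝ) ∞ f y

variable {X Y W : ∀ x : M, TangentSpace 𝓘(ℝ, E) x} {x : M} {f : M → ℝ}

namespace RSmAt

theorem mdiff (h : RSmAt X x) : MDifferentiableAt 𝓘(ℝ, E) (𝓘(ℝ, E).tangent)
    (fun x => (⟨x, X x⟩ : TangentBundle 𝓘(ℝ, E) M)) x :=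
  h.self_of_nhds.mdifferentiableAt (by simp)

theorem add (h : RSmAt X x) (h' : RSmAt Y x) : RSmAt (fun y => X y + Y y) x := by
  filter_upwards [h, h'] with y hy hy'
  exact hy.add_section hy'

theorem sub (h : RSmAt X x) (h' : RSmAt Y x) : RSmAt (fun y => X y - Y y) x := by
  filter_upwards [h, h'] with y hy hy'
  exact hy.sub_section hy'

theorem neg (h : RSmAt X x) : RSmAt (fun y => -X y) x := by
  filter_upwards [h] with y hy
  exact hy.neg_section

theorem smul (hf : RFSmAt (E := E) f x) (h : RSmAt X x) : RSmAt (fun y => f y • X y) x := by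
  filter_upwards [hf, h] with y hy hy'
  exact hy.smul_section hy'

theorem zero : RSmAt (0 : ∀ x : M, TangentSpace 𝓘(ℝ, E) x) x :=
  Eventually.of_forall fun y => Bundle.contMDiffAt_zeroSection ℝ (TangentSpace 𝓘(ℝ, E) (M := M))

theorem congr (h : RSmAt X x) (h' : X =ᶠ[𝓝 x] Y) : RSmAt Y x := by
  filter_upwards [h, h'.eventuallyEq_nhds] with y hy hy'
  refine hy.congr_of_eventuallyEq ?_
  filter_upwards [hy'] with z hz
  rw [hz]

theorem eventually (h : RSmAt X x) : ∀ᶠ y in 𝓝 x, RSmAt X y := eventually_eventually_nhds.2 h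

theorem bracket [CompleteSpace E] (h : RSmAt X x) (h' : RSmAt Y x) :
    RSmAt (VectorField.mlieBracket 𝓘(ℝ, E) X Y) x := by
  filter_upwards [h, h'] with y hy hy'
  have : IsManifold 𝓘(ℝ, E) ((⊤ : ℕ∞) + 1) M := by simpa using! ‹IsManifold 𝓘(ℝ, E) ∞ M›
  have : IsManifold 𝓘(ℝ, E) (minSmoothness ℝ 2) M := by simp; infer_instance
  exact ContMDiffAt.mlieBracket_vectorField (m := ⊤) (n := ⊤) hy hy' (by simp)

end RSmAt

theorem realSmoothOn_iff {U : Set M} (hU : IsOpen U) : RealSmoothOn U X ↔ ∀ x ∈ U, RSmAt X x := by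
  constructor
  · intro h x hx
    filter_upwards [hU.mem_nhds hx] with y hy
    exact (h y hy).contMDiffAt (hU.mem_nhds hy)
  · intro h x hx
    exact (h x hx).self_of_nhds.contMDiffWithinAt

namespace RFSmAt
variable {g : M → ℝ}

theorem mdiff (h : RFSmAt (E := E) f x) : MDifferentiableAt 𝓘(ℝ, E) 𝓘(ℝ, ℝ) f x :=
  h.self_of_nhds.mdifferentiableAt (by simp)

theorem neg (h : RFSmAt (E := E) f x) : RFSmAt (E := E) (-f) x := by
  filter_upwards [h] with y hy
  exact hy.neg

theorem const (c : ℝ) : RFSmAt (E := E) (fun _ : M => c) x :=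
  Eventually.of_forall fun _ => contMDiffAt_const

theorem congr (h : RFSmAt (E := E) f x) (h' : f =ᶠ[𝓝 x] g) : RFSmAt (E := E) g x := by
  filter_upwards [h, h'.eventuallyEq_nhds] with y hy hy'
  exact hy.congr_of_eventuallyEq hy'.symm

theorem eventually (h : RFSmAt (E := E) f x) : ∀ᶠ y in 𝓝 x, RFSmAt (E := E) f y :=
  eventually_eventually_nhds.2 h

end RFSmAt

/-! ### Complex vector fields -/

/-- The complex vector field `X` is smooth on a neighbourhood of `x`. -/
def SmAt (X : ∀ x : M, TC E x) (x : M) : Prop :=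
  RSmAt (fun y => (X y).re) x ∧ RSmAt (fun y => (X y).im) x

/-- The complex function `f` is smooth on a neighbourhood of `x`. -/
def FSmAt (E : Type*) [NormedAddCommGroup E] [NormedSpace ℝ E]
    {M : Type*} [TopologicalSpace M] [ChartedSpace E M] (f : M → ℂ) (x : M) : Prop :=
  RFSmAt (E := E) (fun y => (f y).re) x ∧ RFSmAt (E := E) (fun y => (f y).im) x

/-- The derivative of a complex function along a complex tangent vector. -/
def cD (f : M → ℂ) (x : M) (v : TC E x) : ℂ :=
  ⟨dirDeriv (fun y => (f y).re) x v.re - dirDeriv (fun y => (f y).im) x v.im,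
    dirDeriv (fun y => (f y).re) x v.im + dirDeriv (fun y => (f y).im) x v.re⟩

namespace FSmAt
variable {f g : M → ℂ} {x : M}

theorem const (c : ℂ) : FSmAt E (fun _ : M => c) x := ⟨.const _, .const _⟩

theorem congr (h : FSmAt E f x) (h' : f =ᶠ[𝓝 x] g) : FSmAt E g x :=
  ⟨h.1.congr (h'.mono fun _ hy => by simp only [hy]),
    h.2.congr (h'.mono fun _ hy => by simp only [hy])⟩

theorem conj (h : FSmAt E f x) : FSmAt E (fun y => (starRingEnd ℂ) (f y)) x := ⟨h.1, h.2.neg⟩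

theorem eventually (h : FSmAt E f x) : ∀ᶠ y in 𝓝 x, FSmAt E f y := h.1.eventually.and h.2.eventually

end FSmAt

namespace SmAt
variable {X Y W : ∀ x : M, TC E x} {x : M} {f : M → ℂ}

theorem add (h : SmAt X x) (h' : SmAt Y x) : SmAt (fun y => X y + Y y) x :=
  ⟨h.1.add h'.1, h.2.add h'.2⟩

theorem sub (h : SmAt X x) (h' : SmAt Y x) : SmAt (fun y => X y - Y y) x :=
  ⟨h.1.sub h'.1, h.2.sub h'.2⟩

theorem neg (h : SmAt X x) : SmAt (fun y => -X y) x := ⟨h.1.neg, h.2.neg⟩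

theorem conj (h : SmAt X x) : SmAt (fun y => conj (X y)) x := ⟨h.1, h.2.neg⟩

theorem smul (hf : FSmAt E f x) (h : SmAt X x) : SmAt (fun y => f y • X y) x :=
  ⟨(h.1.smul hf.1).sub (h.2.smul hf.2), (h.2.smul hf.1).add (h.1.smul hf.2)⟩

theorem const_smul (c : ℂ) (h : SmAt X x) : SmAt (fun y => c • X y) x := h.smul (.const c)

theorem zero : SmAt (fun _ => 0 : ∀ x : M, TC E x) x := ⟨.zero, .zero⟩

theorem sum {ι : Type*} (s : Finset ι) {X : ι → ∀ x : M, TC E x} (h : ∀ i ∈ s, SmAt (X i) x) :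
    SmAt (fun y => ∑ i ∈ s, X i y) x := by
  classical
  induction s using Finset.induction_on with
  | empty => simpa using zero
  | insert i s hi ih =>
    simp only [Finset.sum_insert hi]
    exact (h i (by simp)).add (ih fun j hj => h j (by simp [hj]))

theorem congr (h : SmAt X x) (h' : ∀ᶠ y in 𝓝 x, X y = Y y) : SmAt Y x :=
  ⟨h.1.congr (h'.mono fun _ hy => congrArg Cx.re hy),
    h.2.congr (h'.mono fun _ hy => congrArg Cx.im hy)⟩

theorem eventually (h : SmAt X x) : ∀ᶠ y in 𝓝 x, SmAt X y := h.1.eventually.and h.2.eventually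

theorem bracket [CompleteSpace E] (h : SmAt X x) (h' : SmAt Y x) : SmAt (bracket X Y) x :=
  ⟨(h.1.bracket h'.1).sub (h.2.bracket h'.2), (h.1.bracket h'.2).add (h.2.bracket h'.1)⟩

end SmAt

theorem smoothOn_iff {U : Set M} (hU : IsOpen U) {X : ∀ x : M, TC E x} :
    SmoothOn U X ↔ ∀ x ∈ U, SmAt X x := by
  simp only [SmoothOn, realSmoothOn_iff hU, SmAt]
  exact ⟨fun h x hx => ⟨h.1 x hx, h.2 x hx⟩, fun h => ⟨fun x hx => (h x hx).1, fun x hx => (h x hx).2⟩⟩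

/-! ### Algebra of the complex bracket: Leibniz rules, Jacobi identity, conjugation. -/

section bracket

variable {X X' Y Y' W : ∀ x : M, TC E x} {x : M} {f : M → ℂ}

theorem bracket_congr (h : ∀ᶠ y in 𝓝 x, X y = X' y) (h' : ∀ᶠ y in 𝓝 x, Y y = Y' y) : bracket X Y x = bracket X' Y' x := by
  have a : (fun y => (X y).re) =ᶠ[𝓝 x] fun y => (X' y).re := h.mono fun _ hy => congrArg Cx.re hy
  have b : (fun y => (X y).im) =ᶠ[𝓝 x] fun y => (X' y).im := h.mono fun _ hy => congrArg Cx.im hy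
  have c : (fun y => (Y y).re) =ᶠ[𝓝 x] fun y => (Y' y).re := h'.mono fun _ hy => congrArg Cx.re hy
  have d : (fun y => (Y y).im) =ᶠ[𝓝 x] fun y => (Y' y).im := h'.mono fun _ hy => congrArg Cx.im hy
  simp only [bracket, a.mlieBracket_vectorField_eq c, a.mlieBracket_vectorField_eq d,
    b.mlieBracket_vectorField_eq c, b.mlieBracket_vectorField_eq d]

theorem bracket_swap (X Y : ∀ x : M, TC E x) (x : M) : bracket X Y x = -bracket Y X x := by
  ext
  · simp only [bracket, neg_re]
    rw [VectorField.mlieBracket_swap_apply (V := fun y => (X y).re),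
      VectorField.mlieBracket_swap_apply (V := fun y => (X y).im)]
    abel
  · simp only [bracket, neg_im]
    rw [VectorField.mlieBracket_swap_apply (V := fun y => (X y).re),
      VectorField.mlieBracket_swap_apply (V := fun y => (X y).im)]
    abel

theorem bracket_self (X : ∀ x : M, TC E x) (x : M) : bracket X X x = 0 := by
  ext
  · simp [bracket]
  · simp only [bracket, zero_im]
    rw [VectorField.mlieBracket_swap_apply (V := fun y => (X y).re)]
    abel

variable [CompleteSpace E]

section real
variable {X X' Y Y' W : ∀ x : M, TangentSpace 𝓘(ℝ, E) x} {f : M → ℝ}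
open VectorField

theorem rb_add_left (hX : RSmAt X x) (hX' : RSmAt X' x) :
    mlieBracket 𝓘(ℝ, E) (fun y => X y + X' y) Y x
      = mlieBracket 𝓘(ℝ, E) X Y x + mlieBracket 𝓘(ℝ, E) X' Y x := by
  have : IsManifold 𝓘(ℝ, E) 2 M := inferInstance
  exact mlieBracket_add_left hX.mdiff hX'.mdiff

theorem rb_add_right (hY : RSmAt Y x) (hY' : RSmAt Y' x) :
    mlieBracket 𝓘(ℝ, E) X (fun y => Y y + Y' y) x
      = mlieBracket 𝓘(ℝ, E) X Y x + mlieBracket 𝓘(ℝ, E) X Y' x :=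
  mlieBracket_add_right hY.mdiff hY'.mdiff

theorem rb_smul_right (hf : RFSmAt (E := E) f x) (hY : RSmAt Y x) :
    mlieBracket 𝓘(ℝ, E) X (fun y => f y • Y y) x
      = dirDeriv f x (X x) • Y x + f x • mlieBracket 𝓘(ℝ, E) X Y x :=
  mlieBracket_smul_right hf.mdiff hY.mdiff

theorem rb_neg_right (hY : RSmAt Y x) :
    mlieBracket 𝓘(ℝ, E) X (fun y => -Y y) x = -mlieBracket 𝓘(ℝ, E) X Y x := by
  have := mlieBracket_const_smul_right (c := (-1 : ℝ)) (V := X) hY.mdiff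
  rw [neg_one_smul, neg_one_smul] at this
  exact this

theorem rb_neg_left (hX : RSmAt X x) :
    mlieBracket 𝓘(ℝ, E) (fun y => -X y) Y x = -mlieBracket 𝓘(ℝ, E) X Y x := by
  rw [mlieBracket_swap_apply, rb_neg_right hX, mlieBracket_swap_apply (V := X)]

theorem rb_sub_right (hY : RSmAt Y x) (hY' : RSmAt Y' x) :
    mlieBracket 𝓘(ℝ, E) X (fun y => Y y - Y' y) x
      = mlieBracket 𝓘(ℝ, E) X Y x - mlieBracket 𝓘(ℝ, E) X Y' x := by
  simp only [sub_eq_add_neg]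
  rw [rb_add_right hY hY'.neg, rb_neg_right hY']

theorem rb_sub_left (hX : RSmAt X x) (hX' : RSmAt X' x) :
    mlieBracket 𝓘(ℝ, E) (fun y => X y - X' y) Y x
      = mlieBracket 𝓘(ℝ, E) X Y x - mlieBracket 𝓘(ℝ, E) X' Y x := by
  simp only [sub_eq_add_neg]
  rw [rb_add_left hX hX'.neg, rb_neg_left hX']

theorem rb_jacobi (hX : RSmAt X x) (hY : RSmAt Y x) (hW : RSmAt W x) :
    mlieBracket 𝓘(ℝ, E) X (mlieBracket 𝓘(ℝ, E) Y W) x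
      = mlieBracket 𝓘(ℝ, E) (mlieBracket 𝓘(ℝ, E) X Y) W x
        + mlieBracket 𝓘(ℝ, E) Y (mlieBracket 𝓘(ℝ, E) X W) x := by
  have : IsManifold 𝓘(ℝ, E) (minSmoothness ℝ 3) M := by simp; infer_instance
  have h2 : minSmoothness ℝ 2 ≤ ∞ := by
    rw [minSmoothness_of_isRCLikeNormedField]; exact WithTop.coe_le_coe.2 le_top
  exact leibniz_identity_mlieBracket_apply (hX.self_of_nhds.of_le h2) (hY.self_of_nhds.of_le h2)
    (hW.self_of_nhds.of_le h2)

end real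

theorem bracket_add_right (hY : SmAt Y x) (hY' : SmAt Y' x) :
    bracket X (fun y => Y y + Y' y) x = bracket X Y x + bracket X Y' x := by
  ext
  · simp only [bracket, add_re, add_im]
    rw [rb_add_right hY.1 hY'.1, rb_add_right hY.2 hY'.2]
    abel
  · simp only [bracket, add_re, add_im]
    rw [rb_add_right hY.1 hY'.1, rb_add_right hY.2 hY'.2]
    abel

theorem bracket_add_left (hX : SmAt X x) (hX' : SmAt X' x) :
    bracket (fun y => X y + X' y) Y x = bracket X Y x + bracket X' Y x := by
  rw [bracket_swap, bracket_add_right hX hX', bracket_swap X, bracket_swap X']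
  abel

theorem bracket_smul_right (hf : FSmAt E f x) (hY : SmAt Y x) :
    bracket X (fun y => f y • Y y) x = cD f x (X x) • Y x + f x • bracket X Y x := by
  ext
  · simp only [bracket, smul_re, smul_im, cD, add_re]
    rw [rb_sub_right (hY.1.smul hf.1) (hY.2.smul hf.2), rb_add_right (hY.2.smul hf.1) (hY.1.smul hf.2),
      rb_smul_right hf.1 hY.1, rb_smul_right hf.2 hY.2, rb_smul_right hf.1 hY.2,
      rb_smul_right hf.2 hY.1]
    module
  · simp only [bracket, smul_re, smul_im, cD, add_im]
    rw [rb_sub_right (hY.1.smul hf.1) (hY.2.smul hf.2), rb_add_right (hY.2.smul hf.1) (hY.1.smul hf.2),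
      rb_smul_right hf.1 hY.1, rb_smul_right hf.2 hY.2, rb_smul_right hf.1 hY.2,
      rb_smul_right hf.2 hY.1]
    module

theorem bracket_smul_left (hf : FSmAt E f x) (hX : SmAt X x) :
    bracket (fun y => f y • X y) Y x = f x • bracket X Y x - cD f x (Y x) • X x := by
  rw [bracket_swap, bracket_smul_right hf hX, bracket_swap X]
  module

theorem cD_const (c : ℂ) (v : TC E x) : cD (fun _ => c) x v = 0 := by
  have h (r : ℝ) (w) : dirDeriv (E := E) (fun _ : M => r) x w = 0 := by
    rw [dirDeriv, mfderiv_const]; rfl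
  apply Complex.ext <;> simp [cD, h]

theorem bracket_const_smul_right (c : ℂ) (hY : SmAt Y x) :
    bracket X (fun y => c • Y y) x = c • bracket X Y x := by
  rw [bracket_smul_right (.const c) hY, cD_const, zero_smul, zero_add]

theorem bracket_const_smul_left (c : ℂ) (hX : SmAt X x) :
    bracket (fun y => c • X y) Y x = c • bracket X Y x := by
  rw [bracket_smul_left (.const c) hX, cD_const, zero_smul, sub_zero]

theorem bracket_neg_right (hY : SmAt Y x) : bracket X (fun y => -Y y) x = -bracket X Y x := by
  simpa using bracket_const_smul_right (X := X) (-1) hY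

theorem bracket_sub_right (hY : SmAt Y x) (hY' : SmAt Y' x) :
    bracket X (fun y => Y y - Y' y) x = bracket X Y x - bracket X Y' x := by
  simp only [sub_eq_add_neg]
  rw [bracket_add_right hY hY'.neg, bracket_neg_right hY']

theorem bracket_zero_right (X : ∀ x : M, TC E x) (x : M) : bracket X (fun _ => 0) x = 0 := by
  simpa using bracket_const_smul_right (X := X) (x := x) 0 SmAt.zero

theorem bracket_sum_right {ι : Type*} (s : Finset ι) {Y : ι → ∀ x : M, TC E x}
    (h : ∀ i ∈ s, SmAt (Y i) x) :
    bracket X (fun y => ∑ i ∈ s, Y i y) x = ∑ i ∈ s, bracket X (Y i) x := by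
  classical
  induction s using Finset.induction_on with
  | empty => simpa using bracket_zero_right X x
  | insert i s hi ih =>
    simp only [Finset.sum_insert hi]
    rw [bracket_add_right (h i (by simp)) (SmAt.sum s fun j hj => h j (by simp [hj])),
      ih fun j hj => h j (by simp [hj])]

theorem bracket_sum_left {ι : Type*} (s : Finset ι) {Y : ι → ∀ x : M, TC E x}
    (h : ∀ i ∈ s, SmAt (Y i) x) :
    bracket (fun y => ∑ i ∈ s, Y i y) X x = ∑ i ∈ s, bracket (Y i) X x := by
  rw [bracket_swap, bracket_sum_right s h, ← Finset.sum_neg_distrib]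
  simp only [bracket_swap X, neg_neg]

theorem conj_bracket (hX : SmAt X x) (hY : SmAt Y x) :
    conj (bracket X Y x) = bracket (fun y => conj (X y)) (fun y => conj (Y y)) x := by
  ext
  · simp only [bracket, conj_re, conj_im]
    rw [rb_neg_left hX.2, rb_neg_right hY.2]
    abel
  · simp only [bracket, conj_re, conj_im]
    rw [rb_neg_left hX.2, rb_neg_right hY.2]
    abel

theorem bracket_jacobi (hX : SmAt X x) (hY : SmAt Y x) (hW : SmAt W x) :
    bracket X (bracket Y W) x = bracket (bracket X Y) W x + bracket Y (bracket X W) x := by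
  ext
  · simp only [bracket, add_re]
    rw [rb_sub_right (hY.1.bracket hW.1) (hY.2.bracket hW.2),
      rb_add_right (hY.1.bracket hW.2) (hY.2.bracket hW.1),
      rb_sub_right (hX.1.bracket hW.1) (hX.2.bracket hW.2),
      rb_add_right (hX.1.bracket hW.2) (hX.2.bracket hW.1),
      rb_sub_left (hX.1.bracket hY.1) (hX.2.bracket hY.2),
      rb_add_left (hX.1.bracket hY.2) (hX.2.bracket hY.1),
      rb_jacobi hX.1 hY.1 hW.1, rb_jacobi hX.1 hY.2 hW.2, rb_jacobi hX.2 hY.1 hW.2,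
      rb_jacobi hX.2 hY.2 hW.1]
    abel
  · simp only [bracket, add_im]
    rw [rb_sub_right (hY.1.bracket hW.1) (hY.2.bracket hW.2),
      rb_add_right (hY.1.bracket hW.2) (hY.2.bracket hW.1),
      rb_sub_right (hX.1.bracket hW.1) (hX.2.bracket hW.2),
      rb_add_right (hX.1.bracket hW.2) (hX.2.bracket hW.1),
      rb_sub_left (hX.1.bracket hY.1) (hX.2.bracket hY.2),
      rb_add_left (hX.1.bracket hY.2) (hX.2.bracket hY.1),
      rb_jacobi hX.1 hY.1 hW.2, rb_jacobi hX.1 hY.2 hW.1, rb_jacobi hX.2 hY.1 hW.1,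
      rb_jacobi hX.2 hY.2 hW.2]
    abel

end bracket

end Fields

/-! ### Smoothness of coefficients with respect to a frame. -/

section Frames

variable {E : Type*} [NormedAddCommGroup E] [NormedSpace ℝ E]
  {M : Type*} [TopologicalSpace M] [ChartedSpace E M] [IsManifold 𝓘(ℝ, E) ∞ M]

/-- The solution of a smooth family of injective linear systems is smooth. -/
theorem contMDiffAt_of_injective {V F : Type*} [NormedAddCommGroup V] [NormedSpace ℝ V]
    [FiniteDimensional ℝ V] [NormedAddCommGroup F] [NormedSpace ℝ F] [FiniteDimensional ℝ F]
    {A : M → V →L[ℝ] F} {c : M → V} {x₀ : M} (hA₀ : Function.Injective (A x₀))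
    (hA : ∀ᶠ y in 𝓝 x₀, ContMDiffAt 𝓘(ℝ, E) 𝓘(ℝ, V →L[ℝ] F) ∞ A y)
    (hc : ∀ᶠ y in 𝓝 x₀, ContMDiffAt 𝓘(ℝ, E) 𝓘(ℝ, F) ∞ (fun y => A y (c y)) y) :
    ∀ᶠ y in 𝓝 x₀, ContMDiffAt 𝓘(ℝ, E) 𝓘(ℝ, V) ∞ c y := by
  -- A left inverse at the single point x₀ suffices: B ∘ A y is the identity at x₀, hence invertible
  -- nearby, and there c = (B ∘ A)⁻¹ (B (A c)).
  obtain ⟨B, hB⟩ := (A x₀ : V →ₗ[ℝ] F).exists_leftInverse_of_injective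
    (LinearMap.ker_eq_bot.2 hA₀)
  have : CompleteSpace V := FiniteDimensional.complete ℝ V
  set B' : F →L[ℝ] V := LinearMap.toContinuousLinearMap B
  let G : M → V →L[ℝ] V := fun y => B'.comp (A y)
  have hG : ∀ᶠ y in 𝓝 x₀, ContMDiffAt 𝓘(ℝ, E) 𝓘(ℝ, V →L[ℝ] V) ∞ G y := by
    filter_upwards [hA] with y hy
    exact ((ContinuousLinearMap.compL ℝ V F V B').contDiff.contMDiff.contMDiffAt).comp y hy
  have hG₀ : G x₀ = 1 := by
    ext v
    exact LinearMap.congr_fun hB v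
  have hu : ∀ᶠ y in 𝓝 x₀, IsUnit (G y) := by
    have : {T : V →L[ℝ] V | IsUnit T} ∈ 𝓝 (G x₀) := by
      rw [hG₀]; exact Units.isOpen.mem_nhds isUnit_one
    exact hG.self_of_nhds.continuousAt this
  filter_upwards [hG, hc, eventually_eventually_nhds.2 hu] with y hGy hcy huy
  have h1 : ContMDiffAt 𝓘(ℝ, E) 𝓘(ℝ, V →L[ℝ] V) ∞ (fun y => Ring.inverse (G y)) y := by
    obtain ⟨g, hg⟩ := huy.self_of_nhds
    have := contDiffAt_ringInverse ℝ (n := ∞) g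
    rw [hg] at this
    exact this.contMDiffAt.comp y hGy
  have h2 : ContMDiffAt 𝓘(ℝ, E) 𝓘(ℝ, V) ∞ (fun y => B' (A y (c y))) y :=
    B'.contDiff.contMDiff.contMDiffAt.comp y hcy
  refine (h1.clm_apply h2).congr_of_eventuallyEq ?_
  filter_upwards [huy] with z hz
  have h3 : (Ring.inverse (G z) * G z) (c z) = c z := by rw [Ring.inverse_mul_cancel _ hz]; rfl
  exact h3.symm

/-- The local coordinate of a real tangent vector in the trivialization at `x₀`. -/
def rcoord (x₀ : M) (y : M) (v : TangentSpace 𝓘(ℝ, E) y) : E :=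
  (trivializationAt E (TangentSpace 𝓘(ℝ, E)) x₀ ⟨y, v⟩).2

theorem rcoord_eq {x₀ y : M} (hy : y ∈ (chartAt E x₀).source) (v : TangentSpace 𝓘(ℝ, E) y) :
    rcoord x₀ y v
      = (trivializationAt E (TangentSpace 𝓘(ℝ, E)) x₀).continuousLinearEquivAt ℝ y hy v := rfl

theorem rSmAt_iff {X : ∀ x : M, TangentSpace 𝓘(ℝ, E) x} {x₀ x : M}
    (hx : x ∈ (chartAt E x₀).source) :
    RSmAt X x ↔ ∀ᶠ y in 𝓝 x, ContMDiffAt 𝓘(ℝ, E) 𝓘(ℝ, E) ∞ (fun y => rcoord x₀ y (X y)) y := by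
  apply eventually_congr
  filter_upwards [(chartAt E x₀).open_source.mem_nhds hx] with y hy
  exact (trivializationAt E (TangentSpace 𝓘(ℝ, E)) x₀).contMDiffAt_section_iff (n := ∞) hy

theorem linearIndependent_conj {V ι : Type*} [AddCommGroup V] [Module ℝ V] {e : ι → Cx V}
    (h : LinearIndependent ℂ e) : LinearIndependent ℂ (fun i => conj (e i)) := by
  rw [linearIndependent_iff'] at h ⊢
  intro s g hg i hi
  have := h s (fun i => (starRingEnd ℂ) (g i)) ?_ i hi
  · simpa using this
  · have h2 : conj (∑ i ∈ s, g i • conj (e i)) = ∑ i ∈ s, (starRingEnd ℂ) (g i) • e i := by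
      clear hg hi h
      classical
      induction s using Finset.induction_on with
      | empty => simp
      | insert a s ha ih => simp [Finset.sum_insert ha, conj_add, conj_smul, ih]
    rw [← h2, hg, conj_zero]

variable [FiniteDimensional ℝ E]

/-- The coefficients of a smooth field with respect to a smooth frame are smooth. -/
theorem fSmAt_coeff {ι : Type*} [Fintype ι] {e : ι → ∀ x : M, TC E x} {x₀ : M}
    (he : ∀ i, SmAt (e i) x₀) (hli : LinearIndependent ℂ (fun i => e i x₀)) {c : ι → M → ℂ}
    (hX : SmAt (fun y => ∑ i, c i y • e i y) x₀) (i : ι) : FSmAt E (c i) x₀ := by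
  have hx : x₀ ∈ (chartAt E x₀).source := mem_chart_source E x₀
  let p : ι → M → E × E := fun i y => (rcoord x₀ y (e i y).re, rcoord x₀ y (e i y).im)
  let q : ι → M → E × E := fun i y => (-rcoord x₀ y (e i y).im, rcoord x₀ y (e i y).re)
  let Lr : ι → (ι → ℂ) →L[ℝ] ℝ := fun i => Complex.reCLM.comp (ContinuousLinearMap.proj i)
  let Li : ι → (ι → ℂ) →L[ℝ] ℝ := fun i => Complex.imCLM.comp (ContinuousLinearMap.proj i)
  -- A y sends d to the real and imaginary parts of ∑ dᵢ eᵢ(y), read in the trivialization at x₀.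
  -- The real part of dᵢ multiplies pᵢ, which represents eᵢ, and its imaginary part multiplies qᵢ,
  -- which represents i·eᵢ.
  let A : M → (ι → ℂ) →L[ℝ] E × E := fun y => ∑ i, ((Lr i).smulRight (p i y) + (Li i).smulRight (q i y))
  have hA : ∀ y ∈ (chartAt E x₀).source, ∀ d : ι → ℂ, A y d =
      (rcoord x₀ y (∑ i, d i • e i y).re, rcoord x₀ y (∑ i, d i • e i y).im) := by
    intro y hy d
    simp only [rcoord_eq hy, sum_re, sum_im, smul_re, smul_im, map_sum, map_add, map_sub, map_smul]
    simp only [A, sum_apply, add_apply,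
      ContinuousLinearMap.smulRight_apply, p, q, rcoord_eq hy]
    ext
    · simp [Prod.fst_sum, Lr, Li, sub_eq_add_neg]
    · simp [Prod.snd_sum, Lr, Li]
  have hp : ∀ᶠ y in 𝓝 x₀, ∀ i, ContMDiffAt 𝓘(ℝ, E) 𝓘(ℝ, E × E) ∞ (p i) y := by
    refine eventually_all.2 fun i => ?_
    filter_upwards [(rSmAt_iff hx).1 (he i).1, (rSmAt_iff hx).1 (he i).2] with y h1 h2
    exact h1.prodMk_space h2
  have hq : ∀ᶠ y in 𝓝 x₀, ∀ i, ContMDiffAt 𝓘(ℝ, E) 𝓘(ℝ, E × E) ∞ (q i) y := by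
    refine eventually_all.2 fun i => ?_
    filter_upwards [(rSmAt_iff hx).1 (he i).1, (rSmAt_iff hx).1 (he i).2] with y h1 h2
    exact h2.neg.prodMk_space h1
  have key := contMDiffAt_of_injective (E := E) (A := A) (c := fun y i => c i y) (x₀ := x₀) ?_ ?_ ?_
  · constructor
    · filter_upwards [key] with y hy
      exact (Lr i).contDiff.contMDiff.contMDiffAt.comp y hy
    · filter_upwards [key] with y hy
      exact (Li i).contDiff.contMDiff.contMDiffAt.comp y hy
  · rw [injective_iff_map_eq_zero]
    intro d hd
    rw [hA x₀ hx, Prod.mk_eq_zero, rcoord_eq hx, rcoord_eq hx, ContinuousLinearEquiv.map_eq_zero_iff,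
      ContinuousLinearEquiv.map_eq_zero_iff] at hd
    have h0 : ∑ i, d i • e i x₀ = 0 := Cx.ext hd.1 hd.2
    exact funext (Fintype.linearIndependent_iff.1 hli d h0)
  · filter_upwards [hp, hq] with y hpy hqy
    refine ContMDiffAt.sum fun i _ => ContMDiffAt.add ?_ ?_
    · exact ((ContinuousLinearMap.smulRightL ℝ (ι → ℂ) (E × E) (Lr i)).contDiff.contMDiff.contMDiffAt).comp y (hpy i)
    · exact ((ContinuousLinearMap.smulRightL ℝ (ι → ℂ) (E × E) (Li i)).contDiff.contMDiff.contMDiffAt).comp y (hqy i)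
  · filter_upwards [(rSmAt_iff hx).1 hX.1, (rSmAt_iff hx).1 hX.2,
      (chartAt E x₀).open_source.mem_nhds hx] with y h1 h2 hy
    refine (h1.prodMk_space h2).congr_of_eventuallyEq ?_
    filter_upwards [(chartAt E x₀).open_source.mem_nhds hy] with z hz
    exact hA z hz _

theorem linearIndependent_ofReal {V ι : Type*} [AddCommGroup V] [Module ℝ V] {e : ι → V}
    (h : LinearIndependent ℝ e) : LinearIndependent ℂ (fun i => ofReal (e i)) := by
  rw [linearIndependent_iff'] at h ⊢
  intro s g hg i hi
  have h1 := congrArg Cx.re hg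
  have h2 := congrArg Cx.im hg
  simp only [sum_re, sum_im, smul_re, smul_im, ofReal, smul_zero, sub_zero, zero_add, zero_re,
    zero_im] at h1 h2
  exact Complex.ext (h s _ h1 i hi) (h s _ h2 i hi)

theorem span_ofReal {V ι : Type*} [AddCommGroup V] [Module ℝ V] {e : ι → V}
    (h : Submodule.span ℝ (range e) = ⊤) :
    Submodule.span ℂ (range fun i => ofReal (e i)) = ⊤ := by
  have h1 : ∀ v : V, ofReal v ∈ Submodule.span ℂ (range fun i => ofReal (e i)) := by
    intro v
    have hv : v ∈ Submodule.span ℝ (range e) := h ▸ Submodule.mem_top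
    induction hv using Submodule.span_induction with
    | mem v hv =>
      obtain ⟨i, rfl⟩ := hv
      exact Submodule.subset_span ⟨i, rfl⟩
    | zero => exact Submodule.zero_mem _
    | add v w _ _ hv hw =>
      convert Submodule.add_mem _ hv hw using 1
      ext <;> simp [ofReal]
    | smul r v _ hv =>
      convert Submodule.smul_mem _ (r : ℂ) hv using 1
      ext <;> simp only [ofReal, smul_re, smul_im, Complex.ofReal_re, Complex.ofReal_im, zero_smul,
        sub_zero, smul_zero, add_zero]
  rw [eq_top_iff]
  intro v _
  have : v = ofReal v.re + Complex.I • ofReal v.im := by ext <;> simp [ofReal]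
  rw [this]
  exact Submodule.add_mem _ (h1 _) (Submodule.smul_mem _ _ (h1 _))

theorem SmAt.ofReal {X : ∀ x : M, TangentSpace 𝓘(ℝ, E) x} {x : M} (h : RSmAt X x) :
    SmAt (fun y => ofReal (X y)) x := ⟨h, RSmAt.zero⟩

/-- There are smooth local frames of the complexified tangent bundle. -/
theorem exists_frame (x₀ : M) : ∃ (n : ℕ) (e : Fin n → ∀ x : M, TC E x),
    (∀ i, SmAt (e i) x₀) ∧ ∀ᶠ y in 𝓝 x₀, LinearIndependent ℂ (fun i => e i y) ∧
      Submodule.span ℂ (range fun i => e i y) = ⊤ := by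
  let b := Module.finBasis ℝ E
  let t := trivializationAt E (TangentSpace 𝓘(ℝ, E)) x₀
  have hs : (chartAt E x₀).source ∈ 𝓝 x₀ :=
    (chartAt E x₀).open_source.mem_nhds (mem_chart_source E x₀)
  have hf := t.isLocalFrameOn_localFrame_baseSet 𝓘(ℝ, E) ∞ b
  refine ⟨_, fun i y => ofReal (t.localFrame b i y), fun i => SmAt.ofReal ?_, ?_⟩
  · filter_upwards [hs] with y hy
    exact contMDiffAt_localFrame_of_mem ∞ t b i hy
  · filter_upwards [hs] with y hy
    exact ⟨linearIndependent_ofReal (hf.linearIndependent hy),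
      span_ofReal (top_le_iff.1 (hf.generating hy))⟩

end Frames

/-! ### Germs of sections, and fields whose brackets preserve a distribution. -/

section Sections

variable {E : Type*} [NormedAddCommGroup E] [NormedSpace ℝ E]
  {M : Type*} [TopologicalSpace M] [ChartedSpace E M] [IsManifold 𝓘(ℝ, E) ∞ M]

/-- `X` is a smooth section of `T` on a neighbourhood of `x`. -/
def SectAt (T : ∀ x : M, Submodule ℂ (TC E x)) (X : ∀ x : M, TC E x) (x : M) : Prop :=
  SmAt X x ∧ ∀ᶠ y in 𝓝 x, X y ∈ T y

/-- At the point `x` the brackets of sections of `P` with `X` lie in `P`. -/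
def PresAt (P : ∀ x : M, Submodule ℂ (TC E x)) (X : ∀ x : M, TC E x) (x : M) : Prop :=
  SmAt X x ∧ ∀ u, SectAt P u x → bracket u X x ∈ P x

/-- The conjugate family of subspaces. -/
def cj (T : ∀ x : M, Submodule ℂ (TC E x)) (x : M) : Submodule ℂ (TC E x) := conjSub (T x)

theorem isSectionOn_iff {T : ∀ x : M, Submodule ℂ (TC E x)} {U : Set M} (hU : IsOpen U)
    {X : ∀ x : M, TC E x} : IsSectionOn T U X ↔ ∀ x ∈ U, SectAt T X x := by
  rw [IsSectionOn, smoothOn_iff hU]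
  constructor
  · intro h x hx
    exact ⟨h.1 x hx, by filter_upwards [hU.mem_nhds hx] with y hy using h.2 y hy⟩
  · intro h
    exact ⟨fun x hx => (h x hx).1, fun x hx => (h x hx).2.self_of_nhds⟩

variable {T P Q : ∀ x : M, Submodule ℂ (TC E x)} {X Y u : ∀ x : M, TC E x} {x : M}

theorem SectAt.eventually (h : SectAt T X x) : ∀ᶠ y in 𝓝 x, SectAt T X y :=
  h.1.eventually.and (eventually_eventually_nhds.2 h.2)

theorem SectAt.congr (h : SectAt T X x) (h' : ∀ᶠ y in 𝓝 x, X y = Y y) : SectAt T Y x :=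
  ⟨h.1.congr h', by filter_upwards [h.2, h'] with y hy hy' using hy' ▸ hy⟩

theorem SectAt.mono (h : SectAt T X x) (hTP : ∀ y, T y ≤ P y) : SectAt P X x :=
  ⟨h.1, h.2.mono fun y hy => hTP y hy⟩

theorem SectAt.conj' (h : SectAt (cj T) X x) : SectAt T (fun y => Cx.conj (X y)) x :=
  ⟨h.1.conj, h.2⟩

theorem exists_isOpen_sectAt (h : SectAt T X x) : ∃ U, IsOpen U ∧ x ∈ U ∧ IsSectionOn T U X := by
  obtain ⟨U, hU, hUo, hx⟩ := eventually_nhds_iff.1 h.eventually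
  exact ⟨U, hUo, hx, (isSectionOn_iff hUo).2 hU⟩

theorem IsSectionOn.mono {U V : Set M} (hV : IsOpen V) (hU : IsOpen U) (h : IsSectionOn T U X)
    (hVU : V ⊆ U) : IsSectionOn T V X :=
  (isSectionOn_iff hV).2 fun y hy => (isSectionOn_iff hU).1 h y (hVU hy)

theorem Involutive.bracket_mem (hT : Involutive T) (hX : SectAt T X x) (hY : SectAt T Y x) :
    bracket X Y x ∈ T x := by
  obtain ⟨U, hU, hxU, hXU⟩ := exists_isOpen_sectAt hX
  obtain ⟨V, hV, hxV, hYV⟩ := exists_isOpen_sectAt hY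
  exact hT (U ∩ V) X Y (hU.inter hV) (hXU.mono (hU.inter hV) hU inter_subset_left)
    (hYV.mono (hU.inter hV) hV inter_subset_right) x ⟨hxU, hxV⟩

theorem involutive_iff : Involutive T ↔ ∀ (X Y : ∀ x : M, TC E x) (x : M), SectAt T X x →
    SectAt T Y x → bracket X Y x ∈ T x :=
  ⟨fun h _ _ _ hX hY => h.bracket_mem hX hY, fun h U X Y hU hX hY x hx =>
    h X Y x ((isSectionOn_iff hU).1 hX x hx) ((isSectionOn_iff hU).1 hY x hx)⟩

theorem bracketPreservesConj_iff {U : Set M} (hU : IsOpen U) (hX : ∀ x ∈ U, SmAt X x) :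
    BracketPreservesConj T U X ↔ ∀ x ∈ U, PresAt (cj T) X x := by
  constructor
  · intro h x hx
    refine ⟨hX x hx, fun u hu => ?_⟩
    obtain ⟨V, hV, hxV, huV⟩ := exists_isOpen_sectAt hu
    exact h (U ∩ V) u (hU.inter hV) inter_subset_left
      (huV.mono (hU.inter hV) hV inter_subset_right) x ⟨hx, hxV⟩
  · intro h U' u hU' hsub hu x hx
    exact (h x (hsub hx)).2 u ((isSectionOn_iff hU').1 hu x hx)

variable [CompleteSpace E]

theorem Involutive.cj (hT : Involutive T) : Involutive (cj T) := by
  rw [involutive_iff]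
  intro X Y x hX hY
  change Cx.conj _ ∈ T x
  rw [conj_bracket hX.1 hY.1]
  exact hT.bracket_mem hX.conj' hY.conj'

theorem cj_cj : cj (cj T) = T := by
  ext x : 1
  simp [NLHodge.cj]

theorem involutive_cj_iff : Involutive (cj T) ↔ Involutive T :=
  ⟨fun h => by simpa only [cj_cj] using h.cj, fun h => h.cj⟩

namespace PresAt

theorem congr (h : PresAt P X x) (h' : ∀ᶠ y in 𝓝 x, X y = Y y) : PresAt P Y x :=
  ⟨h.1.congr h', fun u hu => by
    rw [← bracket_congr (Eventually.of_forall fun _ => rfl) h']; exact h.2 u hu⟩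

theorem add (h : PresAt P X x) (h' : PresAt P Y x) : PresAt P (fun y => X y + Y y) x :=
  ⟨h.1.add h'.1, fun u hu => by
    rw [bracket_add_right h.1 h'.1]; exact (P x).add_mem (h.2 u hu) (h'.2 u hu)⟩

theorem sub (h : PresAt P X x) (h' : PresAt P Y x) : PresAt P (fun y => X y - Y y) x :=
  ⟨h.1.sub h'.1, fun u hu => by
    rw [bracket_sub_right h.1 h'.1]; exact (P x).sub_mem (h.2 u hu) (h'.2 u hu)⟩

theorem const_smul (c : ℂ) (h : PresAt P X x) : PresAt P (fun y => c • X y) x :=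
  ⟨h.1.const_smul c, fun u hu => by
    rw [bracket_const_smul_right c h.1]; exact (P x).smul_mem _ (h.2 u hu)⟩

theorem sum {ι : Type*} (s : Finset ι) {X : ι → ∀ x : M, TC E x}
    (h : ∀ i ∈ s, PresAt P (X i) x) : PresAt P (fun y => ∑ i ∈ s, X i y) x :=
  ⟨SmAt.sum s fun i hi => (h i hi).1, fun u hu => by
    rw [bracket_sum_right s fun i hi => (h i hi).1]
    exact (P x).sum_mem fun i hi => (h i hi).2 u hu⟩

/-- Multiplication by a function that is constant along `P`. -/
theorem smul {f : M → ℂ} (hf : FSmAt E f x) (hfP : ∀ v ∈ P x, cD f x v = 0) (h : PresAt P X x) :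
    PresAt P (fun y => f y • X y) x :=
  ⟨h.1.smul hf, fun u hu => by
    rw [bracket_smul_right hf h.1, hfP _ hu.2.self_of_nhds, zero_smul, zero_add]
    exact (P x).smul_mem _ (h.2 u hu)⟩

theorem of_sectAt (hP : Involutive P) (h : SectAt P X x) : PresAt P X x :=
  ⟨h.1, fun _ hu => hP.bracket_mem hu h⟩

theorem swap (h : PresAt P X x) (hu : SectAt P u x) : NLHodge.bracket X u x ∈ P x := by
  rw [bracket_swap]; exact (P x).neg_mem (h.2 u hu)

/-- The Jacobi identity: [u, [X, Y]] = [[u, X], Y] + [X, [u, Y]]. The hypotheses are needed near x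
and not only at x, because [u, X] and [u, Y] must be sections of P before they can be bracketed
again. -/
theorem bracket (hX : ∀ᶠ y in 𝓝 x, PresAt P X y) (hY : ∀ᶠ y in 𝓝 x, PresAt P Y y) :
    PresAt P (bracket X Y) x := by
  refine ⟨hX.self_of_nhds.1.bracket hY.self_of_nhds.1, fun u hu => ?_⟩
  rw [bracket_jacobi hu.1 hX.self_of_nhds.1 hY.self_of_nhds.1]
  refine (P x).add_mem (hY.self_of_nhds.2 _ ⟨hu.1.bracket hX.self_of_nhds.1, ?_⟩)
    (hX.self_of_nhds.swap ⟨hu.1.bracket hY.self_of_nhds.1, ?_⟩)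
  · filter_upwards [hX, hu.eventually] with y h1 h2 using h1.2 u h2
  · filter_upwards [hY, hu.eventually] with y h1 h2 using h1.2 u h2

end PresAt

end Sections

/-! ### Local frames of subbundles and projections along them. -/

section Frames

variable {E : Type*} [NormedAddCommGroup E] [NormedSpace ℝ E] [FiniteDimensional ℝ E]
  {M : Type*} [TopologicalSpace M] [ChartedSpace E M] [IsManifold 𝓘(ℝ, E) ∞ M]
  {T P Q : ∀ x : M, Submodule ℂ (TC E x)} {X Y u : ∀ x : M, TC E x} {x : M}

/-- `e` is a smooth frame of `T` on a neighbourhood of `x`. -/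
def FrameAt {ι : Type*} (T : ∀ x : M, Submodule ℂ (TC E x)) (e : ι → ∀ x : M, TC E x) (x : M) :
    Prop :=
  (∀ i, SmAt (e i) x) ∧ ∀ᶠ y in 𝓝 x, LinearIndependent ℂ (fun i => e i y) ∧
    Submodule.span ℂ (range fun i => e i y) = T y

theorem FrameAt.sectAt {ι : Type*} {e : ι → ∀ x : M, TC E x} (h : FrameAt T e x) (i : ι) :
    SectAt T (e i) x :=
  ⟨h.1 i, h.2.mono fun y hy => hy.2 ▸ Submodule.subset_span ⟨i, rfl⟩⟩

theorem IsSmoothSubbundle.exists_frameAt (h : IsSmoothSubbundle T) (x : M) :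
    ∃ (k : ℕ) (e : Fin k → ∀ x : M, TC E x), FrameAt T e x := by
  obtain ⟨U, hU, hx, k, e, he, h⟩ := h x
  exact ⟨k, e, fun i => (smoothOn_iff hU).1 (he i) x hx,
    by filter_upwards [hU.mem_nhds hx] with y hy using h y hy⟩

theorem isSmoothSubbundle_of_frameAt (h : ∀ x, ∃ (ι : Type) (_ : Fintype ι)
    (e : ι → ∀ y : M, TC E y), FrameAt T e x) : IsSmoothSubbundle T := by
  intro x
  obtain ⟨ι, _, e, he, h⟩ := h x
  obtain ⟨U, hU, hUo, hx⟩ := eventually_nhds_iff.1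
    ((eventually_all.2 fun i => (he i).eventually).and h)
  let f := (Fintype.equivFin ι).symm
  refine ⟨U, hUo, hx, _, fun i => e (f i), fun i => (smoothOn_iff hUo).2 fun y hy => (hU y hy).1 _,
    fun y hy => ⟨(hU y hy).2.1.comp _ f.injective, ?_⟩⟩
  rw [← (hU y hy).2.2]
  congr 1
  exact f.surjective.range_comp fun i => e i y

/-- The coefficients may be chosen pointwise, with the value 0 where no expansion is available;
linear independence of the frame makes any such choice smooth near x. -/
theorem FrameAt.exists_coeff {ι : Type*} [Fintype ι] {e : ι → ∀ x : M, TC E x} (h : FrameAt T e x)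
    (hX : SectAt T X x) : ∃ c : ι → M → ℂ, (∀ i, FSmAt E (c i) x) ∧
      ∀ᶠ y in 𝓝 x, X y = ∑ i, c i y • e i y := by
  have h1 : ∀ y, ∃ c : ι → ℂ, (Submodule.span ℂ (range fun i => e i y) = T y ∧ X y ∈ T y) →
      X y = ∑ i, c i • e i y := by
    intro y
    by_cases hy : Submodule.span ℂ (range fun i => e i y) = T y ∧ X y ∈ T y
    · obtain ⟨c, hc⟩ := (Submodule.mem_span_range_iff_exists_fun ℂ).1 (hy.1.symm ▸ hy.2)
      exact ⟨c, fun _ => hc.symm⟩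
    · exact ⟨0, fun h => (hy h).elim⟩
  choose c hc using h1
  have h2 : ∀ᶠ y in 𝓝 x, X y = ∑ i, c y i • e i y := by
    filter_upwards [h.2, hX.2] with y h1 h2 using hc y ⟨h1.2, h2⟩
  exact ⟨fun i y => c y i, fun i => fSmAt_coeff h.1 h.2.self_of_nhds.1 (c := fun i y => c y i)
    (hX.1.congr h2) i, h2⟩

/-- It suffices to check on a frame that the brackets with `X` preserve `T`. -/
theorem FrameAt.presAt {ι : Type*} [Fintype ι] {e : ι → ∀ x : M, TC E x} (h : FrameAt T e x)
    (hX : SmAt X x) (he : ∀ i, bracket (e i) X x ∈ T x) : PresAt T X x := by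
  have := FiniteDimensional.complete ℝ E
  refine ⟨hX, fun u hu => ?_⟩
  obtain ⟨c, hc, hcu⟩ := h.exists_coeff hu
  rw [bracket_congr hcu (Eventually.of_forall fun _ => rfl),
    bracket_sum_left _ fun i _ => (h.1 i).smul (hc i)]
  refine (T x).sum_mem fun i _ => ?_
  rw [bracket_smul_left (hc i) (h.1 i)]
  exact (T x).sub_mem ((T x).smul_mem _ (he i)) ((T x).smul_mem _ (h.sectAt i).2.self_of_nhds)

/-- The reduction to a frame in `FrameAt.presAt` is applied twice, once for each argument of the
bracket. -/
theorem involutive_of_frameAt (h : ∀ x, ∃ (ι : Type) (_ : Fintype ι) (e : ι → ∀ y : M, TC E y),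
    FrameAt T e x ∧ ∀ i j, bracket (e i) (e j) x ∈ T x) : Involutive T := by
  rw [involutive_iff]
  intro X Y x hX hY
  obtain ⟨ι, _, e, he, hij⟩ := h x
  have h1 : ∀ i, PresAt T (e i) x := fun i => he.presAt (he.1 i) fun j => hij j i
  have := FiniteDimensional.complete ℝ E
  exact (he.presAt hY.1 fun i => (h1 i).swap hY).2 X hX

/-- P and Q need not span V, as with T and T̄ inside the full tangent space, so Q is enlarged to a
complement of P. The projection is chosen pointwise; only its restriction to P ⊕ Q is canonical, and
only there is smoothness claimed later. -/
theorem exists_proj {V : Type*} [AddCommGroup V] [Module ℂ V] {P Q : Submodule ℂ V}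
    (h : Disjoint P Q) : ∃ π : V →ₗ[ℂ] V, (∀ v, π v ∈ P) ∧ (∀ v ∈ P, π v = v) ∧ ∀ v ∈ Q, π v = 0 := by
  obtain ⟨Q', hQ, hc'⟩ := h.symm.exists_isCompl
  have hc := hc'.symm
  refine ⟨P.subtype ∘ₗ P.projectionOnto Q' hc, fun v => by simp, fun v hv => ?_, fun v hv => ?_⟩
  · simpa using congrArg Subtype.val (Submodule.projectionOnto_apply_left hc ⟨v, hv⟩)
  · simpa using (Submodule.projectionOnto_apply_eq_zero_iff hc).2 (hQ hv)

theorem FrameAt.sup {ι κ : Type*} {e : ι → ∀ x : M, TC E x} {f : κ → ∀ x : M, TC E x}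
    (he : FrameAt P e x) (hf : FrameAt Q f x) (hd : ∀ᶠ y in 𝓝 x, Disjoint (P y) (Q y)) :
    FrameAt (fun y => P y ⊔ Q y) (Sum.elim e f) x := by
  refine ⟨fun i => by cases i <;> simp [he.1, hf.1], ?_⟩
  filter_upwards [he.2, hf.2, hd] with y h1 h2 hd
  have h3 : (fun i => Sum.elim e f i y) = Sum.elim (fun i => e i y) (fun i => f i y) := by
    ext i <;> cases i <;> rfl
  rw [h3]
  refine ⟨h1.1.sum_type h2.1 ?_, ?_⟩
  · rw [h1.2, h2.2]; exact hd
  · rw [Set.Sum.elim_range, Submodule.span_union, h1.2, h2.2]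

theorem FrameAt.conj {ι : Type*} {e : ι → ∀ x : M, TC E x} (h : FrameAt T e x) :
    FrameAt (cj T) (fun i y => Cx.conj (e i y)) x := by
  refine ⟨fun i => (h.1 i).conj, ?_⟩
  filter_upwards [h.2] with y hy
  refine ⟨linearIndependent_conj hy.1, le_antisymm ?_ ?_⟩
  · rw [Submodule.span_le]
    rintro _ ⟨i, rfl⟩
    change Cx.conj (Cx.conj _) ∈ T y
    rw [conj_conj, ← hy.2]
    exact Submodule.subset_span ⟨i, rfl⟩
  · have : T y ≤ conjSub (Submodule.span ℂ (range fun i => Cx.conj (e i y))) := by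
      rw [← hy.2, Submodule.span_le]
      rintro _ ⟨i, rfl⟩
      exact Submodule.subset_span ⟨i, rfl⟩
    intro v hv
    simpa [mem_conjSub] using this hv

/-- The component in `T` of a smooth section of `T ⊕ T̄` is smooth. -/
theorem SmAt.proj (hT : IsSmoothSubbundle T) (hd : ∀ y, Disjoint (T y) (conjSub (T y)))
    {π : ∀ y : M, TC E y →ₗ[ℂ] TC E y} (hπ : ∀ y, ∀ v ∈ T y, π y v = v)
    (hπ' : ∀ y, ∀ v ∈ conjSub (T y), π y v = 0)
    (hX : SectAt (fun y => T y ⊔ conjSub (T y)) X x) : SmAt (fun y => π y (X y)) x := by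
  obtain ⟨k, e, he⟩ := hT.exists_frameAt x
  obtain ⟨c, hc, hcX⟩ := (he.sup he.conj (Eventually.of_forall hd)).exists_coeff hX
  refine SmAt.congr (SmAt.sum Finset.univ fun i _ => (he.1 i).smul (hc (.inl i))) ?_
  filter_upwards [hcX, he.2] with y hy h2
  have h3 : ∀ i, e i y ∈ T y := fun i => h2.2 ▸ Submodule.subset_span ⟨i, rfl⟩
  have h4 : ∀ i, π y (Cx.conj (e i y)) = 0 := fun i =>
    hπ' y _ (by simpa [mem_conjSub] using h3 i)
  rw [hy]
  simp only [Fintype.sum_sum_type, Sum.elim_inl, Sum.elim_inr, map_add, map_sum, map_smul, h4,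
    hπ y _ (h3 _), smul_zero, Finset.sum_const_zero, add_zero]

end Frames

/-! ### Derivatives of complex functions, and the bracket as a commutator. -/

section Derivations

variable {E : Type*} [NormedAddCommGroup E] [NormedSpace ℝ E]
  {M : Type*} [TopologicalSpace M] [ChartedSpace E M] [IsManifold 𝓘(ℝ, E) ∞ M]
  {X Y u : ∀ x : M, TC E x} {x : M} {f g : M → ℂ}

theorem dirDeriv_congr {f g : M → ℝ} (h : f =ᶠ[𝓝 x] g) (v : TangentSpace 𝓘(ℝ, E) x) :
    dirDeriv f x v = dirDeriv g x v := by
  rw [dirDeriv, dirDeriv, h.mfderiv_eq]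
  rfl

theorem cD_congr (h : f =ᶠ[𝓝 x] g) (v : TC E x) : cD f x v = cD g x v := by
  have h1 : (fun y => (f y).re) =ᶠ[𝓝 x] fun y => (g y).re := h.mono fun _ hy => congrArg _ hy
  have h2 : (fun y => (f y).im) =ᶠ[𝓝 x] fun y => (g y).im := h.mono fun _ hy => congrArg _ hy
  simp only [cD, dirDeriv_congr h1, dirDeriv_congr h2]

theorem dirDeriv_map_add (f : M → ℝ) (v w : TangentSpace 𝓘(ℝ, E) x) :
    dirDeriv f x (v + w) = dirDeriv f x v + dirDeriv f x w := map_add _ _ _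

theorem dirDeriv_map_smul (f : M → ℝ) (c : ℝ) (v : TangentSpace 𝓘(ℝ, E) x) :
    dirDeriv f x (c • v) = c * dirDeriv f x v := map_smul _ _ _

/-- The derivative of a complex function as a complex linear form. -/
def cDL (f : M → ℂ) (x : M) : TC E x →ₗ[ℂ] ℂ where
  toFun := cD f x
  map_add' v w := by
    apply Complex.ext <;> simp only [cD, add_re, add_im, Complex.add_re, Complex.add_im,
      dirDeriv_map_add] <;> ring
  map_smul' c v := by
    apply Complex.ext <;> simp only [cD, smul_re, smul_im, smul_eq_mul, Complex.mul_re,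
      Complex.mul_im, dirDeriv_map_add, dirDeriv_map_smul, sub_eq_add_neg, ← neg_smul,
      RingHom.id_apply] <;> ring

theorem cDL_apply (f : M → ℂ) (x : M) (v : TC E x) : cDL f x v = cD f x v := rfl

theorem cD_conj (f : M → ℂ) (v : TC E x) :
    cD (fun y => (starRingEnd ℂ) (f y)) x v = (starRingEnd ℂ) (cD f x (conj v)) := by
  have h (w : TangentSpace 𝓘(ℝ, E) x) :
      dirDeriv (fun y => -(f y).im) x w = -dirDeriv (fun y => (f y).im) x w := by
    rw [dirDeriv, show (fun y => -(f y).im) = -(fun y => (f y).im) from rfl, mfderiv_neg]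
    rfl
  have h' (f : M → ℝ) (w : TangentSpace 𝓘(ℝ, E) x) : dirDeriv f x (-w) = -dirDeriv f x w :=
    map_neg _ _
  apply Complex.ext <;> simp [cD, h, h'] <;> ring

variable [FiniteDimensional ℝ E]

theorem exists_frameAt_top (x : M) : ∃ (n : ℕ) (e : Fin n → ∀ x : M, TC E x),
    FrameAt (fun _ => ⊤) e x := exists_frame x

/-- Either all tangent vectors at `x` vanish, or there is a smooth field near `x` without zeros. -/
theorem eq_zero_or_exists_smAt (x : M) : (∀ v : TC E x, v = 0) ∨
    ∃ W : ∀ x : M, TC E x, SmAt W x ∧ ∀ᶠ y in 𝓝 x, W y ≠ 0 := by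
  obtain ⟨n, e, he, h⟩ := exists_frameAt_top (E := E) x
  rcases n with _ | n
  · left
    intro v
    have h1 := h.self_of_nhds.2
    rw [range_eq_empty, Submodule.span_empty] at h1
    exact (Submodule.mem_bot ℂ).1 (h1 ▸ Submodule.mem_top)
  · exact .inr ⟨e 0, he 0, h.mono fun y hy => hy.1.ne_zero 0⟩

theorem fSmAt_of_smul {W : ∀ x : M, TC E x} (hW : SmAt W x) (h0 : W x ≠ 0)
    (h : SmAt (fun y => f y • W y) x) : FSmAt E f x := by
  refine fSmAt_coeff (e := fun _ : Unit => W) (c := fun _ => f) (fun _ => hW) ?_ ?_ ()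
  · exact linearIndependent_unique_iff.2 h0
  · simpa using h

/-- With a field W without zeros, (Yf) W = [Y, fW] - f [Y, W], so smoothness of Yf is inherited from
brackets. -/
theorem FSmAt.cD (hf : FSmAt E f x) (hY : SmAt Y x) : FSmAt E (fun y => cD f y (Y y)) x := by
  have := FiniteDimensional.complete ℝ E
  rcases eq_zero_or_exists_smAt (E := E) x with h | ⟨W, hW, h0⟩
  · have h1 : ∀ v : E, v = 0 := fun v => congrArg Cx.re (h ⟨v, 0⟩)
    refine (FSmAt.const 0).congr (Eventually.of_forall fun y => ?_)
    have : Y y = 0 := Cx.ext (h1 _) (h1 _)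
    change 0 = cDL f y (Y y)
    rw [this, map_zero]
  · refine fSmAt_of_smul hW h0.self_of_nhds ?_
    refine ((hY.bracket (hW.smul hf)).sub ((hY.bracket hW).smul hf)).congr ?_
    filter_upwards [hf.eventually, hW.eventually] with y h1 h2
    rw [bracket_smul_right h1 h2]
    abel

/-- The bracket is the commutator of derivations. -/
theorem cD_bracket (hf : FSmAt E f x) (hX : SmAt X x) (hY : SmAt Y x) :
    cD f x (bracket X Y x)
      = cD (fun y => cD f y (Y y)) x (X x) - cD (fun y => cD f y (X y)) x (Y x) := by
  have := FiniteDimensional.complete ℝ E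
  rcases eq_zero_or_exists_smAt (E := E) x with h | ⟨W, hW, h0⟩
  · rw [h (bracket X Y x), h (X x), h (Y x)]
    simp only [← cDL_apply, map_zero, sub_zero]
  -- Expanding the Jacobi identity for X, Y, fW by the Leibniz rule and cancelling it for X, Y, W
  -- leaves the claim multiplied by W.
  have key := bracket_jacobi hX hY (hW.smul hf)
  have e (Y : ∀ x : M, TC E x) : ∀ᶠ y in 𝓝 x, bracket Y (fun y => f y • W y) y
      = cD f y (Y y) • W y + f y • bracket Y W y := by
    filter_upwards [hf.eventually, hW.eventually] with y h1 h2 using bracket_smul_right h1 h2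
  rw [bracket_congr (Eventually.of_forall fun _ => rfl) (e Y),
    bracket_congr (X := Y) (Eventually.of_forall fun _ => rfl) (e X),
    bracket_add_right (hW.smul (hf.cD hY)) ((hY.bracket hW).smul hf),
    bracket_add_right (hW.smul (hf.cD hX)) ((hX.bracket hW).smul hf),
    bracket_smul_right (hf.cD hY) hW, bracket_smul_right hf (hY.bracket hW),
    bracket_smul_right (hf.cD hX) hW, bracket_smul_right hf (hX.bracket hW),
    bracket_smul_right hf hW, bracket_jacobi hX hY hW] at key
  have h2 : (cD f x (bracket X Y x)
      - (cD (fun y => cD f y (Y y)) x (X x) - cD (fun y => cD f y (X y)) x (Y x))) • W x = 0 := by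
    rw [sub_smul, sub_smul, sub_eq_zero]
    rw [← sub_eq_zero] at key ⊢
    rw [← neg_eq_zero, ← key]
    module
  exact sub_eq_zero.1 ((smul_eq_zero.1 h2).resolve_right h0.self_of_nhds)

end Derivations

/-! ### Pullback of functions from the base, and vanishing along a fibre. -/

section Maps

variable {ES : Type*} [NormedAddCommGroup ES] [NormedSpace ℂ ES]
  {S : Type*} [TopologicalSpace S] [ChartedSpace ES S] [IsManifold 𝓘(ℂ, ES) ω S]
  {EZ : Type*} [NormedAddCommGroup EZ] [NormedSpace ℝ EZ]
  {Z : Type*} [TopologicalSpace Z] [ChartedSpace EZ Z] [IsManifold 𝓘(ℝ, EZ) ∞ Z]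
  {α : Z → S} {z : Z} {f : S → ℂ}

theorem RFSmAt.comp {f : S → ℝ} (hα : ContMDiff 𝓘(ℝ, EZ) 𝓘(ℝ, ES) ∞ α)
    (hf : RFSmAt (E := ES) f (α z)) : RFSmAt (E := EZ) (fun z => f (α z)) z := by
  filter_upwards [hα.continuous.continuousAt.eventually hf] with y hy
  exact hy.comp y hα.contMDiffAt

theorem FSmAt.comp (hα : ContMDiff 𝓘(ℝ, EZ) 𝓘(ℝ, ES) ∞ α) (hf : FSmAt ES f (α z)) :
    FSmAt EZ (fun z => f (α z)) z :=
  ⟨RFSmAt.comp (f := fun s => (f s).re) hα hf.1, RFSmAt.comp (f := fun s => (f s).im) hα hf.2⟩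

theorem dirDeriv_comp {f : S → ℝ} (hα : ContMDiff 𝓘(ℝ, EZ) 𝓘(ℝ, ES) ∞ α)
    (hf : RFSmAt (E := ES) f (α z)) (v : TangentSpace 𝓘(ℝ, EZ) z) :
    dirDeriv (fun z => f (α z)) z v
      = dirDeriv f (α z) (mfderiv 𝓘(ℝ, EZ) 𝓘(ℝ, ES) α z v) := by
  rw [dirDeriv, dirDeriv]
  exact mfderiv_comp_apply z hf.mdiff ((hα z).mdifferentiableAt (by simp)) v

theorem cD_comp (hα : ContMDiff 𝓘(ℝ, EZ) 𝓘(ℝ, ES) ∞ α) (hf : FSmAt ES f (α z)) (v : TC EZ z) :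
    cD (fun z => f (α z)) z v = cD f (α z) (dC (ES := ES) α z v) := by
  have h1 := dirDeriv_comp (f := fun s => (f s).re) hα hf.1
  have h2 := dirDeriv_comp (f := fun s => (f s).im) hα hf.2
  simp only [cD, h1, h2]
  rfl

variable [FiniteDimensional ℝ EZ]

/-- The derivative in a vertical direction of a function that vanishes on the fibre is zero. -/
theorem dirDeriv_eq_zero_of_fiber [FiniteDimensional ℝ ES] (hα : ContMDiff 𝓘(ℝ, EZ) 𝓘(ℝ, ES) ∞ α) {f : Z → ℝ}
    (hf : RFSmAt (E := EZ) f z) (h0 : ∀ᶠ y in 𝓝 z, α y = α z → f y = 0)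
    {X : ∀ z : Z, TangentSpace 𝓘(ℝ, EZ) z} (hX : RSmAt X z)
    (hv : ∀ᶠ y in 𝓝 z, mfderiv 𝓘(ℝ, EZ) 𝓘(ℝ, ES) α y (X y) = 0) : dirDeriv f z (X z) = 0 := by
  have := FiniteDimensional.complete ℝ EZ
  -- Instead of a manifold structure on the fibre, the integral curve of X through z is used: it
  -- stays in the fibre because X is vertical, so f vanishes along it.
  obtain ⟨γ, hγ0, hγ⟩ := exists_isMIntegralCurveAt_of_contMDiffAt_boundaryless (I := 𝓘(ℝ, EZ)) 0
    (hX.self_of_nhds.of_le (m := 1) (by simp))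
  have hc : ContinuousAt γ 0 := hγ.continuousAt
  have hγ' : ∀ᶠ t in 𝓝 (0 : ℝ), α (γ t) = α z := by
    have hs : ∀ᶠ t in 𝓝 (0 : ℝ), α (γ t) ∈ (chartAt ES (α z)).source :=
      (hα.continuous.continuousAt.comp hc).eventually_mem
        ((chartAt ES (α z)).open_source.mem_nhds (by simp [hγ0]))
    have hv' : ∀ᶠ t in 𝓝 (0 : ℝ), mfderiv 𝓘(ℝ, EZ) 𝓘(ℝ, ES) α (γ t) (X (γ t)) = 0 :=
      hc.eventually (by rwa [hγ0])
    obtain ⟨ε, hε, hb⟩ := Metric.eventually_nhds_iff_ball.1 (hs.and (hv'.and hγ))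
    -- In a chart of S the curve α ∘ γ has derivative zero on a ball, hence is constant there.
    let g : ℝ → ES := fun t => extChartAt 𝓘(ℝ, ES) (α z) (α (γ t))
    have hg : ∀ t ∈ Metric.ball (0 : ℝ) ε, HasFDerivAt g (0 : ℝ →L[ℝ] ES) t := by
      intro t ht
      obtain ⟨h1, h2, h3⟩ := hb t ht
      have h4 := (mdifferentiableAt_extChartAt (I := 𝓘(ℝ, ES)) h1).hasMFDerivAt.comp t
        (((hα (γ t)).mdifferentiableAt (by simp)).hasMFDerivAt.comp t h3)
      refine (hasMFDerivAt_iff_hasFDerivAt.1 h4).congr_fderiv (ContinuousLinearMap.ext fun r => ?_)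
      change mfderiv 𝓘(ℝ, ES) 𝓘(ℝ, ES) (extChartAt 𝓘(ℝ, ES) (α z)) (α (γ t))
        (mfderiv 𝓘(ℝ, EZ) 𝓘(ℝ, ES) α (γ t) ((show ℝ from r) • X (γ t))) = 0
      rw [map_smul, h2, smul_zero, map_zero]
    filter_upwards [Metric.ball_mem_nhds (0 : ℝ) hε] with t ht
    have h6 : g t = g 0 := (convex_ball (0 : ℝ) ε).is_const_of_fderivWithin_eq_zero (𝕜 := ℝ)
      (fun s hs => (hg s hs).differentiableAt.differentiableWithinAt)
      (fun s hs => by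
        rw [fderivWithin_of_isOpen Metric.isOpen_ball hs]; exact (hg s hs).fderiv)
      ht (Metric.mem_ball_self hε)
    have h7 := (extChartAt 𝓘(ℝ, ES) (α z)).injOn (by simpa using (hb t ht).1)
      (by simpa using (hb 0 (Metric.mem_ball_self hε)).1) h6
    rw [h7, hγ0]
  have h1 : (fun t => f (γ t)) =ᶠ[𝓝 0] fun _ => 0 := by
    have h0' : ∀ᶠ y in 𝓝 (γ 0), α y = α z → f y = 0 := by rwa [hγ0]
    filter_upwards [hγ', hc.eventually h0'] with t h2 h3 using h3 h2
  have hf' : HasMFDerivAt 𝓘(ℝ, EZ) 𝓘(ℝ, ℝ) f (γ 0) (mfderiv 𝓘(ℝ, EZ) 𝓘(ℝ, ℝ) f (γ 0)) := by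
    rw [hγ0]; exact hf.mdiff.hasMFDerivAt
  have h2 := hasMFDerivAt_iff_hasFDerivAt.1 (hf'.comp 0 hγ.hasMFDerivAt)
  have h3 : HasFDerivAt (f ∘ γ) (0 : ℝ →L[ℝ] ℝ) 0 :=
    (hasFDerivAt_const (0 : ℝ) (0 : ℝ)).congr_of_eventuallyEq h1
  have h4 := DFunLike.congr_fun (h3.unique h2).symm (1 : ℝ)
  change mfderiv 𝓘(ℝ, EZ) 𝓘(ℝ, ℝ) f (γ 0) ((1 : ℝ) • X (γ 0)) = 0 at h4
  rw [one_smul, hγ0] at h4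
  exact h4

/-- A smooth vertical field that vanishes on a fibre has vanishing brackets with smooth vertical
fields on this fibre. -/
theorem bracket_eq_zero_of_fiber [FiniteDimensional ℝ ES] (hα : ContMDiff 𝓘(ℝ, EZ) 𝓘(ℝ, ES) ∞ α)
    {u Y : ∀ z : Z, TC EZ z} (hu : SmAt u z) (hY : SmAt Y z)
    (hv : ∀ᶠ y in 𝓝 z, dC (ES := ES) α y (u y) = 0) (h0 : ∀ᶠ y in 𝓝 z, α y = α z → Y y = 0) :
    bracket u Y z = 0 := by
  have := FiniteDimensional.complete ℝ EZ
  obtain ⟨n, e, he⟩ := exists_frameAt_top (E := EZ) z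
  obtain ⟨c, hc, hcY⟩ := he.exists_coeff ⟨hY, by simp⟩
  rw [bracket_congr (Eventually.of_forall fun _ => rfl) hcY,
    bracket_sum_right _ fun i _ => (he.1 i).smul (hc i)]
  refine Finset.sum_eq_zero fun i _ => ?_
  -- By independence of the frame each coefficient vanishes on the fibre, so both the coefficient
  -- and its derivative along u vanish at z, and with them both terms of the Leibniz rule.
  have hci : ∀ᶠ y in 𝓝 z, α y = α z → c i y = 0 := by
    filter_upwards [hcY, h0, he.2] with y h1 h2 h3 h4
    rw [h2 h4] at h1
    exact Fintype.linearIndependent_iff.1 h3.1 (fun i => c i y) h1.symm i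
  have hre := fun X => dirDeriv_eq_zero_of_fiber (X := X) (f := fun y => (c i y).re) hα (hc i).1
    (hci.mono fun y hy h => by rw [hy h, Complex.zero_re])
  have him := fun X => dirDeriv_eq_zero_of_fiber (X := X) (f := fun y => (c i y).im) hα (hc i).2
    (hci.mono fun y hy h => by rw [hy h, Complex.zero_im])
  have hvr := hv.mono fun y hy => congrArg Cx.re hy
  have hvi := hv.mono fun y hy => congrArg Cx.im hy
  have hD : cD (c i) z (u z) = 0 := by
    apply Complex.ext <;> simp only [cD, hre _ hu.1 hvr, hre _ hu.2 hvi, him _ hu.1 hvr, him _ hu.2 hvi,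
      sub_zero, add_zero, Complex.zero_re, Complex.zero_im]
  rw [bracket_smul_right (hc i) (he.1 i), hci.self_of_nhds rfl, hD]
  simp

end Maps

/-! ### Types of tangent vectors and holomorphic fields on the base. -/

section Base

variable {ES : Type*} [NormedAddCommGroup ES] [NormedSpace ℂ ES]
  {S : Type*} [TopologicalSpace S] [ChartedSpace ES S]

/-! ### The types of complex tangent vectors -/

section Types

variable {s : S}

theorem tangentI_tangentI (x : TangentSpace 𝓘(ℝ, ES) s) : tangentI s (tangentI s x) = -x := by
  change Complex.I • (Complex.I • (show ES from x)) = -(show ES from x)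
  rw [smul_smul, Complex.I_mul_I, neg_one_smul]

theorem p10_re (v : TC ES s) : (p10 s v).re = (1 / 2 : ℝ) • (v.re + tangentI s v.im) := by
  simp [p10, Cx.map]

theorem p10_im (v : TC ES s) : (p10 s v).im = (1 / 2 : ℝ) • (v.im - tangentI s v.re) := by
  simp [p10, Cx.map]

theorem p01_re (v : TC ES s) : (p01 s v).re = (1 / 2 : ℝ) • (v.re - tangentI s v.im) := by
  simp [p01, Cx.map, sub_eq_add_neg]

theorem p01_im (v : TC ES s) : (p01 s v).im = (1 / 2 : ℝ) • (v.im + tangentI s v.re) := by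
  simp [p01, Cx.map]

theorem p10_add_p01 (v : TC ES s) : p10 s v + p01 s v = v := by
  ext
  · rw [add_re, p10_re, p01_re]; module
  · rw [add_im, p10_im, p01_im]; module

theorem mem_T10_iff {v : TC ES s} : v ∈ T10 s ↔ v.im = -tangentI s v.re := by
  rw [T10, LinearMap.mem_ker]
  constructor
  · intro h
    have h1 := congrArg Cx.im h
    rw [p01_im, zero_im, smul_eq_zero] at h1
    exact eq_neg_of_add_eq_zero_left (h1.resolve_left (by norm_num))
  · intro h
    ext
    · rw [p01_re, h, map_neg, tangentI_tangentI]; simp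
    · rw [p01_im, h]; simp

theorem mem_T01_iff {v : TC ES s} : v ∈ T01 s ↔ v.im = tangentI s v.re := by
  rw [T01, LinearMap.mem_ker]
  constructor
  · intro h
    have h1 := congrArg Cx.im h
    rw [p10_im, zero_im, smul_eq_zero] at h1
    exact sub_eq_zero.1 (h1.resolve_left (by norm_num))
  · intro h
    ext
    · rw [p10_re, h, tangentI_tangentI]; simp
    · rw [p10_im, h]; simp

theorem p10_mem (v : TC ES s) : p10 s v ∈ T10 s := by
  rw [mem_T10_iff, p10_im, p10_re, map_smul, map_add, tangentI_tangentI]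
  module

theorem p01_mem (v : TC ES s) : p01 s v ∈ T01 s := by
  rw [mem_T01_iff, p01_im, p01_re, map_smul, map_sub, tangentI_tangentI]
  module

theorem p01_of_mem_T10 {v : TC ES s} (h : v ∈ T10 s) : p01 s v = 0 := h

theorem p10_of_mem_T01 {v : TC ES s} (h : v ∈ T01 s) : p10 s v = 0 := h

theorem p10_of_mem_T10 {v : TC ES s} (h : v ∈ T10 s) : p10 s v = v := by
  conv_rhs => rw [← p10_add_p01 v, p01_of_mem_T10 h, add_zero]

theorem p01_of_mem_T01 {v : TC ES s} (h : v ∈ T01 s) : p01 s v = v := by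
  conv_rhs => rw [← p10_add_p01 v, p10_of_mem_T01 h, zero_add]

theorem conj_mem_T10 {v : TC ES s} : conj v ∈ T10 s ↔ v ∈ T01 s := by
  rw [mem_T10_iff, mem_T01_iff, conj_re, conj_im, neg_inj]

theorem conj_mem_T01 {v : TC ES s} : conj v ∈ T01 s ↔ v ∈ T10 s := by
  rw [← conj_mem_T10, conj_conj]

theorem eq_zero_of_mem_T10_of_mem_T01 {v : TC ES s} (h : v ∈ T10 s) (h' : v ∈ T01 s) : v = 0 := by
  rw [← p10_of_mem_T10 h, p10_of_mem_T01 h']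

end Types

/-! ### Holomorphic functions and fields -/

section Restrict

variable {F : Type*} [NormedAddCommGroup F] [NormedSpace ℂ F] {f : S → F} {s : S}

theorem hasMFDerivAt_real {f' : ES →L[ℂ] F} (h : HasMFDerivAt 𝓘(ℂ, ES) 𝓘(ℂ, F) f s f') :
    HasMFDerivAt 𝓘(ℝ, ES) 𝓘(ℝ, F) f s (f'.restrictScalars ℝ) :=
  ⟨h.1, HasFDerivWithinAt.restrictScalars ℝ h.2⟩

theorem contMDiffAt_real (h : ContMDiffAt 𝓘(ℂ, ES) 𝓘(ℂ, F) ω f s) :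
    ContMDiffAt 𝓘(ℝ, ES) 𝓘(ℝ, F) ∞ f s := by
  rw [contMDiffAt_iff] at h ⊢
  exact ⟨h.1, (ContDiffWithinAt.restrict_scalars ℝ h.2).of_le le_top⟩

end Restrict

theorem cD_of_hasMFDerivAt {f : S → ℂ} {s : S} {f' : ES →L[ℂ] ℂ}
    (h : HasMFDerivAt 𝓘(ℂ, ES) 𝓘(ℂ, ℂ) f s f') (v : TC ES s) :
    cD f s v = f' (show ES from v.re) + Complex.I * f' (show ES from v.im) := by
  have h0 := hasMFDerivAt_real h
  have hr : HasMFDerivAt 𝓘(ℝ, ES) 𝓘(ℝ, ℝ) (fun y => (f y).re) s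
      (Complex.reCLM.comp (f'.restrictScalars ℝ)) :=
    (Complex.reCLM.hasFDerivAt (x := f s)).hasMFDerivAt.comp s h0
  have hi : HasMFDerivAt 𝓘(ℝ, ES) 𝓘(ℝ, ℝ) (fun y => (f y).im) s
      (Complex.imCLM.comp (f'.restrictScalars ℝ)) :=
    (Complex.imCLM.hasFDerivAt (x := f s)).hasMFDerivAt.comp s h0
  have hr' : ∀ w : TangentSpace 𝓘(ℝ, ES) s, dirDeriv (fun y => (f y).re) s w
      = (f' (show ES from w)).re := fun w => by rw [dirDeriv, hr.mfderiv]; rfl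
  have hi' : ∀ w : TangentSpace 𝓘(ℝ, ES) s, dirDeriv (fun y => (f y).im) s w
      = (f' (show ES from w)).im := fun w => by rw [dirDeriv, hi.mfderiv]; rfl
  apply Complex.ext <;> simp [cD, hr', hi', sub_eq_add_neg, add_comm]

/-- Cauchy-Riemann: the vector is x + iJx, and f'(Jx) = i f'(x). -/
theorem cD_eq_zero_of_mem_T01 {f : S → ℂ} {s : S} (h : MDifferentiableAt 𝓘(ℂ, ES) 𝓘(ℂ, ℂ) f s)
    {v : TC ES s} (hv : v ∈ T01 s) : cD f s v = 0 := by
  obtain ⟨f', hf'⟩ : ∃ f' : ES →L[ℂ] ℂ, HasMFDerivAt 𝓘(ℂ, ES) 𝓘(ℂ, ℂ) f s f' := ⟨_, h.hasMFDerivAt⟩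
  rw [cD_of_hasMFDerivAt hf', mem_T01_iff.1 hv]
  change _ + Complex.I * f' (Complex.I • (show ES from v.re)) = 0
  rw [map_smul, smul_eq_mul, ← mul_assoc, Complex.I_mul_I]
  ring

/-- For x - iJx the two summands are both f'(x). The resulting factor 2 later cancels the 1/2 in
`p10`. -/
theorem cD_of_mem_T10 {f : S → ℂ} {s : S} {f' : ES →L[ℂ] ℂ}
    (h : HasMFDerivAt 𝓘(ℂ, ES) 𝓘(ℂ, ℂ) f s f') {v : TC ES s} (hv : v ∈ T10 s) :
    cD f s v = 2 * f' (show ES from v.re) := by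
  rw [cD_of_hasMFDerivAt h, mem_T10_iff.1 hv]
  have : f' (-(Complex.I • (show ES from v.re))) = -(Complex.I * f' (show ES from v.re)) := by
    rw [map_neg, map_smul, smul_eq_mul]
  change _ + Complex.I * f' (-(Complex.I • (show ES from v.re))) = _
  rw [this, mul_neg, ← mul_assoc, Complex.I_mul_I]
  ring

variable [IsManifold 𝓘(ℂ, ES) ω S]

/-- The differential of the chart at `s₀`. -/
def chartD (s₀ s : S) : ES →L[ℂ] ES :=
  show TangentSpace 𝓘(ℂ, ES) s →L[ℂ] TangentSpace 𝓘(ℂ, ES) (extChartAt 𝓘(ℂ, ES) s₀ s) from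
    mfderiv 𝓘(ℂ, ES) 𝓘(ℂ, ES) (extChartAt 𝓘(ℂ, ES) s₀) s

theorem hasMFDerivAt_chart {s₀ s : S} (hs : s ∈ (chartAt ES s₀).source) :
    HasMFDerivAt 𝓘(ℂ, ES) 𝓘(ℂ, ES) (extChartAt 𝓘(ℂ, ES) s₀) s (chartD (ES := ES) s₀ s) := by
  have : IsManifold 𝓘(ℂ, ES) 1 S := IsManifold.of_le (n := ω) le_top
  exact (mdifferentiableAt_extChartAt (I := 𝓘(ℂ, ES)) hs).hasMFDerivAt

/-- The real and the complex tangent bundle are trivialized by the same complex linear map `chartD`.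
This is the bridge between holomorphic and smooth fields. -/
theorem rcoord_eq_chartD {s₀ s : S} (hs : s ∈ (chartAt ES s₀).source)
    (v : TangentSpace 𝓘(ℝ, ES) s) : rcoord s₀ s v = chartD s₀ s (show ES from v) := by
  have h1 : rcoord s₀ s v
      = (trivializationAt ES (TangentSpace 𝓘(ℝ, ES)) s₀).continuousLinearMapAt ℝ s v := by
    exact (congrFun ((trivializationAt ES (TangentSpace 𝓘(ℝ, ES)) s₀).coe_linearMapAt_of_mem (R := ℝ) hs) v).symm
  rw [h1, TangentBundle.continuousLinearMapAt_trivializationAt hs]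
  have h2 := (hasMFDerivAt_real (hasMFDerivAt_chart hs)).mfderiv
  exact DFunLike.congr_fun h2 v

theorem ccoord_eq_chartD {s₀ s : S} (hs : s ∈ (chartAt ES s₀).source)
    (v : TangentSpace 𝓘(ℂ, ES) s) :
    (trivializationAt ES (TangentSpace 𝓘(ℂ, ES)) s₀ ⟨s, v⟩).2 = chartD s₀ s (show ES from v) := by
  have : IsManifold 𝓘(ℂ, ES) 1 S := IsManifold.of_le (n := ω) le_top
  have h1 : (trivializationAt ES (TangentSpace 𝓘(ℂ, ES)) s₀ ⟨s, v⟩).2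
      = (trivializationAt ES (TangentSpace 𝓘(ℂ, ES)) s₀).continuousLinearMapAt ℂ s v := by
    exact (congrFun ((trivializationAt ES (TangentSpace 𝓘(ℂ, ES)) s₀).coe_linearMapAt_of_mem (R := ℂ) hs) v).symm
  rw [h1, TangentBundle.continuousLinearMapAt_trivializationAt hs]
  rfl

theorem contMDiffAt_complex_iff {X : ∀ s : S, TangentSpace 𝓘(ℂ, ES) s} {s₀ s : S} (hs : s ∈ (chartAt ES s₀).source) :
    ContMDiffAt 𝓘(ℂ, ES) (𝓘(ℂ, ES).tangent) ω
      (fun s => (⟨s, X s⟩ : TangentBundle 𝓘(ℂ, ES) S)) s ↔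
    ContMDiffAt 𝓘(ℂ, ES) 𝓘(ℂ, ES) ω (fun s => chartD s₀ s (show ES from X s)) s := by
  have : IsManifold 𝓘(ℂ, ES) 1 S := IsManifold.of_le (n := ω) le_top
  -- No regularity is lost, as ω + 1 = ω.
  have : IsManifold 𝓘(ℂ, ES) (ω + 1) S := ‹IsManifold 𝓘(ℂ, ES) ω S›
  have h := (trivializationAt ES (TangentSpace 𝓘(ℂ, ES)) s₀).contMDiffAt_section_iff
    (IB := 𝓘(ℂ, ES)) (s := X) (n := ω) (x₀ := s) hs
  refine h.trans (Filter.EventuallyEq.contMDiffAt_iff ?_)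
  filter_upwards [(chartAt ES s₀).open_source.mem_nhds hs] with y hy
  exact ccoord_eq_chartD hy _

theorem chartD_bijective {s₀ s : S} (hs : s ∈ (chartAt ES s₀).source) :
    Function.Bijective (chartD (ES := ES) s₀ s) := by
  have : IsManifold 𝓘(ℂ, ES) 1 S := IsManifold.of_le (n := ω) le_top
  exact (isInvertible_mfderiv_extChartAt (I := 𝓘(ℂ, ES)) (x := s₀) (y := s) (by simpa using hs)).bijective

/-- Holomorphic vector fields are smooth. -/
theorem IsHolFieldOn.smAt {V : Set S} (hV : IsOpen V) {a : ∀ s : S, TC ES s} (ha : IsHolFieldOn V a)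
    {s : S} (hs : s ∈ V) : SmAt a s := by
  have hs0 : s ∈ (chartAt ES s).source := mem_chart_source ES s
  have h1 : ∀ᶠ y in 𝓝 s, ContMDiffAt 𝓘(ℝ, ES) 𝓘(ℝ, ES) ∞
      (fun y => chartD s y (show ES from (a y).re)) y := by
    filter_upwards [(chartAt ES s).open_source.mem_nhds hs0, hV.mem_nhds hs] with y hy hyV
    exact contMDiffAt_real ((contMDiffAt_complex_iff hy).1 ((ha.2 y hyV).contMDiffAt (hV.mem_nhds hyV)))
  have h2 : RSmAt (fun y => (a y).re) s := by
    rw [rSmAt_iff hs0]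
    filter_upwards [h1, (chartAt ES s).open_source.mem_nhds hs0] with y hy hy0
    refine hy.congr_of_eventuallyEq ?_
    filter_upwards [(chartAt ES s).open_source.mem_nhds hy0] with w hw
    exact rcoord_eq_chartD hw _
  -- The imaginary part of a (1,0)-field is -J of its real part, and in the chart J is
  -- multiplication by i because `chartD` is complex linear.
  have h3 : RSmAt (fun y => tangentI y (a y).re) s := by
    rw [rSmAt_iff hs0]
    filter_upwards [h1, (chartAt ES s).open_source.mem_nhds hs0] with y hy hy0
    have h4 : ContMDiffAt 𝓘(ℝ, ES) 𝓘(ℝ, ES) ∞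
      (fun y => Complex.I • chartD s y (show ES from (a y).re)) y :=
      ((Complex.I • ContinuousLinearMap.id ℝ ES).contDiff.contMDiff.contMDiffAt).comp y hy
    refine h4.congr_of_eventuallyEq ?_
    filter_upwards [(chartAt ES s).open_source.mem_nhds hy0] with w hw
    rw [rcoord_eq_chartD hw]
    exact (chartD s w).map_smul Complex.I _
  refine ⟨h2, h3.neg.congr ?_⟩
  filter_upwards [hV.mem_nhds hs] with y hy
  exact (mem_T10_iff.1 (ha.1 y hy)).symm

end Base

/-! ### Coordinate frames and extensions with constant coefficients. -/

section Base

variable {ES : Type*} [NormedAddCommGroup ES] [NormedSpace ℂ ES] [FiniteDimensional ℂ ES]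
  {S : Type*} [TopologicalSpace S] [ChartedSpace ES S] [IsManifold 𝓘(ℂ, ES) ω S]

/-- The index type of the complex coordinates and their conjugates. -/
abbrev CIdx (ES : Type*) [NormedAddCommGroup ES] [NormedSpace ℂ ES] : Type :=
  Fin (Module.finrank ℂ ES)

/-- The linear coordinates on the model space. -/
def lcoord (ES : Type*) [NormedAddCommGroup ES] [NormedSpace ℂ ES] [FiniteDimensional ℂ ES]
    (i : CIdx ES) : ES →L[ℂ] ℂ :=
  LinearMap.toContinuousLinearMap ((Module.finBasis ℂ ES).coord i)

/-- The holomorphic coordinates of the chart at `s₀`. -/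
def hcoord (s₀ : S) (i : CIdx ES) (s : S) : ℂ := lcoord ES i (extChartAt 𝓘(ℂ, ES) s₀ s)

/-- The coordinate vector fields of the chart at `s₀`. -/
def hframe (s₀ : S) (i : CIdx ES) (s : S) : TC ES s :=
  -- Outside the chart `invFun` may return an arbitrary vector; `p10` still makes the value a
  -- (1,0)-vector at every point of S.
  p10 s (ofReal (show ES from Function.invFun (chartD s₀ s) (Module.finBasis ℂ ES i)))

variable {s₀ s : S}

theorem hasMFDerivAt_hcoord (hs : s ∈ (chartAt ES s₀).source) (i : CIdx ES) :
    HasMFDerivAt 𝓘(ℂ, ES) 𝓘(ℂ, ℂ) (hcoord s₀ i) s ((lcoord ES i).comp (chartD (ES := ES) s₀ s)) :=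
  (lcoord ES i).hasFDerivAt.hasMFDerivAt.comp s (hasMFDerivAt_chart hs)

theorem contMDiffAt_hcoord (hs : s ∈ (chartAt ES s₀).source) (i : CIdx ES) :
    ContMDiffAt 𝓘(ℂ, ES) 𝓘(ℂ, ℂ) ω (hcoord s₀ i) s :=
  (lcoord ES i).contDiff.contMDiff.contMDiffAt.comp s (contMDiffAt_extChartAt' hs)

theorem fSmAt_of_contMDiffAt {f : S → ℂ} (h : ∀ᶠ y in 𝓝 s, ContMDiffAt 𝓘(ℂ, ES) 𝓘(ℂ, ℂ) ω f y) :
    FSmAt ES f s := by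
  constructor
  · filter_upwards [h] with y hy
    exact Complex.reCLM.contDiff.contMDiff.contMDiffAt.comp y (contMDiffAt_real hy)
  · filter_upwards [h] with y hy
    exact Complex.imCLM.contDiff.contMDiff.contMDiffAt.comp y (contMDiffAt_real hy)

theorem fSmAt_hcoord (hs : s ∈ (chartAt ES s₀).source) (i : CIdx ES) : FSmAt ES (hcoord s₀ i) s := by
  apply fSmAt_of_contMDiffAt
  filter_upwards [(chartAt ES s₀).open_source.mem_nhds hs] with y hy using contMDiffAt_hcoord hy i

theorem chartD_hframe (hs : s ∈ (chartAt ES s₀).source) (i : CIdx ES) :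
    chartD s₀ s (show ES from (hframe s₀ i s).re) = (1 / 2 : ℂ) • Module.finBasis ℂ ES i := by
  have h1 : (show ES from (hframe s₀ i s).re)
      = (1 / 2 : ℂ) • (show ES from Function.invFun (chartD s₀ s) (Module.finBasis ℂ ES i)) := by
    rw [hframe, p10_re]
    change (1 / 2 : ℝ) • ((show ES from Function.invFun (chartD s₀ s) (Module.finBasis ℂ ES i))
      + Complex.I • (0 : ES)) = _
    rw [smul_zero, add_zero, ← Complex.coe_smul]
    norm_num
  rw [h1, map_smul]
  congr 1
  exact Function.rightInverse_invFun (chartD_bijective hs).2 _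

theorem hframe_mem (s₀ s : S) (i : CIdx ES) : hframe s₀ i s ∈ T10 s := p10_mem _

theorem isHolFieldOn_hframe (s₀ : S) (i : CIdx ES) :
    IsHolFieldOn (chartAt ES s₀).source (hframe s₀ i) := by
  refine ⟨fun s _ => hframe_mem s₀ s i, fun s hs => ContMDiffAt.contMDiffWithinAt ?_⟩
  refine (contMDiffAt_complex_iff hs).2 ?_
  refine (contMDiffAt_const (c := (1 / 2 : ℂ) • Module.finBasis ℂ ES i)).congr_of_eventuallyEq ?_
  filter_upwards [(chartAt ES s₀).open_source.mem_nhds hs] with y hy using chartD_hframe hy i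

theorem smAt_hframe (hs : s ∈ (chartAt ES s₀).source) (i : CIdx ES) : SmAt (hframe s₀ i) s :=
  (isHolFieldOn_hframe s₀ i).smAt (chartAt ES s₀).open_source hs

theorem cD_hcoord (hs : s ∈ (chartAt ES s₀).source) (i : CIdx ES) {v : TC ES s} (hv : v ∈ T10 s) :
    cD (hcoord s₀ i) s v = 2 * lcoord ES i (chartD s₀ s (show ES from v.re)) :=
  cD_of_mem_T10 (hasMFDerivAt_hcoord hs i) hv

theorem cD_hcoord_of_mem_T01 (hs : s ∈ (chartAt ES s₀).source) (i : CIdx ES) {v : TC ES s}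
    (hv : v ∈ T01 s) : cD (hcoord s₀ i) s v = 0 :=
  cD_eq_zero_of_mem_T01 (hasMFDerivAt_hcoord hs i).mdifferentiableAt hv

theorem cD_hcoord_hframe (hs : s ∈ (chartAt ES s₀).source) (i j : CIdx ES) :
    cD (hcoord s₀ i) s (hframe s₀ j s) = if i = j then 1 else 0 := by
  rw [cD_hcoord hs i (hframe_mem s₀ s j), chartD_hframe hs, map_smul]
  have : lcoord ES i (Module.finBasis ℂ ES j) = if i = j then 1 else 0 := by
    rw [lcoord, LinearMap.coe_toContinuousLinearMap', Module.Basis.coord_apply, Module.Basis.repr_self,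
      Finsupp.single_apply]
    simp only [eq_comm]
  rw [this]
  split_ifs <;> simp

/-- The difference of the two sides is of type (1,0) and is killed by the differentials of all
holomorphic coordinates, so its real part vanishes in the chart, and the real part determines a
(1,0)-vector. -/
theorem eq_sum_hframe (hs : s ∈ (chartAt ES s₀).source) {v : TC ES s} (hv : v ∈ T10 s) :
    v = ∑ i : CIdx ES, cD (hcoord s₀ i) s v • hframe s₀ i s := by
  set w := v - ∑ i : CIdx ES, cD (hcoord s₀ i) s v • hframe s₀ i s with hw
  have hw10 : w ∈ T10 s := (T10 s).sub_mem hv ((T10 s).sum_mem fun i _ =>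
    (T10 s).smul_mem _ (hframe_mem s₀ s i))
  have h0 : ∀ j : CIdx ES, cD (hcoord s₀ j) s w = 0 := by
    intro j
    rw [hw]
    simp only [← cDL_apply, map_sub, map_sum, map_smul]
    simp only [cDL_apply, cD_hcoord_hframe hs]
    simp
  have h1 : chartD s₀ s (show ES from w.re) = 0 := by
    rw [← (Module.finBasis ℂ ES).forall_coord_eq_zero_iff]
    intro j
    have h2 := h0 j
    rw [cD_hcoord hs j hw10] at h2
    exact (mul_eq_zero.1 h2).resolve_left two_ne_zero
  have h2 : w.re = 0 := (injective_iff_map_eq_zero _).1 (chartD_bijective hs).1 _ h1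
  have h3 : w = 0 := by
    ext
    · exact h2
    · rw [mem_T10_iff.1 hw10, h2, map_zero, neg_zero]; rfl
  exact sub_eq_zero.1 h3

/-- The coefficients of a holomorphic field in holomorphic coordinates are holomorphic. -/
theorem cD_coeff_eq_zero {V : Set S} (hV : IsOpen V) {a : ∀ s : S, TC ES s} (ha : IsHolFieldOn V a)
    (hsV : s ∈ V) (hs : s ∈ (chartAt ES s₀).source) (i : CIdx ES) {w : TC ES s} (hw : w ∈ T01 s) :
    cD (fun y => cD (hcoord s₀ i) y (a y)) s w = 0 := by
  have h1 : ContMDiffAt 𝓘(ℂ, ES) 𝓘(ℂ, ES) ω (fun y => chartD s₀ y (show ES from (a y).re)) s :=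
    (contMDiffAt_complex_iff hs).1 ((ha.2 s hsV).contMDiffAt (hV.mem_nhds hsV))
  have h2 : ContMDiffAt 𝓘(ℂ, ES) 𝓘(ℂ, ℂ) ω
      (fun y => ((2 : ℂ) • lcoord ES i) (chartD s₀ y (show ES from (a y).re))) s :=
    ((2 : ℂ) • lcoord ES i).contDiff.contMDiff.contMDiffAt.comp s h1
  rw [cD_congr (g := fun y => ((2 : ℂ) • lcoord ES i) (chartD s₀ y (show ES from (a y).re)))]
  · exact cD_eq_zero_of_mem_T01 (h2.mdifferentiableAt (by simp)) hw
  · filter_upwards [hV.mem_nhds hsV, (chartAt ES s₀).open_source.mem_nhds hs] with y hyV hy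
    rw [cD_hcoord hy i (ha.1 y hyV)]
    rfl

/-! ### Real frames -/

/-- The coordinates and their conjugates. -/
def bcoord (s₀ : S) : CIdx ES ⊕ CIdx ES → S → ℂ :=
  Sum.elim (hcoord s₀) fun i s => (starRingEnd ℂ) (hcoord s₀ i s)

/-- The coordinate vector fields and their conjugates. -/
def bframe (s₀ : S) : CIdx ES ⊕ CIdx ES → ∀ s : S, TC ES s :=
  Sum.elim (hframe s₀) fun i s => conj (hframe s₀ i s)

theorem fSmAt_bcoord (hs : s ∈ (chartAt ES s₀).source) (k : CIdx ES ⊕ CIdx ES) :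
    FSmAt ES (bcoord s₀ k) s := by
  cases k with
  | inl i => exact fSmAt_hcoord hs i
  | inr i => exact (fSmAt_hcoord hs i).conj

theorem smAt_bframe (hs : s ∈ (chartAt ES s₀).source) (k : CIdx ES ⊕ CIdx ES) :
    SmAt (bframe s₀ k) s := by
  cases k with
  | inl i => exact smAt_hframe hs i
  | inr i => exact (smAt_hframe hs i).conj

theorem bframe_inr_mem (s₀ s : S) (i : CIdx ES) : bframe s₀ (.inr i) s ∈ T01 s :=
  conj_mem_T01.2 (hframe_mem s₀ s i)

theorem cD_bcoord_inl (hs : s ∈ (chartAt ES s₀).source) (i : CIdx ES) {v : TC ES s}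
    (hv : v ∈ T01 s) : cD (bcoord s₀ (.inl i)) s v = 0 := cD_hcoord_of_mem_T01 hs i hv

theorem cD_bcoord_inr (hs : s ∈ (chartAt ES s₀).source) (i : CIdx ES) {v : TC ES s}
    (hv : v ∈ T10 s) : cD (bcoord s₀ (.inr i)) s v = 0 := by
  change cD (fun s => (starRingEnd ℂ) (hcoord s₀ i s)) s v = 0
  rw [cD_conj, cD_hcoord_of_mem_T01 hs i (conj_mem_T01.2 hv), map_zero]

theorem cD_bcoord_bframe (hs : s ∈ (chartAt ES s₀).source) (k l : CIdx ES ⊕ CIdx ES) :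
    cD (bcoord s₀ k) s (bframe s₀ l s) = if k = l then 1 else 0 := by
  rcases k with i | i <;> rcases l with j | j
  · simpa [bcoord, bframe] using cD_hcoord_hframe hs i j
  · simpa using cD_bcoord_inl hs i (bframe_inr_mem s₀ s j)
  · simpa using! cD_bcoord_inr hs i (hframe_mem s₀ s j)
  · simp only [bcoord, bframe, Sum.elim_inr, cD_conj, conj_conj, cD_hcoord_hframe hs]
    split_ifs <;> simp_all

theorem eq_sum_bframe (hs : s ∈ (chartAt ES s₀).source) (v : TC ES s) :
    v = ∑ k : CIdx ES ⊕ CIdx ES, cD (bcoord s₀ k) s v • bframe s₀ k s := by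
  have h1 : ∀ k : CIdx ES ⊕ CIdx ES, cD (bcoord s₀ k) s v = cD (bcoord s₀ k) s (p10 s v) + cD (bcoord s₀ k) s (p01 s v) := by
    intro k
    conv_lhs => rw [← p10_add_p01 v]
    exact map_add (cDL (bcoord s₀ k) s) _ _
  rw [Fintype.sum_sum_type]
  simp only [h1, cD_bcoord_inl hs _ (p01_mem v), cD_bcoord_inr hs _ (p10_mem v), add_zero, zero_add]
  have h2 := congrArg conj (eq_sum_hframe hs (conj_mem_T10.2 (p01_mem v)))
  rw [conj_conj, conj_sum] at h2
  conv_lhs => rw [← p10_add_p01 v, h2, eq_sum_hframe hs (p10_mem v)]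
  congr 1
  refine Finset.sum_congr rfl fun i _ => ?_
  rw [conj_smul, ← cD_conj]
  rfl

/-- The extension of a vector with constant coefficients in the chart. -/
def cext (s₀ : S) : TC ES s₀ →ₗ[ℂ] (∀ s : S, TC ES s) where
  toFun v s := ∑ k : CIdx ES ⊕ CIdx ES, cD (bcoord s₀ k) s₀ v • bframe s₀ k s
  map_add' v w := by
    ext1 s
    simp only [← cDL_apply, map_add, add_smul, Finset.sum_add_distrib, Pi.add_apply]
  map_smul' c v := by
    ext1 s
    simp only [← cDL_apply, map_smul, smul_eq_mul, mul_smul, Finset.smul_sum, Pi.smul_apply,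
      RingHom.id_apply]

theorem cext_apply (s₀ : S) (v : TC ES s₀) (s : S) :
    cext s₀ v s = ∑ k : CIdx ES ⊕ CIdx ES, cD (bcoord s₀ k) s₀ v • bframe s₀ k s := rfl

theorem cext_self (s₀ : S) (v : TC ES s₀) : cext s₀ v s₀ = v :=
  (eq_sum_bframe (mem_chart_source ES s₀) v).symm

theorem smAt_cext (hs : s ∈ (chartAt ES s₀).source) (v : TC ES s₀) : SmAt (cext s₀ v) s :=
  SmAt.sum _ fun k _ => (smAt_bframe hs k).const_smul _

theorem cD_bcoord_cext (hs : s ∈ (chartAt ES s₀).source) (k : CIdx ES ⊕ CIdx ES) (v : TC ES s₀) :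
    cD (bcoord s₀ k) s (cext s₀ v s) = cD (bcoord s₀ k) s₀ v := by
  rw [cext_apply, ← cDL_apply]
  simp only [map_sum, map_smul]
  simp only [cDL_apply, cD_bcoord_bframe hs]
  simp

theorem cext_mem_T01 {v : TC ES s₀} (hv : v ∈ T01 s₀) (s : S) : cext s₀ v s ∈ T01 s := by
  rw [cext_apply, Fintype.sum_sum_type]
  simp only [cD_bcoord_inl (mem_chart_source ES s₀) _ hv, zero_smul, Finset.sum_const_zero, zero_add]
  exact (T01 s).sum_mem fun i _ => (T01 s).smul_mem _ (bframe_inr_mem s₀ s i)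

theorem cext_of_mem_T10 {v : TC ES s₀} (hv : v ∈ T10 s₀) (s : S) :
    cext s₀ v s = ∑ i : CIdx ES, cD (hcoord s₀ i) s₀ v • hframe s₀ i s := by
  rw [cext_apply, Fintype.sum_sum_type]
  simp only [cD_bcoord_inr (mem_chart_source ES s₀) _ hv, zero_smul, Finset.sum_const_zero, add_zero]
  rfl

theorem cext_mem_T10 {v : TC ES s₀} (hv : v ∈ T10 s₀) (s : S) : cext s₀ v s ∈ T10 s := by
  rw [cext_of_mem_T10 hv]
  exact (T10 s).sum_mem fun i _ => (T10 s).smul_mem _ (hframe_mem s₀ s i)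

/-- The coordinate derivatives of the field are constant, so its expression in the chart is
constant. -/
theorem isHolFieldOn_cext {v : TC ES s₀} (hv : v ∈ T10 s₀) :
    IsHolFieldOn (chartAt ES s₀).source (cext s₀ v) := by
  refine ⟨fun s _ => cext_mem_T10 hv s, fun s hs => ContMDiffAt.contMDiffWithinAt ?_⟩
  refine (contMDiffAt_complex_iff hs).2 ?_
  refine (contMDiffAt_const (c := chartD s₀ s (show ES from (cext s₀ v s).re))).congr_of_eventuallyEq ?_
  have : ∀ y ∈ (chartAt ES s₀).source, chartD s₀ y (show ES from (cext s₀ v y).re)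
      = chartD s₀ s (show ES from (cext s₀ v s).re) := by
    intro y hy
    apply (Module.finBasis ℂ ES).ext_elem
    intro i
    have h1 := cD_bcoord_cext hy (.inl i) v
    rw [← cD_bcoord_cext hs (.inl i) v] at h1
    have h2 := cD_hcoord hy i (cext_mem_T10 hv y)
    have h3 := cD_hcoord hs i (cext_mem_T10 hv s)
    have h4 : (2 : ℂ) * _ = 2 * _ := h2.symm.trans (h1.trans h3)
    exact mul_left_cancel₀ two_ne_zero h4
  filter_upwards [(chartAt ES s₀).open_source.mem_nhds hs] with y hy using this y hy

end Base

/-! ### Morphisms from `α^* T_{S_ℂ}` and the correction terms in their brackets. -/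

section Fibration

variable {ES : Type*} [NormedAddCommGroup ES] [NormedSpace ℂ ES]
  {S : Type*} [TopologicalSpace S] [ChartedSpace ES S] [IsManifold 𝓘(ℂ, ES) ω S]
  {EZ : Type*} [NormedAddCommGroup EZ] [NormedSpace ℝ EZ]
  {Z : Type*} [TopologicalSpace Z] [ChartedSpace EZ Z] [IsManifold 𝓘(ℝ, EZ) ∞ Z]
  {α : Z → S} {z : Z}

/-- `L` maps fields that are smooth near `α z` to fields that are smooth near `z`. -/
def HomSmAt (L : PreHom (ES := ES) (EZ := EZ) α) (z : Z) : Prop :=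
  ∀ a : ∀ s : S, TC ES s, SmAt a (α z) → SmAt (fun z => L z (a (α z))) z

/-- At `z` the brackets with the fields in the image of `L` preserve the conjugate of `T`. -/
def HomPresAt (T : ∀ z : Z, Submodule ℂ (TC EZ z)) (L : PreHom (ES := ES) (EZ := EZ) α) (z : Z) :
    Prop :=
  ∀ a : ∀ s : S, TC ES s, SmAt a (α z) → PresAt (cj T) (fun z => L z (a (α z))) z

theorem exists_isOpen_smoothOn {E : Type*} [NormedAddCommGroup E] [NormedSpace ℝ E]
    {M : Type*} [TopologicalSpace M] [ChartedSpace E M] [IsManifold 𝓘(ℝ, E) ∞ M]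
    {X : ∀ x : M, TC E x} {x : M} (h : SmAt X x) :
    ∃ U, IsOpen U ∧ x ∈ U ∧ SmoothOn U X := by
  obtain ⟨U, hU, hUo, hx⟩ := eventually_nhds_iff.1 h.eventually
  exact ⟨U, hUo, hx, (smoothOn_iff hUo).2 hU⟩

theorem smoothHomOn_iff (hα : Continuous α) {U : Set Z} (hU : IsOpen U)
    {L : PreHom (ES := ES) (EZ := EZ) α} : SmoothHomOn α U L ↔ ∀ z ∈ U, HomSmAt L z := by
  constructor
  · intro h z hz a ha
    obtain ⟨V, hV, hzV, haV⟩ := exists_isOpen_smoothOn ha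
    exact (smoothOn_iff (hU.inter (hV.preimage hα))).1 (h V a hV haV) z ⟨hz, hzV⟩
  · intro h V a hV ha
    rw [smoothOn_iff (hU.inter (hV.preimage hα))]
    exact fun z hz => h z hz.1 a ((smoothOn_iff hV).1 ha _ hz.2)

theorem verticallyHolOn_iff (hα : Continuous α) {U : Set Z} (hU : IsOpen U)
    {T : ∀ z : Z, Submodule ℂ (TC EZ z)} {L : PreHom (ES := ES) (EZ := EZ) α}
    (hL : SmoothHomOn α U L) : VerticallyHolOn α T U L ↔ ∀ z ∈ U, HomPresAt T L z := by
  have hL' := (smoothHomOn_iff hα hU).1 hL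
  constructor
  · intro h z hz a ha
    obtain ⟨V, hV, hzV, haV⟩ := exists_isOpen_smoothOn ha
    refine (bracketPreservesConj_iff (hU.inter (hV.preimage hα)) fun y hy => ?_).1 (h V a hV haV)
      z ⟨hz, hzV⟩
    exact hL' y hy.1 a ((smoothOn_iff hV).1 haV _ hy.2)
  · intro h V a hV ha
    refine (bracketPreservesConj_iff (hU.inter (hV.preimage hα)) fun y hy => ?_).2 fun y hy => ?_
    · exact hL' y hy.1 a ((smoothOn_iff hV).1 ha _ hy.2)
    · exact h y hy.1 a ((smoothOn_iff hV).1 ha _ hy.2)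

/-! ### Brackets with the images of fields on the base -/

section Tensor

variable [FiniteDimensional ℂ ES] [FiniteDimensional ℝ EZ]

/-- The correction term in the bracket of `L(a)` with `Y`. -/
def corr (α : Z → S) (z : Z) (a : ∀ s : S, TC ES s) (Y : ∀ z : Z, TC EZ z) : TC ES (α z) :=
  ∑ k : CIdx ES ⊕ CIdx ES, cD (fun s => cD (bcoord (α z) k) s (a s)) (α z) (dC (ES := ES) α z (Y z)) •
    bframe (α z) k (α z)

theorem corr_eq_zero {a : ∀ s : S, TC ES s} {Y : ∀ z : Z, TC EZ z}
    (h : dC (ES := ES) α z (Y z) = 0) : corr α z a Y = 0 :=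
  by
  rw [corr]
  exact Finset.sum_eq_zero fun k _ => by rw [h, ← cDL_apply, map_zero, zero_smul]

theorem cD_zero_of_eventually {f : S → ℂ} {s : S} (h : ∀ᶠ y in 𝓝 s, f y = 0) (v : TC ES s) :
    cD f s v = 0 := by
  rw [cD_congr (g := fun _ => 0) h, cD_const]

theorem chart_source_mem (ES : Type*) [NormedAddCommGroup ES] {S : Type*} [TopologicalSpace S]
    [ChartedSpace ES S] (s : S) : ∀ᶠ y in 𝓝 s, y ∈ (chartAt ES s).source :=
  (chartAt ES s).open_source.mem_nhds (mem_chart_source ES s)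

/-- The coefficients of a in the directions ∂ᵢ vanish near α z, so only the directions ∂̄ᵢ
contribute. -/
theorem corr_mem_T01 {a : ∀ s : S, TC ES s} {Y : ∀ z : Z, TC EZ z}
    (ha : ∀ᶠ s in 𝓝 (α z), a s ∈ T01 s) : corr α z a Y ∈ T01 (α z) := by
  rw [corr, Fintype.sum_sum_type]
  refine Submodule.add_mem _ ?_ (Submodule.sum_mem _ fun i _ =>
    Submodule.smul_mem _ _ (bframe_inr_mem _ _ i))
  rw [Finset.sum_eq_zero]
  · exact Submodule.zero_mem _
  · intro i _
    rw [cD_zero_of_eventually, zero_smul]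
    filter_upwards [ha, chart_source_mem ES (α z)] with y h1 h2 using cD_bcoord_inl h2 i h1

/-- The ∂ᵢ-coefficients of a are holomorphic, hence killed by (0,1)-vectors, and its
∂̄ᵢ-coefficients vanish identically. -/
theorem corr_of_hol {V : Set S} (hV : IsOpen V) {a : ∀ s : S, TC ES s} (ha : IsHolFieldOn V a)
    (hz : α z ∈ V) {Y : ∀ z : Z, TC EZ z} (hY : dC (ES := ES) α z (Y z) ∈ T01 (α z)) :
    corr α z a Y = 0 := by
  rw [corr, Fintype.sum_sum_type]
  have h1 : ∀ i : CIdx ES, cD (fun s => cD (bcoord (α z) (.inl i)) s (a s)) (α z) (dC (ES := ES) α z (Y z)) = 0 :=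
    fun i => cD_coeff_eq_zero hV ha hz (mem_chart_source ES _) i hY
  have h2 : ∀ i : CIdx ES, cD (fun s => cD (bcoord (α z) (.inr i)) s (a s)) (α z) (dC (ES := ES) α z (Y z)) = 0 := by
    intro i
    rw [cD_zero_of_eventually]
    filter_upwards [hV.mem_nhds hz, chart_source_mem ES (α z)] with y h1 h2
      using cD_bcoord_inr h2 i (ha.1 y h1)
  simp only [h1, h2, zero_smul, Finset.sum_const_zero, add_zero]

/-- The bracket of `L(a)` with `Y` depends on the value of `a` at `α z` up to a correction term. -/
theorem bracket_hom (hα : ContMDiff 𝓘(ℝ, EZ) 𝓘(ℝ, ES) ∞ α) {L : PreHom (ES := ES) (EZ := EZ) α}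
    (hL : HomSmAt L z) {a : ∀ s : S, TC ES s} (ha : SmAt a (α z)) {Y : ∀ z : Z, TC EZ z} :
    bracket (fun z => L z (a (α z))) Y z
      = bracket (fun y => L y (cext (α z) (a (α z)) (α y))) Y z - L z (corr α z a Y) := by
  have := FiniteDimensional.complete ℝ EZ
  have : FiniteDimensional ℝ ES := FiniteDimensional.complexToReal ES
  have hs := mem_chart_source ES (α z)
  let c : CIdx ES ⊕ CIdx ES → S → ℂ := fun k s => cD (bcoord (α z) k) s (a s)
  have hc : ∀ k : CIdx ES ⊕ CIdx ES, FSmAt ES (c k) (α z) := fun k => (fSmAt_bcoord hs k).cD ha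
  have hb : ∀ k : CIdx ES ⊕ CIdx ES, SmAt (fun y => L y (bframe (α z) k (α y))) z := fun k => hL _ (smAt_bframe hs k)
  have h1 : ∀ᶠ y in 𝓝 z, L y (a (α y)) = ∑ k : CIdx ES ⊕ CIdx ES, c k (α y) • L y (bframe (α z) k (α y)) := by
    filter_upwards [hα.continuous.continuousAt.eventually (chart_source_mem ES (α z))] with y hy
    conv_lhs => rw [eq_sum_bframe hy (a (α y))]
    simp only [map_sum, map_smul, c]
  have h2 : ∀ y, L y (cext (α z) (a (α z)) (α y))
      = ∑ k : CIdx ES ⊕ CIdx ES, c k (α z) • L y (bframe (α z) k (α y)) := by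
    intro y
    simp only [cext_apply, map_sum, map_smul, c]
  rw [bracket_congr h1 (Eventually.of_forall fun _ => rfl),
    bracket_congr (X := fun y => L y (cext (α z) (a (α z)) (α y))) (Eventually.of_forall h2)
      (Eventually.of_forall fun _ => rfl),
    bracket_sum_left _ fun k _ => (hb k).smul ((hc k).comp hα),
    bracket_sum_left _ fun k _ => (hb k).const_smul _, corr]
  simp only [map_sum, map_smul]
  rw [← Finset.sum_sub_distrib]
  refine Finset.sum_congr rfl fun k _ => ?_
  -- The coefficients are pulled back from S, so their derivative along Y is the derivative on S
  -- along dα(Y); these are the coefficients in `corr`.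
  rw [bracket_smul_left ((hc k).comp hα) (hb k), bracket_const_smul_left _ (hb k),
    cD_comp hα (hc k)]

/-- Brackets of fields that are related to fields with constant coefficients are vertical. -/
theorem dC_bracket (hα : ContMDiff 𝓘(ℝ, EZ) 𝓘(ℝ, ES) ∞ α) {X Y : ∀ z : Z, TC EZ z}
    (hX : SmAt X z) (hY : SmAt Y z) {s₀ : S} (hs : α z ∈ (chartAt ES s₀).source) {v w : TC ES s₀}
    (hv : ∀ᶠ y in 𝓝 z, dC (ES := ES) α y (X y) = cext s₀ v (α y))
    (hw : ∀ᶠ y in 𝓝 z, dC (ES := ES) α y (Y y) = cext s₀ w (α y)) :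
    dC (ES := ES) α z (bracket X Y z) = 0 := by
  have hce : ∀ᶠ y in 𝓝 z, α y ∈ (chartAt ES s₀).source := hα.continuous.continuousAt.eventually
    ((chartAt ES s₀).open_source.mem_nhds hs)
  rw [eq_sum_bframe hs (dC (ES := ES) α z (bracket X Y z))]
  refine Finset.sum_eq_zero fun k _ => ?_
  -- X projects to a field with constant coefficients, so X applied to a pulled back coordinate is
  -- constant; both terms of the commutator [X, Y] on coordinates are then derivatives of constants.
  have h1 : ∀ {X : ∀ z : Z, TC EZ z} {v : TC ES s₀}
      (hv : ∀ᶠ y in 𝓝 z, dC (ES := ES) α y (X y) = cext s₀ v (α y)) (w : TC EZ z),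
      cD (fun y => cD (fun y => bcoord (ES := ES) s₀ k (α y)) y (X y)) z w = 0 := by
    intro X v hv w
    rw [cD_congr (g := fun _ => cD (bcoord (ES := ES) s₀ k) s₀ v), cD_const]
    filter_upwards [hv, hce] with y h2 h3
    rw [cD_comp hα (fSmAt_bcoord h3 k), h2, cD_bcoord_cext h3]
  rw [← cD_comp hα (fSmAt_bcoord hs k), cD_bracket ((fSmAt_bcoord hs k).comp hα) hX hY, h1 hw, h1 hv,
    sub_zero, zero_smul]

end Tensor

end Fibration

/-! ### `∂̄`-operators, their lifts, and holomorphy along the fibres. -/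

section Fibration

variable {ES : Type*} [NormedAddCommGroup ES] [NormedSpace ℂ ES]
  {S : Type*} [TopologicalSpace S] [ChartedSpace ES S] [IsManifold 𝓘(ℂ, ES) ω S]
  {EZ : Type*} [NormedAddCommGroup EZ] [NormedSpace ℝ EZ]
  {Z : Type*} [TopologicalSpace Z] [ChartedSpace EZ Z] [IsManifold 𝓘(ℝ, EZ) ∞ Z]
  {α : Z → S} {z : Z} {T TA TB : ∀ z : Z, Submodule ℂ (TC EZ z)}
  {D : PreQuotHom (ES := ES) α T} {L L' : PreHom (ES := ES) (EZ := EZ) α}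

/-! ### The subbundle of a `∂̄`-operator -/

theorem mem_Tbar {w : TC EZ z} : w ∈ Tbar D z ↔ ∃ v, D z v = (conjSub (T z)).mkQ w := Iff.rfl

theorem conjSub_le_Tbar : conjSub (T z) ≤ Tbar D z := fun w hw =>
  mem_Tbar.2 ⟨0, by rw [map_zero, Submodule.mkQ_apply, (Submodule.Quotient.mk_eq_zero _).2 hw]⟩

theorem IsDbarOperator.dC_mem (hD : IsDbarOperator α T D) {w : TC EZ z} (hw : w ∈ Tbar D z) :
    dC (ES := ES) α z w ∈ T01 (α z) := by
  obtain ⟨v, hv⟩ := mem_Tbar.1 hw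
  rw [hD.split z v w hv.symm]
  exact p01_mem v

/-- If D v is the class of w, then p01 v = dα(w) = 0, and D factors through p01. All later descents
from T̄_D to T̄ rest on this. -/
theorem IsDbarOperator.mem_of_vertical (hD : IsDbarOperator α T D) {w : TC EZ z}
    (hw : w ∈ Tbar D z) (h : dC (ES := ES) α z w = 0) : w ∈ conjSub (T z) := by
  obtain ⟨v, hv⟩ := mem_Tbar.1 hw
  have h1 := hD.split z v w hv.symm
  rw [← hD.comp_proj, ← h1, h, map_zero] at hv
  exact (Submodule.Quotient.mk_eq_zero _).1 hv.symm

theorem lift_mem_Tbar (hL : toQuot T L z = D z) (v : TC ES (α z)) : L z v ∈ Tbar D z :=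
  mem_Tbar.2 ⟨v, by rw [← hL]; rfl⟩

theorem IsSplitting.dC_lift {p : ∀ s : S, TC ES s →ₗ[ℂ] TC ES s} (hD : IsSplitting α T p D)
    (hL : toQuot T L z = D z) (v : TC ES (α z)) : dC (ES := ES) α z (L z v) = p (α z) v :=
  hD.split z v _ (by rw [← hL]; rfl)

/-- A ∂̄-operator is extended by zero to (1,0)-vectors, so a lifting need not vanish on them but
takes values in T̄. -/
theorem IsDbarOperator.lift_mem_of_mem_T10 (hD : IsDbarOperator α T D) (hL : toQuot T L z = D z)
    {v : TC ES (α z)} (hv : v ∈ T10 (α z)) : L z v ∈ conjSub (T z) :=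
  hD.mem_of_vertical (lift_mem_Tbar hL v) ((IsSplitting.dC_lift hD hL v).trans hv)

theorem IsDbarOperator.sub_lift_mem (hD : IsDbarOperator α T D) (hL : toQuot T L z = D z)
    {w : TC EZ z} (hw : w ∈ Tbar D z) : w - L z (dC (ES := ES) α z w) ∈ conjSub (T z) := by
  refine hD.mem_of_vertical ((Tbar D z).sub_mem hw (lift_mem_Tbar hL _)) ?_
  rw [map_sub, IsSplitting.dC_lift hD hL, p01_of_mem_T01 (hD.dC_mem hw), sub_self]

theorem cj_almostCx : cj (almostCx D) = Tbar D := by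
  ext z : 1
  exact conjSub_conjSub _

/-- A section of a splitting can be checked on local lifts. -/
theorem IsSplitting.of_lifts {p : ∀ s : S, TC ES s →ₗ[ℂ] TC ES s}
    (hT : ∀ z, conjSub (T z) ≤ LinearMap.ker (dC (ES := ES) α z))
    (hc : ∀ z v, D z (p (α z) v) = D z v)
    (h : ∀ z : Z, ∃ U L, z ∈ U ∧ IsLiftOn α T D U L ∧
      ∀ v, dC (ES := ES) α z (L z v) = p (α z) v) : IsSplitting α T p D := by
  refine ⟨fun z => ?_, hc, fun z v w hw => ?_⟩
  · obtain ⟨U, L, hz, hL, -⟩ := h z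
    exact ⟨U, L, hz, hL⟩
  · obtain ⟨U, L, hz, hL, hv⟩ := h z
    have h1 : w - L z v ∈ conjSub (T z) := by
      rw [← Submodule.Quotient.mk_eq_zero, Submodule.Quotient.mk_sub, sub_eq_zero]
      rw [← hL.2.2 z hz] at hw
      exact hw
    have h2 : dC (ES := ES) α z (w - L z v) = 0 := hT z h1
    rw [map_sub, hv, sub_eq_zero] at h2
    exact h2

/-! ### Lifts and the local lifting condition -/

theorem IsLiftOn.homSmAt (hα : Continuous α) {U : Set Z} (hL : IsLiftOn α T D U L) (hz : z ∈ U) :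
    HomSmAt L z := (smoothHomOn_iff hα hL.1).1 hL.2.1 z hz

theorem IsLiftOn.mem_nhds {U : Set Z} (hL : IsLiftOn α T D U L) (hz : z ∈ U) : ∀ᶠ y in 𝓝 z, y ∈ U :=
  hL.1.mem_nhds hz

theorem HomPresAt.homSmAt (h : HomPresAt T L z) : HomSmAt L z := fun a ha => (h a ha).1

theorem IsRelComplexStructure.le_ker (hT : IsRelComplexStructure (ES := ES) α T) (z : Z) :
    T z ≤ LinearMap.ker (dC (ES := ES) α z) := hT.sup_eq z ▸ le_sup_left

theorem IsRelComplexStructure.conj_le_ker (hT : IsRelComplexStructure (ES := ES) α T) (z : Z) :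
    conjSub (T z) ≤ LinearMap.ker (dC (ES := ES) α z) := hT.sup_eq z ▸ le_sup_right

section Finite

variable [FiniteDimensional ℂ ES] [FiniteDimensional ℝ EZ]

/-- The condition asks for one good lifting, but every lifting is then good: two of them differ by a
section of T̄, and T̄ is involutive. -/
theorem LocalLifting.homPresAt (hα : Continuous α) (hT : Involutive T) (h : LocalLifting α T D)
    {U : Set Z} (hL : IsLiftOn α T D U L) (hz : z ∈ U) : HomPresAt T L z := by
  have := FiniteDimensional.complete ℝ EZ
  intro a ha
  obtain ⟨U', L', hz', hL', hv⟩ := h z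
  have h1 := (verticallyHolOn_iff hα hL'.1 hL'.2.1).1 hv z hz' a ha
  have h2 : SectAt (cj T) (fun y => L y (a (α y)) - L' y (a (α y))) z := by
    refine ⟨(hL.homSmAt hα hz a ha).sub h1.1, ?_⟩
    filter_upwards [hL.mem_nhds hz, hL'.mem_nhds hz'] with y hy hy'
    have h3 := LinearMap.congr_fun ((hL.2.2 y hy).trans (hL'.2.2 y hy').symm) (a (α y))
    exact (Submodule.Quotient.eq _).1 h3
  exact (h1.add (PresAt.of_sectAt hT.cj h2)).congr (Eventually.of_forall fun y => by abel)

theorem localLifting_of_homPresAt (hα : Continuous α) (h : ∀ z : Z, ∃ U L, z ∈ U ∧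
    IsLiftOn α T D U L ∧ ∀ y ∈ U, HomPresAt T L y) : LocalLifting α T D := by
  intro z
  obtain ⟨U, L, hz, hL, hv⟩ := h z
  exact ⟨U, L, hz, hL, (verticallyHolOn_iff hα hL.1 hL.2.1).2 hv⟩

/-- The brackets of vertical fields with `L(a)` depend only on the values of `a`. -/
theorem homPresAt_of_exists (hα : ContMDiff 𝓘(ℝ, EZ) 𝓘(ℝ, ES) ∞ α)
    (hT : ∀ z, conjSub (T z) ≤ LinearMap.ker (dC (ES := ES) α z)) (hL : HomSmAt L z)
    (h : ∀ v : TC ES (α z), ∃ a : ∀ s : S, TC ES s, SmAt a (α z) ∧ a (α z) = v ∧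
      PresAt (cj T) (fun y => L y (a (α y))) z) : HomPresAt T L z := by
  intro a ha
  refine ⟨hL a ha, fun u hu => ?_⟩
  obtain ⟨b, hb, hba, hbp⟩ := h (a (α z))
  -- As u is vertical, the correction terms vanish, and a may be exchanged for b with the same value
  -- at α z.
  have h1 : dC (ES := ES) α z (u z) = 0 := hT z hu.2.self_of_nhds
  have h2 := hbp.2 u hu
  rw [bracket_swap, bracket_hom hα hL hb, hba, corr_eq_zero h1, map_zero, sub_zero] at h2
  rw [bracket_swap, bracket_hom hα hL ha, corr_eq_zero h1, map_zero, sub_zero]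
  exact h2

theorem dC_bracket_vertical (hα : ContMDiff 𝓘(ℝ, EZ) 𝓘(ℝ, ES) ∞ α) {X u : ∀ z : Z, TC EZ z}
    (hX : SmAt X z) (hu : SmAt u z) {v : TC ES (α z)}
    (hv : ∀ᶠ y in 𝓝 z, dC (ES := ES) α y (X y) = cext (α z) v (α y))
    (hw : ∀ᶠ y in 𝓝 z, dC (ES := ES) α y (u y) = 0) :
    dC (ES := ES) α z (bracket u X z) = 0 :=
  dC_bracket hα hu hX (mem_chart_source ES (α z)) (v := 0) (by simp only [map_zero]; exact hw) hv

theorem cext_p01 (s₀ : S) (v : TC ES s₀) (s : S) : p01 s (cext s₀ v s) = cext s₀ (p01 s₀ v) s := by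
  conv_lhs => rw [← p10_add_p01 v, map_add, Pi.add_apply, map_add,
    p01_of_mem_T10 (cext_mem_T10 (p10_mem v) s), p01_of_mem_T01 (cext_mem_T01 (p01_mem v) s), zero_add]

theorem cext_p10 (s₀ : S) (v : TC ES s₀) (s : S) : p10 s (cext s₀ v s) = cext s₀ (p10 s₀ v) s := by
  conv_lhs => rw [← p10_add_p01 v, map_add, Pi.add_apply, map_add,
    p10_of_mem_T10 (cext_mem_T10 (p10_mem v) s), p10_of_mem_T01 (cext_mem_T01 (p01_mem v) s), add_zero]

theorem smAt_cext_self (s₀ : S) (v : TC ES s₀) : SmAt (cext s₀ v) s₀ :=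
  smAt_cext (mem_chart_source ES s₀) v

/-- The `∂̄`-operator of a holomorphic fibration satisfies the local lifting condition. -/
theorem IsHolomorphicFibration.homPresAt (hα : ContMDiff 𝓘(ℝ, EZ) 𝓘(ℝ, ES) ∞ α)
    (hT : IsRelComplexStructure (ES := ES) α T) (hD : IsHolomorphicFibration α T D)
    {U : Set Z} (hL : IsLiftOn α T D U L) (hz : z ∈ U) : HomPresAt T L z := by
  have := FiniteDimensional.complete ℝ EZ
  have hs := hL.homSmAt hα.continuous hz
  have hi : Involutive (Tbar D) := cj_almostCx (D := D) ▸ hD.2.involutive.cj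
  refine homPresAt_of_exists hα hT.conj_le_ker hs fun v =>
    ⟨cext (α z) v, smAt_cext_self _ v, cext_self _ v, ⟨hs _ (smAt_cext_self _ v), fun u hu => ?_⟩⟩
  -- The bracket lies in T̄_D by integrability and is vertical because u is vertical and L of the
  -- extension projects to a field on S; so it lies in T̄.
  refine hD.1.mem_of_vertical (hi.bracket_mem (hu.mono fun y => conjSub_le_Tbar)
    ⟨hs _ (smAt_cext_self _ v), ?_⟩) ?_
  · filter_upwards [hL.mem_nhds hz] with y hy using lift_mem_Tbar (hL.2.2 y hy) _
  · refine dC_bracket_vertical hα (hs _ (smAt_cext_self _ v)) hu.1 (v := p01 _ v) ?_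
      (hu.2.mono fun y hy => hT.conj_le_ker y hy)
    filter_upwards [hL.mem_nhds hz] with y hy
    rw [IsSplitting.dC_lift hD.1 (hL.2.2 y hy), cext_p01]

/-- The extension of the (1,0)-part of v with constant coefficients is a holomorphic field, so its
image is a holomorphic field on X. Brackets with T̄ therefore lie in T̄_X, and being vertical they
lie in T̄. -/
theorem IsFlatHolConnection.homPresAt (hα : ContMDiff 𝓘(ℝ, EZ) 𝓘(ℝ, ES) ∞ α)
    (hT : IsRelComplexStructure (ES := ES) α T) (hD : IsDbarOperator α T D)
    (hL : IsFlatHolConnection α (almostCx D) L) (z : Z) : HomPresAt T L z := by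
  have := FiniteDimensional.complete ℝ EZ
  have hs := (smoothHomOn_iff hα.continuous isOpen_univ).1 hL.connection.smooth z trivial
  refine homPresAt_of_exists hα hT.conj_le_ker hs fun v =>
    ⟨cext (α z) v, smAt_cext_self _ v, cext_self _ v, ⟨hs _ (smAt_cext_self _ v), fun u hu => ?_⟩⟩
  have h1 := hL.holomorphic (chartAt ES (α z)).source (cext (α z) (p10 _ v))
    (chartAt ES (α z)).open_source (isHolFieldOn_cext (p10_mem v))
  have ho := (chartAt ES (α z)).open_source.preimage hα.continuous
  have h2 := (bracketPreservesConj_iff ho fun y hy => (((isSectionOn_iff ho).1 h1.1) y hy).1).1 h1.2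
    z (mem_chart_source ES (α z))
  rw [cj_almostCx] at h2
  have h3 := h2.congr (Y := fun y => L y (cext (α z) v (α y))) <| Eventually.of_forall fun y => by
    rw [← cext_p10, hL.connection.comp_proj]
  refine hD.mem_of_vertical (h3.2 u (hu.mono fun y => conjSub_le_Tbar)) ?_
  refine dC_bracket_vertical hα (hs _ (smAt_cext_self _ v)) hu.1 (v := p10 _ v) ?_
      (hu.2.mono fun y hy => hT.conj_le_ker y hy)
  exact Eventually.of_forall fun y => by rw [hL.connection.split, cext_p10]

end Finite

/-! ### Transport by a bundle automorphism -/

theorem BundleAut.smAt (β : BundleAut (ES := ES) α TA TB) {X : ∀ z : Z, TC EZ z} (hX : SmAt X z) :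
    SmAt (fun z => β.C z (X z)) z := by
  obtain ⟨U, hU, hz, hXU⟩ := exists_isOpen_smoothOn hX
  exact (smoothOn_iff hU).1 ⟨β.smooth U _ hU hXU.1, β.smooth U _ hU hXU.2⟩ z hz

theorem BundleAut.dC_C (β : BundleAut (ES := ES) α TA TB) (w : TC EZ z) :
    dC (ES := ES) α z (β.C z w) = dC (ES := ES) α z w :=
  Cx.ext (β.over_id z w.re) (β.over_id z w.im)

theorem BundleAut.C_mem (β : BundleAut (ES := ES) α TA TB) {w : TC EZ z} (hw : w ∈ TA z) :
    β.C z w ∈ TB z := β.map_eq z ▸ Submodule.mem_map_of_mem hw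

theorem BundleAut.isLiftOn (β : BundleAut (ES := ES) α TA TB) (hα : Continuous α)
    {D : PreQuotHom (ES := ES) α TA} {U : Set Z} (hL : IsLiftOn α TA D U L) :
    IsLiftOn α TB (β.comp D) U (fun z => β.C z ∘ₗ L z) := by
  refine ⟨hL.1, (smoothHomOn_iff hα hL.1).2 fun z hz a ha => β.smAt (hL.homSmAt hα hz a ha),
    fun z hz => LinearMap.ext fun v => ?_⟩
  have h := LinearMap.congr_fun (hL.2.2 z hz) v
  change _ = β.quot z (D z v)
  rw [← h]
  rfl

theorem IsConnectionIn.isLiftOn (hL : IsConnectionIn α TA L) :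
    IsLiftOn α T (toQuot T L) univ L := ⟨isOpen_univ, hL.smooth, fun _ _ => rfl⟩

theorem IsConnectionIn.isAlmostConnection (hT : IsRelComplexStructure (ES := ES) α T)
    (hL : IsConnectionIn α TA L) : IsAlmostConnection α T (toQuot T L) :=
  IsSplitting.of_lifts hT.conj_le_ker
    (fun z v => by change Submodule.mkQ _ (L z _) = Submodule.mkQ _ (L z v); rw [hL.comp_proj])
    fun z => ⟨univ, L, trivial, hL.isLiftOn, hL.split z⟩

end Fibration

/-! ### Holomorphy along the fibres of the Higgs field, its conjugation and `∂̄_ω`. -/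

section Fibration

variable {ES : Type*} [NormedAddCommGroup ES] [NormedSpace ℂ ES]
  {S : Type*} [TopologicalSpace S] [ChartedSpace ES S] [IsManifold 𝓘(ℂ, ES) ω S]
  {EZ : Type*} [NormedAddCommGroup EZ] [NormedSpace ℝ EZ]
  {Z : Type*} [TopologicalSpace Z] [ChartedSpace EZ Z] [IsManifold 𝓘(ℝ, EZ) ∞ Z]
  {α : Z → S} {z : Z} {T TA TB : ∀ z : Z, Submodule ℂ (TC EZ z)}
  {om : ∀ z : Z, TangentSpace 𝓘(ℝ, EZ) z →ₗ[ℝ] TangentSpace 𝓘(ℝ, EZ) z →ₗ[ℝ] ℝ}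
  [FiniteDimensional ℂ ES] [FiniteDimensional ℝ EZ]

theorem HomPresAt.add {L L' : PreHom (ES := ES) (EZ := EZ) α} (h : HomPresAt T L z)
    (h' : HomPresAt T L' z) : HomPresAt T (fun z => L z + L' z) z := by
  have := FiniteDimensional.complete ℝ EZ
  exact fun a ha => (h a ha).add (h' a ha)

theorem HomPresAt.sub {L L' : PreHom (ES := ES) (EZ := EZ) α} (h : HomPresAt T L z)
    (h' : HomPresAt T L' z) : HomPresAt T (fun z => L z - L' z) z := by
  have := FiniteDimensional.complete ℝ EZ
  exact fun a ha => (h a ha).sub (h' a ha)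

theorem HomPresAt.const_smul {L : PreHom (ES := ES) (EZ := EZ) α} (c : ℂ) (h : HomPresAt T L z) :
    HomPresAt T (fun z => c • L z) z := by
  have := FiniteDimensional.complete ℝ EZ
  exact fun a ha => (h a ha).const_smul c

theorem IsAlmostHiggs.homSmAt {Θ : PreHom (ES := ES) (EZ := EZ) α} (h : IsAlmostHiggs α T Θ)
    (hα : Continuous α) (z : Z) : HomSmAt Θ z :=
  (smoothHomOn_iff hα isOpen_univ).1 h.smooth z trivial

/-! ### The Higgs field -/

theorem dC_conj (w : TC EZ z) : dC (ES := ES) α z (Cx.conj w) = Cx.conj (dC (ES := ES) α z w) := by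
  ext <;> simp [dC, Cx.map]

/-- The forward direction of the hypothesis on β, in the form needed for brackets. -/
theorem BundleAut.PreservesLocalLifting.homPresAt {β : BundleAut (ES := ES) α TA TB}
    (hβ : β.PreservesLocalLifting) (hα : Continuous α) (hTB : Involutive TB)
    {D : PreQuotHom (ES := ES) α TA} (hD : IsDbarOperator α TA D ∨ IsAlmostConnection α TA D)
    (hl : LocalLifting α TA D) {U : Set Z} {L : PreHom (ES := ES) (EZ := EZ) α}
    (hL : IsLiftOn α TA D U L) (hz : z ∈ U) : HomPresAt TB (fun z => β.C z ∘ₗ L z) z :=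
  ((hβ D hD).1 hl).homPresAt hα hTB (β.isLiftOn hα hL) hz

theorem IsConnectionIn.localLifting (hα : Continuous α) {L : PreHom (ES := ES) (EZ := EZ) α}
    (hL : IsConnectionIn α TA L) (h : ∀ z, HomPresAt T L z) : LocalLifting α T (toQuot T L) :=
  localLifting_of_homPresAt hα fun z => ⟨univ, L, trivial, hL.isLiftOn, fun y _ => h y⟩

theorem isAlmostHiggs_higgsField (hα : Continuous α) (hTA : IsRelComplexStructure (ES := ES) α TA)
    (β : BundleAut (ES := ES) α TA TB) {D : PreQuotHom (ES := ES) α TA} (hD : IsDbarOperator α TA D)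
    {N C : PreHom (ES := ES) (EZ := EZ) α} (hN : IsConnectionIn α (almostCx D) N)
    (hC : IsConnectionIn α (almostCx D) C) : IsAlmostHiggs α TB (higgsField β N C) := by
  refine ⟨?_, fun z v => ?_, fun z v => ?_⟩
  · rw [smoothHomOn_iff hα isOpen_univ]
    intro z _ a ha
    have h1 := (smoothHomOn_iff hα isOpen_univ).1 hN.smooth z trivial a ha
    have h2 := (smoothHomOn_iff hα isOpen_univ).1 hC.smooth z trivial a ha
    exact (β.smAt (h1.sub h2)).const_smul _
  · change (1 / 2 : ℂ) • β.C z (N z _ - C z _) = (1 / 2 : ℂ) • β.C z (N z _ - C z _)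
    rw [hN.comp_proj, hC.comp_proj]
  · refine (TB z).smul_mem _ (β.C_mem ?_)
    -- The difference of the two connections is vertical and lies in T_X, hence in T_A; this is the
    -- conjugate of `mem_of_vertical`.
    have h1 : Cx.conj (N z v - C z v) ∈ Tbar D z := (almostCx D z).sub_mem (hN.mem z v) (hC.mem z v)
    have h3 := hD.mem_of_vertical h1 (by
      rw [dC_conj, map_sub, hN.split, hC.split, sub_self]
      exact conj_zero)
    simpa [mem_conjSub] using h3

/-- Both ∇ and ∂_ω induce almost connections satisfying the local lifting condition, so β ∘ ∇ and β
∘ ∂_ω are holomorphic along the fibres for T_B. Their difference is 2θ_ω. -/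
theorem homPresAt_higgsField (hα : ContMDiff 𝓘(ℝ, EZ) 𝓘(ℝ, ES) ∞ α)
    (hTA : IsRelComplexStructure (ES := ES) α TA)
    (hTB : Involutive TB) {β : BundleAut (ES := ES) α TA TB}
    (hβ : β.PreservesLocalLifting) {D : PreQuotHom (ES := ES) α TA} (hD : IsDbarOperator α TA D)
    {N C : PreHom (ES := ES) (EZ := EZ) α} (hN : IsFlatHolConnection α (almostCx D) N)
    (hC : IsConnectionIn α (almostCx D) C) (hCv : VerticallyHolOn α TA univ C) (z : Z) :
    HomPresAt TB (higgsField β N C) z := by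
  have hc := hα.continuous
  have h1 : ∀ {L : PreHom (ES := ES) (EZ := EZ) α}, IsConnectionIn α (almostCx D) L →
      (∀ z, HomPresAt TA L z) → HomPresAt TB (fun z => β.C z ∘ₗ L z) z := fun hL hv =>
    hβ.homPresAt hc hTB (.inr (hL.isAlmostConnection hTA)) (hL.localLifting hc hv) hL.isLiftOn trivial
  have h2 := ((h1 hN.connection fun z => hN.homPresAt hα hTA hD z).sub
    (h1 hC fun z => (verticallyHolOn_iff hc isOpen_univ hC.smooth).1 hCv z trivial)).const_smul
      (1 / 2 : ℂ)
  have h3 : (fun z => (1 / 2 : ℂ) • (β.C z ∘ₗ N z - β.C z ∘ₗ C z)) = higgsField β N C := by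
    funext z
    rw [higgsField, LinearMap.comp_sub]
  exact h3 ▸ h2

/-! ### The complex conjugation of the Higgs field -/

theorem IsComplexConjugation.mem {Θ Θbar : PreHom (ES := ES) (EZ := EZ) α}
    (h : IsComplexConjugation α T om Θ Θbar) (z : Z) (v : TC ES (α z)) : Θbar z v ∈ T z := by
  -- The conjugation is described on global set-theoretic (1,0)-sections; `cext` is one, as its
  -- values stay of type (1,0) outside the chart.
  obtain ⟨x, y, hx, hy, h1⟩ := h.conj_eq (α z) (cext (α z) (Cx.conj (p01 _ v)))
    (fun s => cext_mem_T10 (conj_mem_T10.2 (p01_mem v)) s)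
  have h2 : Θbar z (Cx.conj (cext (α z) (Cx.conj (p01 _ v)) (α z))) = _ := (h1 ⟨z, rfl⟩).2
  rw [cext_self, conj_conj, h.comp_proj] at h2
  rw [h2]
  exact (T z).neg_mem ((T z).sub_mem (hx.1 ⟨z, rfl⟩) ((T z).smul_mem _ (hy.1 ⟨z, rfl⟩)))

/-- The extension of an infinitesimal isometry of a fibre to a neighbourhood of a point. -/
theorem IsFiberAut10.exists_extension {x : ∀ y : {y : Z // α y = α z}, TC EZ (y : Z)}
    (hx : IsFiberAut10 (ES := ES) α T om (α z) x) : ∃ X : ∀ z, TC EZ z, PresAt (cj T) X z ∧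
      (∀ᶠ y in 𝓝 z, dC (ES := ES) α y (X y) = 0) ∧
      ∀ᶠ y in 𝓝 z, ∀ h : α y = α z, X y = x ⟨y, h⟩ + Cx.conj (x ⟨y, h⟩) := by
  have := FiniteDimensional.complete ℝ EZ
  obtain ⟨U, X, hU, hz, hX, hv, hXx, hp, -⟩ := hx.2.1 ⟨z, rfl⟩
  refine ⟨fun y => ofReal (X y), ⟨SmAt.ofReal ((realSmoothOn_iff hU).1 hX z hz), fun u hu => ?_⟩, ?_, ?_⟩
  · obtain ⟨V, hV, hzV, huV⟩ := exists_isOpen_sectAt hu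
    rw [bracket_swap]
    exact Submodule.neg_mem _ (hp (U ∩ V) u (hU.inter hV) inter_subset_left
      (huV.mono (hU.inter hV) hV inter_subset_right) z ⟨hz, hzV⟩ rfl)
  · filter_upwards [hU.mem_nhds hz] with y hy
    exact Cx.ext (hv y hy) (map_zero _)
  · filter_upwards [hU.mem_nhds hz] with y hy h
    refine Cx.ext (hXx ⟨y, h⟩ hy) ?_
    simp [ofReal]

/-- On the fibre through z, -Θbar(v̄) is x - iy with isometries x, y whose extensions X, Y preserve
T̄. Off the fibre nothing ties Θbar to X and Y, but brackets with vertical fields do not see terms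
that vanish on the fibre. -/
theorem IsComplexConjugation.homPresAt (hα : ContMDiff 𝓘(ℝ, EZ) 𝓘(ℝ, ES) ∞ α)
    (hT : IsRelComplexStructure (ES := ES) α T) {Θ Θbar : PreHom (ES := ES) (EZ := EZ) α}
    (h : IsComplexConjugation α T om Θ Θbar) (z : Z) : HomPresAt T Θbar z := by
  have := FiniteDimensional.complete ℝ EZ
  have : FiniteDimensional ℝ ES := FiniteDimensional.complexToReal ES
  have hs := (smoothHomOn_iff hα.continuous isOpen_univ).1 h.smooth z trivial
  refine homPresAt_of_exists hα hT.conj_le_ker hs fun v => ?_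
  let a : ∀ s : S, TC ES s := cext (α z) (p10 _ v)
  let b : ∀ s : S, TC ES s := cext (α z) (Cx.conj (p01 _ v))
  have ha : SmAt a (α z) := smAt_cext_self _ _
  have hb : SmAt b (α z) := smAt_cext_self _ _
  refine ⟨fun s => a s + Cx.conj (b s), ha.add hb.conj, ?_, ?_⟩
  · simp only [a, b, cext_self, conj_conj, p10_add_p01]
  obtain ⟨x, y, hx, hy, h1⟩ := h.conj_eq (α z) b
    (fun s => cext_mem_T10 (conj_mem_T10.2 (p01_mem v)) s)
  obtain ⟨X, hX, hXv, hXx⟩ := hx.exists_extension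
  obtain ⟨Y, hY, hYv, hYy⟩ := hy.exists_extension
  have hB := hs _ hb.conj
  -- X restricts to x + x̄ and Y to y + ȳ, so on the fibre W equals x̄ - iȳ, a section of T̄.
  let W : ∀ z : Z, TC EZ z := fun w =>
    Θbar w (Cx.conj (b (α w))) + (X w - Complex.I • Y w)
  have hW : SmAt W z := hB.add (hX.1.sub (hY.1.const_smul _))
  have hWv : ∀ᶠ w in 𝓝 z, W w ∈ T w ⊔ conjSub (T w) := by
    filter_upwards [hXv, hYv] with w h2 h3
    rw [hT.sup_eq, LinearMap.mem_ker, map_add, map_sub, map_smul, h2, h3, smul_zero, sub_zero,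
      add_zero]
    exact hT.le_ker w (h.mem w _)
  have hWf : ∀ᶠ w in 𝓝 z, α w = α z → W w ∈ conjSub (T w) := by
    filter_upwards [hXx, hYy] with w h2 h3 hw
    have h4 : W w = Cx.conj (x ⟨w, hw⟩) - Complex.I • Cx.conj (y ⟨w, hw⟩) := by
      change Θbar w (Cx.conj (b (α w))) + (X w - Complex.I • Y w) = _
      rw [h2 hw, h3 hw, (h1 ⟨w, hw⟩).2]
      module
    rw [h4]
    refine Submodule.sub_mem _ ?_ (Submodule.smul_mem _ _ ?_)
    · simpa [mem_conjSub] using hx.1 ⟨w, hw⟩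
    · simpa [mem_conjSub] using hy.1 ⟨w, hw⟩
  choose π hπT hπ hπ' using fun w => exists_proj (hT.disjoint w)
  have hπW : SmAt (fun w => π w (W w)) z := SmAt.proj hT.smooth hT.disjoint hπ hπ' ⟨hW, hWv⟩
  -- The T-component of W vanishes on the fibre, so its brackets with vertical fields vanish at z.
  -- The remaining T̄-component is harmless because T̄ is involutive.
  have h5 : PresAt (cj T) (fun w => π w (W w)) z := by
    refine ⟨hπW, fun u hu => ?_⟩
    rw [bracket_eq_zero_of_fiber hα hu.1 hπW (hu.2.mono fun w hw => hT.conj_le_ker w hw)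
      (by filter_upwards [hWf] with w h6 h7 using hπ' w _ (h6 h7))]
    exact Submodule.zero_mem _
  have h6 : SectAt (cj T) (fun w => W w - π w (W w)) z := by
    refine ⟨hW.sub hπW, ?_⟩
    filter_upwards [hWv] with w hw
    obtain ⟨p, hp, q, hq, hpq⟩ := Submodule.mem_sup.1 hw
    rw [← hpq, map_add, hπ w p hp, hπ' w q hq, add_zero, add_sub_cancel_left]
    exact hq
  refine ((h5.add (PresAt.of_sectAt hT.involutive.cj h6)).sub
    (hX.sub (hY.const_smul Complex.I))).congr (Eventually.of_forall fun w => ?_)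
  have h7 : Θbar w (a (α w)) = 0 := by
    rw [← h.comp_proj, p01_of_mem_T10 (cext_mem_T10 (p10_mem v) _), map_zero]
  change _ = Θbar w (a (α w) + Cx.conj (b (α w)))
  rw [map_add (Θbar w), h7]
  simp only [W]
  abel

/-! ### The `∂̄`-operator -/

variable {β : BundleAut (ES := ES) α TA TB} {D : PreQuotHom (ES := ES) α TA}
  {Θ Θbar : PreHom (ES := ES) (EZ := EZ) α}

theorem isLiftOn_dbarOmega (hα : Continuous α) (h : SmoothHomOn α univ Θbar) {U : Set Z}
    {L : PreHom (ES := ES) (EZ := EZ) α} (hL : IsLiftOn α TA D U L) :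
    IsLiftOn α TB (dbarOmega β D Θbar) U (fun z => β.C z ∘ₗ L z - Θbar z) := by
  have h1 := β.isLiftOn hα hL
  refine ⟨hL.1, (smoothHomOn_iff hα hL.1).2 fun z hz a ha => ?_, fun z hz => ?_⟩
  · exact (h1.homSmAt hα hz a ha).sub ((smoothHomOn_iff hα isOpen_univ).1 h z trivial a ha)
  · rw [dbarOmega, ← h1.2.2 z hz]
    ext v
    exact map_sub (Submodule.mkQ _) _ _

theorem isDbarOperator_dbarOmega (hα : Continuous α) (hTB : IsRelComplexStructure (ES := ES) α TB)
    (hD : IsDbarOperator α TA D) (h : IsComplexConjugation α TB om Θ Θbar) :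
    IsDbarOperator α TB (dbarOmega β D Θbar) := by
  refine IsSplitting.of_lifts hTB.conj_le_ker (fun z v => ?_) fun z => ?_
  · change β.quot z (D z _) - Submodule.mkQ _ (Θbar z _) = β.quot z (D z _) - Submodule.mkQ _ (Θbar z _)
    rw [hD.comp_proj, h.comp_proj]
  · obtain ⟨U, L, hz, hL⟩ := hD.smooth z
    refine ⟨U, _, hz, isLiftOn_dbarOmega hα h.smooth hL, fun v => ?_⟩
    change dC (ES := ES) α z (β.C z (L z v) - Θbar z v) = _
    rw [map_sub, β.dC_C, hTB.le_ker z (h.mem z v), sub_zero, IsSplitting.dC_lift hD (hL.2.2 z hz)]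

theorem IsHolomorphicFibration.localLifting (hα : ContMDiff 𝓘(ℝ, EZ) 𝓘(ℝ, ES) ∞ α)
    (hT : IsRelComplexStructure (ES := ES) α TA) (hD : IsHolomorphicFibration α TA D) :
    LocalLifting α TA D := localLifting_of_homPresAt hα.continuous fun z => by
  obtain ⟨U, L, hz, hL⟩ := hD.1.smooth z
  exact ⟨U, L, hz, hL, fun y hy => hD.homPresAt hα hT hL hy⟩

/-- With L a lifting of ∂̄_f, β ∘ L - Θbar is a lifting of ∂̄_ω, and both of its terms are
holomorphic along the fibres. -/
theorem localLifting_dbarOmega (hα : ContMDiff 𝓘(ℝ, EZ) 𝓘(ℝ, ES) ∞ α)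
    (hTA : IsRelComplexStructure (ES := ES) α TA) (hTB : IsRelComplexStructure (ES := ES) α TB)
    (hβ : β.PreservesLocalLifting)
    (hD : IsHolomorphicFibration α TA D) (h : IsComplexConjugation α TB om Θ Θbar) :
    LocalLifting α TB (dbarOmega β D Θbar) := by
  have hc := hα.continuous
  have h1 : LocalLifting α TA D := hD.localLifting hα hTA
  refine localLifting_of_homPresAt hc fun z => ?_
  obtain ⟨U, L, hz, hL⟩ := hD.1.smooth z
  exact ⟨U, _, hz, isLiftOn_dbarOmega hc h.smooth hL, fun y hy =>
    (hβ.homPresAt hc hTB.involutive (.inl hD.1) h1 hL hy).sub (h.homPresAt hα hTB y)⟩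

end Fibration

/-! ### Construction of the bracket tensor. -/

section Fibration

variable {ES : Type*} [NormedAddCommGroup ES] [NormedSpace ℂ ES]
  {S : Type*} [TopologicalSpace S] [ChartedSpace ES S] [IsManifold 𝓘(ℂ, ES) ω S]
  {EZ : Type*} [NormedAddCommGroup EZ] [NormedSpace ℝ EZ]
  {Z : Type*} [TopologicalSpace Z] [ChartedSpace EZ Z] [IsManifold 𝓘(ℝ, EZ) ∞ Z]
  {α : Z → S} {z : Z} {T TA TB : ∀ z : Z, Submodule ℂ (TC EZ z)}

/-! ### The inverse of a bundle automorphism -/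

/-- The inverse of `β` on complexified tangent spaces. -/
def BundleAut.invC (β : BundleAut (ES := ES) α TA TB) (z : Z) : TC EZ z →ₗ[ℂ] TC EZ z :=
  Cx.map (β.toFun z).symm.toLinearMap

theorem BundleAut.C_invC (β : BundleAut (ES := ES) α TA TB) (w : TC EZ z) : β.C z (β.invC z w) = w :=
  Cx.ext ((β.toFun z).apply_symm_apply w.re) ((β.toFun z).apply_symm_apply w.im)

theorem BundleAut.invC_C (β : BundleAut (ES := ES) α TA TB) (w : TC EZ z) : β.invC z (β.C z w) = w :=
  Cx.ext ((β.toFun z).symm_apply_apply w.re) ((β.toFun z).symm_apply_apply w.im)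

theorem BundleAut.invC_mem (β : BundleAut (ES := ES) α TA TB) {w : TC EZ z} (hw : w ∈ TB z) :
    β.invC z w ∈ TA z := by
  rw [← β.map_eq z] at hw
  obtain ⟨u, hu, rfl⟩ := hw
  exact (β.invC_C u).symm ▸ hu

theorem BundleAut.C_injective (β : BundleAut (ES := ES) α TA TB) (z : Z) :
    Function.Injective (β.C z) := Function.LeftInverse.injective (g := β.invC z) β.invC_C

theorem BundleAut.linearIndependent (β : BundleAut (ES := ES) α TA TB) {ι : Type*} {e : ι → TC EZ z}
    (h : LinearIndependent ℂ e) : LinearIndependent ℂ (fun i => β.C z (e i)) :=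
  h.map' (β.C z) (LinearMap.ker_eq_bot.2 (β.C_injective z))

/-- Replaces smoothness of β⁻¹: X has the same coefficients in a frame e as β(X) has in the smooth
frame β(e). -/
theorem BundleAut.smAt_of_C [FiniteDimensional ℝ EZ] (β : BundleAut (ES := ES) α TA TB)
    {X : ∀ z : Z, TC EZ z} (hX : SmAt (fun z => β.C z (X z)) z) : SmAt X z := by
  obtain ⟨n, e, he⟩ := exists_frameAt_top (E := EZ) z
  have h1 : ∀ y, ∃ c : Fin n → ℂ, Submodule.span ℂ (range fun i => e i y) = ⊤ →
      X y = ∑ i, c i • e i y := by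
    intro y
    by_cases hy : Submodule.span ℂ (range fun i => e i y) = ⊤
    · obtain ⟨c, hc⟩ := (Submodule.mem_span_range_iff_exists_fun ℂ).1
        (hy.symm ▸ Submodule.mem_top : X y ∈ Submodule.span ℂ (range fun i => e i y))
      exact ⟨c, fun _ => hc.symm⟩
    · exact ⟨0, fun h => (hy h).elim⟩
  choose c hc using h1
  have h2 : ∀ᶠ y in 𝓝 z, X y = ∑ i, c y i • e i y := he.2.mono fun y hy => hc y hy.2
  have h3 : ∀ i, FSmAt EZ (fun y => c y i) z := by
    refine fSmAt_coeff (c := fun i y => c y i) (fun i => β.smAt (he.1 i))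
      (β.linearIndependent he.2.self_of_nhds.1) (hX.congr ?_)
    filter_upwards [h2] with y hy
    conv_lhs => rw [hy]
    simp only [map_sum, map_smul]
  exact (SmAt.sum _ fun i _ => (he.1 i).smul (h3 i)).congr (h2.mono fun y hy => hy.symm)

section Finite

variable [FiniteDimensional ℂ ES] [FiniteDimensional ℝ EZ]

theorem SmAt.p01 {a : ∀ s : S, TC ES s} {s : S} (ha : SmAt a s) : SmAt (fun s => p01 s (a s)) s := by
  have : FiniteDimensional ℝ ES := FiniteDimensional.complexToReal ES
  have hs := mem_chart_source ES s
  refine (SmAt.sum Finset.univ fun (i : CIdx ES) _ =>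
    (smAt_bframe hs (.inr i)).smul ((fSmAt_bcoord hs (.inr i)).cD ha)).congr ?_
  filter_upwards [chart_source_mem ES s] with y hy
  conv_rhs => rw [eq_sum_bframe hy (a y), Fintype.sum_sum_type, map_add, map_sum, map_sum]
  have h0 : ∑ i : CIdx ES, NLHodge.p01 y (cD (bcoord s (.inl i)) y (a y) • bframe s (.inl i) y) = 0 :=
    Finset.sum_eq_zero fun i _ => by
      rw [map_smul, p01_of_mem_T10 (v := bframe s (.inl i) y) (hframe_mem s y i), smul_zero]
  rw [h0, zero_add]
  refine Finset.sum_congr rfl fun i _ => ?_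
  rw [map_smul, p01_of_mem_T01 (bframe_inr_mem s y i)]

theorem SmAt.p10 {a : ∀ s : S, TC ES s} {s : S} (ha : SmAt a s) : SmAt (fun s => p10 s (a s)) s :=
  (ha.sub ha.p01).congr (Eventually.of_forall fun y => by
    conv_lhs => rw [← p10_add_p01 (a y)]
    rw [map_add, p01_of_mem_T10 (p10_mem _), p01_of_mem_T01 (p01_mem _), zero_add, add_sub_cancel_right])

theorem bframe_eq_cext (s₀ : S) (k : CIdx ES ⊕ CIdx ES) :
    bframe s₀ k = cext s₀ (bframe s₀ k s₀) := by
  ext1 s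
  rw [cext_apply]
  simp only [cD_bcoord_bframe (mem_chart_source ES s₀)]
  simp

/-! ### The curvature form of a morphism -/

theorem HomSmAt.cext {M : PreHom (ES := ES) (EZ := EZ) α} (hM : HomSmAt M z) (v : TC ES (α z)) :
    SmAt (fun y => M y (cext (α z) v (α y))) z := hM _ (smAt_cext_self _ v)

/-- The bilinear form of the brackets of the images under `M` of fields with constant
coefficients. -/
def bracketForm (M : PreHom (ES := ES) (EZ := EZ) α) (hM : HomSmAt M z) :
    TC ES (α z) →ₗ[ℂ] TC ES (α z) →ₗ[ℂ] TC EZ z :=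
  have := FiniteDimensional.complete ℝ EZ
  LinearMap.mk₂ ℂ (fun v w => bracket (fun y => M y (cext (α z) v (α y)))
      (fun y => M y (cext (α z) w (α y))) z)
    (fun v v' w => by
      simp only [map_add, Pi.add_apply]; exact bracket_add_left (hM.cext v) (hM.cext v'))
    (fun c v w => by
      simp only [map_smul, Pi.smul_apply]; exact bracket_const_smul_left c (hM.cext v))
    (fun v w w' => by
      simp only [map_add, Pi.add_apply]; exact bracket_add_right (hM.cext w) (hM.cext w'))
    (fun c v w => by
      simp only [map_smul, Pi.smul_apply]; exact bracket_const_smul_right c (hM.cext w))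

/-- `β G(v, w)` is the bracket modulo `T̄B` of the images under a lifting of `D + Θ` of
fields with constant coefficients. -/
def IsBracketTensor (β : BundleAut (ES := ES) α TA TB) (D : PreQuotHom (ES := ES) α TB)
    (Θ : PreHom (ES := ES) (EZ := EZ) α)
    (G : ∀ z : Z, TC ES (α z) →ₗ[ℂ] TC ES (α z) →ₗ[ℂ] TC EZ z) : Prop :=
  (∀ z v w, G z v w ∈ TA z) ∧ (∀ z v, G z v v = 0) ∧
  ∀ (U : Set Z) (L : PreHom (ES := ES) (EZ := EZ) α), IsLiftOn α TB D U L → ∀ z ∈ U, ∀ v w,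
    β.C z (G z v w) - bracket (fun y => (L y + Θ y) (cext (α z) v (α y)))
      (fun y => (L y + Θ y) (cext (α z) w (α y))) z ∈ conjSub (TB z)

variable {β : BundleAut (ES := ES) α TA TB} {D : PreQuotHom (ES := ES) α TB}
  {Θ L L' : PreHom (ES := ES) (EZ := EZ) α}
  {G G' : ∀ z : Z, TC ES (α z) →ₗ[ℂ] TC ES (α z) →ₗ[ℂ] TC EZ z}

/-- Fields which are congruent modulo `P` have congruent brackets if they preserve `P`. -/
theorem bracket_sub_bracket_mem {P : ∀ z : Z, Submodule ℂ (TC EZ z)}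
    {X X' Y Y' : ∀ z : Z, TC EZ z} (hX : PresAt P X z) (hY' : PresAt P Y' z)
    (hXX : SectAt P (fun y => X' y - X y) z) (hYY : SectAt P (fun y => Y' y - Y y) z) :
    bracket X' Y' z - bracket X Y z ∈ P z := by
  have := FiniteDimensional.complete ℝ EZ
  have h1 : bracket X' Y' z = bracket (fun y => (X' y - X y) + X y) Y' z :=
    bracket_congr (Eventually.of_forall fun y => by abel) (Eventually.of_forall fun _ => rfl)
  have h2 : bracket X Y z = bracket X (fun y => Y' y - (Y' y - Y y)) z :=
    bracket_congr (Eventually.of_forall fun _ => rfl) (Eventually.of_forall fun y => by abel)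
  rw [h1, h2, bracket_add_left hXX.1 hX.1, bracket_sub_right hY'.1 hYY.1]
  have h3 := (P z).add_mem (hY'.2 _ hXX) (hX.swap hYY)
  convert h3 using 1
  abel

theorem lift_sub_lift_mem (hL : toQuot TB L z = D z) (hL' : toQuot TB L' z = D z)
    (v : TC ES (α z)) : L z v - L' z v ∈ conjSub (TB z) :=
  (Submodule.Quotient.eq _).1 (LinearMap.congr_fun (hL.trans hL'.symm) v)

/-- At each z a lifting is chosen, the brackets of L + Θ are projected to T_B along T̄_B, and β is
inverted. Smoothness in z is not claimed here; it follows later from the congruence, which holds for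
every lifting. -/
theorem exists_isBracketTensor (hα : ContMDiff 𝓘(ℝ, EZ) 𝓘(ℝ, ES) ∞ α)
    (hTB : IsRelComplexStructure (ES := ES) α TB) (hD : IsDbarOperator α TB D)
    (hl : LocalLifting α TB D) (hΘ : IsAlmostHiggs α TB Θ) (hΘp : ∀ z, HomPresAt TB Θ z) :
    ∃ G, IsBracketTensor β D Θ G := by
  have := FiniteDimensional.complete ℝ EZ
  choose U L hz hL using hD.smooth
  choose π hπT hπ hπ' using fun w => exists_proj (hTB.disjoint w)
  have hM : ∀ z, HomPresAt TB (fun y => L z y + Θ y) z := fun z =>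
    (hl.homPresAt hα.continuous hTB.involutive (hL z) (hz z)).add (hΘp z)
  let B := fun z => bracketForm (fun y => L z y + Θ y) (hM z).homSmAt
  refine ⟨fun z => (B z).compr₂ (β.invC z ∘ₗ π z), fun z v w => β.invC_mem (hπT z _), fun z v => ?_,
    fun U' L' hL' z hz' v w => ?_⟩
  · change β.invC z (π z (bracket _ _ z)) = 0
    rw [bracket_self, map_zero, map_zero]
  · change β.C z (β.invC z (π z (bracket _ _ z))) - _ ∈ _
    rw [β.C_invC]
    have hv : ∀ v : TC ES (α z), ∀ᶠ y in 𝓝 z,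
        dC (ES := ES) α y ((L z y + Θ y) (cext (α z) v (α y))) = cext (α z) (p01 _ v) (α y) := by
      intro v
      filter_upwards [(hL z).mem_nhds (hz z)] with y hy
      rw [LinearMap.add_apply, map_add, IsSplitting.dC_lift hD ((hL z).2.2 y hy),
        hTB.le_ker y (hΘ.mem y _), add_zero, cext_p01]
    have h1 : ∀ x ∈ LinearMap.ker (dC (ES := ES) α z), π z x - x ∈ conjSub (TB z) := by
      intro x hx
      rw [← hTB.sup_eq] at hx
      obtain ⟨p, hp, q, hq, rfl⟩ := Submodule.mem_sup.1 hx
      rw [map_add, hπ z p hp, hπ' z q hq, add_zero, sub_add_cancel_left]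
      exact Submodule.neg_mem _ hq
    -- The bracket is vertical, hence in T_B ⊕ T̄_B, so projecting it changes it only by an element
    -- of T̄_B.
    have h2 := h1 _ (dC_bracket hα ((hM z).homSmAt.cext v) ((hM z).homSmAt.cext w)
      (mem_chart_source ES (α z)) (hv v) (hv w))
    have hM' : HomPresAt TB (fun y => L' y + Θ y) z :=
      (hl.homPresAt hα.continuous hTB.involutive hL' hz').add (hΘp z)
    have h3 : ∀ v : TC ES (α z), SectAt (cj TB) (fun y => (L z y + Θ y) (cext (α z) v (α y))
        - (L' y + Θ y) (cext (α z) v (α y))) z := by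
      intro v
      refine ⟨((hM z).homSmAt.cext v).sub (hM'.homSmAt.cext v), ?_⟩
      filter_upwards [(hL z).mem_nhds (hz z), hL'.mem_nhds hz'] with y h4 h5
      rw [LinearMap.add_apply, LinearMap.add_apply, add_sub_add_right_eq_sub]
      exact lift_sub_lift_mem ((hL z).2.2 y h4) (hL'.2.2 y h5) _
    have h6 := bracket_sub_bracket_mem (hM' _ (smAt_cext_self _ v)) (hM z _ (smAt_cext_self _ w))
      (h3 v) (h3 w)
    have h7 := Submodule.add_mem _ h2 h6
    rwa [sub_add_sub_cancel] at h7

end Finite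

end Fibration

/-! ### Type components and vertical holomorphy of the bracket tensor. -/

section Fibration

variable {ES : Type*} [NormedAddCommGroup ES] [NormedSpace ℂ ES]
  {S : Type*} [TopologicalSpace S] [ChartedSpace ES S] [IsManifold 𝓘(ℂ, ES) ω S]
  {EZ : Type*} [NormedAddCommGroup EZ] [NormedSpace ℝ EZ]
  {Z : Type*} [TopologicalSpace Z] [ChartedSpace EZ Z] [IsManifold 𝓘(ℝ, EZ) ∞ Z]
  {α : Z → S} {z : Z} {TA TB : ∀ z : Z, Submodule ℂ (TC EZ z)}

/-- `D` is a `∂̄`-operator and `Θ` an almost Higgs field on `(α, TB)`, and both of them are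
holomorphic along the fibres. -/
structure IsVerticallyHolPair (α : Z → S) (TB : ∀ z : Z, Submodule ℂ (TC EZ z))
    (D : PreQuotHom (ES := ES) α TB) (Θ : PreHom (ES := ES) (EZ := EZ) α) : Prop where
  smooth : ContMDiff 𝓘(ℝ, EZ) 𝓘(ℝ, ES) ∞ α
  rel : IsRelComplexStructure (ES := ES) α TB
  dbar : IsDbarOperator α TB D
  lifting : LocalLifting α TB D
  higgs : IsAlmostHiggs α TB Θ
  higgs_pres : ∀ z, HomPresAt TB Θ z

variable [FiniteDimensional ℂ ES] [FiniteDimensional ℝ EZ]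
  {β : BundleAut (ES := ES) α TA TB} {D : PreQuotHom (ES := ES) α TB}
  {Θ L L' : PreHom (ES := ES) (EZ := EZ) α}
  {G G' : ∀ z : Z, TC ES (α z) →ₗ[ℂ] TC ES (α z) →ₗ[ℂ] TC EZ z}

theorem bracket_hom_hom (hα : ContMDiff 𝓘(ℝ, EZ) 𝓘(ℝ, ES) ∞ α) (hL : HomSmAt L z)
    (hL' : HomSmAt L' z) {a b : ∀ s : S, TC ES s} (ha : SmAt a (α z)) (hb : SmAt b (α z)) :
    bracket (fun y => L y (a (α y))) (fun y => L' y (b (α y))) z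
      = bracket (fun y => L y (cext (α z) (a (α z)) (α y)))
          (fun y => L' y (cext (α z) (b (α z)) (α y))) z
        - L z (corr α z a (fun y => L' y (b (α y))))
        + L' z (corr α z b (fun y => L y (cext (α z) (a (α z)) (α y)))) := by
  rw [bracket_hom hα hL ha, bracket_swap _ (fun y => L' y (b (α y))), bracket_hom hα hL' hb,
    bracket_swap _ (fun y => L y (cext (α z) (a (α z)) (α y)))]
  abel

theorem corr_bframe_mem {s₀ : S} (hs : α z ∈ (chartAt ES s₀).source) (k : CIdx ES ⊕ CIdx ES)
    {Y : ∀ z : Z, TC EZ z} (hY : dC (ES := ES) α z (Y z) ∈ T01 (α z)) :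
    corr α z (bframe s₀ k) Y ∈ T01 (α z) := by
  cases k with
  | inl i =>
    have h := corr_of_hol (chartAt ES s₀).open_source (isHolFieldOn_hframe s₀ i) hs hY
    change corr α z (hframe s₀ i) Y ∈ _
    rw [h]
    exact Submodule.zero_mem _
  | inr i => exact corr_mem_T01 (Eventually.of_forall fun s => bframe_inr_mem s₀ s i)

/-- T̄_B is vertical, so functions pulled back from S are constant along it. -/
theorem FSmAt.presAt_smul (hα : ContMDiff 𝓘(ℝ, EZ) 𝓘(ℝ, ES) ∞ α)
    (hTB : IsRelComplexStructure (ES := ES) α TB) {f : S → ℂ} (hf : FSmAt ES f (α z))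
    {X : ∀ z : Z, TC EZ z} (hX : PresAt (cj TB) X z) : PresAt (cj TB) (fun y => f (α y) • X y) z := by
  have := FiniteDimensional.complete ℝ EZ
  refine hX.smul (hf.comp hα) fun v hv => ?_
  have h1 : dC (ES := ES) α z v = 0 := hTB.conj_le_ker z hv
  rw [cD_comp hα hf, h1, ← cDL_apply, map_zero]

namespace IsVerticallyHolPair

theorem homPresAt_lift (h : IsVerticallyHolPair α TB D Θ) {U : Set Z} (hL : IsLiftOn α TB D U L)
    (hz : z ∈ U) : HomPresAt TB L z :=
  h.lifting.homPresAt h.smooth.continuous h.rel.involutive hL hz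

theorem homPresAt_add (h : IsVerticallyHolPair α TB D Θ) {U : Set Z} (hL : IsLiftOn α TB D U L)
    (hz : z ∈ U) : HomPresAt TB (fun y => L y + Θ y) z :=
  (h.homPresAt_lift hL hz).add (h.higgs_pres z)

theorem dC_add (h : IsVerticallyHolPair α TB D Θ) (hL : toQuot TB L z = D z) (v : TC ES (α z)) :
    dC (ES := ES) α z ((L z + Θ z) v) = p01 (α z) v := by
  rw [LinearMap.add_apply, map_add, IsSplitting.dC_lift h.dbar hL, h.rel.le_ker z (h.higgs.mem z v),
    add_zero]

theorem higgs_eq_zero (h : IsVerticallyHolPair α TB D Θ) {v : TC ES (α z)} (hv : v ∈ T01 (α z)) :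
    Θ z v = 0 := by
  rw [← h.higgs.comp_proj, p10_of_mem_T01 hv, map_zero]

theorem eq_zero_of_mem_conj (h : IsVerticallyHolPair α TB D Θ) {w : TC EZ z} (hw : w ∈ TB z)
    (hw' : w ∈ conjSub (TB z)) : w = 0 :=
  Submodule.disjoint_def.1 (h.rel.disjoint z) w hw hw'

/-- T_B is vertical, and the vertical vectors in T̄_D are those of T̄_B. -/
theorem eq_zero_of_mem_Tbar (h : IsVerticallyHolPair α TB D Θ) {w : TC EZ z} (hw : w ∈ TB z)
    (hw' : w ∈ Tbar D z) : w = 0 :=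
  h.eq_zero_of_mem_conj hw (h.dbar.mem_of_vertical hw' (h.rel.le_ker z hw))

theorem exists_lift (h : IsVerticallyHolPair α TB D Θ) (z : Z) : ∃ U L, z ∈ U ∧ IsLiftOn α TB D U L :=
  h.dbar.smooth z

theorem sectAt_lift (h : IsVerticallyHolPair α TB D Θ) {U : Set Z} (hL : IsLiftOn α TB D U L)
    (hz : z ∈ U) {a : ∀ s : S, TC ES s} (ha : SmAt a (α z)) (h10 : ∀ᶠ s in 𝓝 (α z), a s ∈ T10 s) :
    SectAt (cj TB) (fun y => L y (a (α y))) z := by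
  refine ⟨hL.homSmAt h.smooth.continuous hz a ha, ?_⟩
  filter_upwards [hL.mem_nhds hz, h.smooth.continuous.continuousAt.eventually h10] with y hy h1
    using h.dbar.lift_mem_of_mem_T10 (hL.2.2 y hy) h1

/-- Θ vanishes on (0,1)-vectors, and the two correction terms are values of L, which lie in T̄_D. -/
theorem type02 (h : IsVerticallyHolPair α TB D Θ) (hG : IsBracketTensor β D Θ G) {U : Set Z}
    (hL : IsLiftOn α TB D U L) (hz : z ∈ U) {a b : ∀ s : S, TC ES s} (ha : SectAt T01 a (α z))
    (hb : SectAt T01 b (α z)) : β.C z (G z (a (α z)) (b (α z)))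
      - bracket (fun z => L z (a (α z))) (fun z => L z (b (α z))) z ∈ Tbar D z := by
  have hs := hL.homSmAt h.smooth.continuous hz
  have h1 := conjSub_le_Tbar (D := D) (hG.2.2 U L hL z hz (a (α z)) (b (α z)))
  simp only [LinearMap.add_apply, h.higgs_eq_zero (cext_mem_T01 ha.2.self_of_nhds _),
    h.higgs_eq_zero (cext_mem_T01 hb.2.self_of_nhds _), add_zero] at h1
  rw [bracket_hom_hom h.smooth hs hs ha.1 hb.1, ← sub_sub, sub_sub_eq_add_sub, add_sub_right_comm]
  exact Submodule.sub_mem _ (Submodule.add_mem _ h1 (lift_mem_Tbar (hL.2.2 z hz) _))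
    (lift_mem_Tbar (hL.2.2 z hz) _)

/-- L of a (1,0)-field is a section of T̄_B, so its bracket with L(b) drops out and only Θ(a)
remains. Both correction terms vanish: a is holomorphic and L(b) projects to a (0,1)-vector, while
Θ(a) is vertical. -/
theorem type11 (h : IsVerticallyHolPair α TB D Θ) (hG : IsBracketTensor β D Θ G) {U : Set Z}
    (hL : IsLiftOn α TB D U L) (hz : z ∈ U) {V : Set S} (hV : IsOpen V) (hzV : α z ∈ V)
    {a b : ∀ s : S, TC ES s} (ha : IsHolFieldOn V a) (hb : SectAt T01 b (α z)) :
    β.C z (G z (a (α z)) (b (α z)))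
      - bracket (fun z => Θ z (a (α z))) (fun z => L z (b (α z))) z ∈ conjSub (TB z) := by
  have := FiniteDimensional.complete ℝ EZ
  have hc := h.smooth.continuous
  have hs := hL.homSmAt hc hz
  have hp := h.homPresAt_lift hL hz
  have h1 := hG.2.2 U L hL z hz (a (α z)) (b (α z))
  simp only [LinearMap.add_apply, h.higgs_eq_zero (cext_mem_T01 hb.2.self_of_nhds _), add_zero] at h1
  rw [bracket_add_left (hs.cext _) ((h.higgs.homSmAt hc z).cext _)] at h1
  have h2 := (hp _ (smAt_cext_self _ (b (α z)))).2 _ (h.sectAt_lift hL hz (smAt_cext_self _ (a (α z)))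
    (Eventually.of_forall fun s => cext_mem_T10 (ha.1 _ hzV) s))
  rw [bracket_hom_hom h.smooth (h.higgs.homSmAt hc z) hs (ha.smAt hV hzV) hb.1,
    corr_of_hol hV ha hzV, corr_eq_zero, map_zero, map_zero, sub_zero, add_zero]
  · have h3 := Submodule.add_mem _ h1 h2
    convert h3 using 1
    abel
  · exact h.rel.le_ker z (h.higgs.mem z _)
  · rw [IsSplitting.dC_lift h.dbar (hL.2.2 z hz)]
    exact p01_mem _

/-- On (1,0)-fields L + Θ and Θ differ by sections of T̄_B, which gives the congruence modulo T̄_B.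
Both sides lie in T_B, so it is an equality. -/
theorem type20 (h : IsVerticallyHolPair α TB D Θ) (hG : IsBracketTensor β D Θ G)
    {a b : ∀ s : S, TC ES s} (ha : SectAt T10 a (α z))
    (hb : SectAt T10 b (α z)) : β.C z (G z (a (α z)) (b (α z)))
      = bracket (fun z => Θ z (a (α z))) (fun z => Θ z (b (α z))) z := by
  obtain ⟨U, L, hz, hL⟩ := h.exists_lift z
  have := FiniteDimensional.complete ℝ EZ
  have hc := h.smooth.continuous
  have hsΘ := h.higgs.homSmAt hc z
  rw [bracket_hom_hom h.smooth hsΘ hsΘ ha.1 hb.1, corr_eq_zero, corr_eq_zero, map_zero, sub_zero,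
    add_zero, ← sub_eq_zero]
  · refine h.eq_zero_of_mem_conj (Submodule.sub_mem _ (β.C_mem (hG.1 _ _ _)) ?_) ?_
    · exact h.rel.involutive.bracket_mem
        ⟨hsΘ.cext _, Eventually.of_forall fun y => h.higgs.mem y _⟩
        ⟨hsΘ.cext _, Eventually.of_forall fun y => h.higgs.mem y _⟩
    · have h1 := hG.2.2 U L hL z hz (a (α z)) (b (α z))
      have h2 : ∀ v ∈ T10 (α z), SectAt (cj TB) (fun y => (L y + Θ y) (cext (α z) v (α y))
          - Θ y (cext (α z) v (α y))) z := fun v hv =>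
        (h.sectAt_lift hL hz (smAt_cext_self _ v)
          (Eventually.of_forall fun s => cext_mem_T10 hv s)).congr
          (Eventually.of_forall fun y => by rw [LinearMap.add_apply, add_sub_cancel_right])
      have h3 := bracket_sub_bracket_mem (h.higgs_pres z _ (smAt_cext_self _ (a (α z))))
        (h.homPresAt_add hL hz _ (smAt_cext_self _ (b (α z)))) (h2 _ ha.2.self_of_nhds)
        (h2 _ hb.2.self_of_nhds)
      have h4 := Submodule.add_mem _ h1 h3
      rwa [sub_add_sub_cancel] at h4
  · exact h.rel.le_ker z (h.higgs.mem z _)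
  · exact h.rel.le_ker z (h.higgs.mem z _)

theorem dC_bracket_bframe (h : IsVerticallyHolPair α TB D Θ) {U : Set Z} (hL : IsLiftOn α TB D U L)
    (hz : z ∈ U) {s₀ : S} (hs : α z ∈ (chartAt ES s₀).source) (k l : CIdx ES ⊕ CIdx ES) :
    dC (ES := ES) α z (bracket (fun y => (L y + Θ y) (bframe s₀ k (α y)))
      (fun y => (L y + Θ y) (bframe s₀ l (α y))) z) = 0 := by
  have hM := (h.homPresAt_add hL hz).homSmAt
  have h1 : ∀ k : CIdx ES ⊕ CIdx ES, ∀ᶠ y in 𝓝 z, dC (ES := ES) α y ((L y + Θ y) (bframe s₀ k (α y)))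
      = cext s₀ (p01 s₀ (bframe s₀ k s₀)) (α y) := by
    intro k
    filter_upwards [hL.mem_nhds hz] with y hy
    rw [h.dC_add (hL.2.2 y hy), ← cext_p01, ← bframe_eq_cext]
  exact dC_bracket h.smooth (hM _ (smAt_bframe hs k)) (hM _ (smAt_bframe hs l)) hs (h1 k) (h1 l)

/-- At z the tensor is defined by the chart centred at α z, but smoothness in z requires one fixed
chart s₀. The change of chart costs (L + Θ)(c) with c of type (0,1). Both brackets are vertical, so
c = p01 c = dα((L + Θ)(c)) = 0. -/
theorem sub_bracket_bframe_mem (h : IsVerticallyHolPair α TB D Θ) (hG : IsBracketTensor β D Θ G)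
    {U : Set Z} (hL : IsLiftOn α TB D U L) (hz : z ∈ U) {s₀ : S}
    (hs : α z ∈ (chartAt ES s₀).source) (k l : CIdx ES ⊕ CIdx ES) :
    β.C z (G z (bframe s₀ k (α z)) (bframe s₀ l (α z)))
      - bracket (fun y => (L y + Θ y) (bframe s₀ k (α y)))
          (fun y => (L y + Θ y) (bframe s₀ l (α y))) z ∈ conjSub (TB z) := by
  have hM := (h.homPresAt_add hL hz).homSmAt
  have h1 := hG.2.2 U L hL z hz (bframe s₀ k (α z)) (bframe s₀ l (α z))
  have h2 := bracket_hom_hom h.smooth hM hM (smAt_bframe hs k) (smAt_bframe hs l)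
  rw [sub_add, ← map_sub] at h2
  set c := corr α z (bframe s₀ k) (fun y => (L y + Θ y) (bframe s₀ l (α y))) -
    corr α z (bframe s₀ l) (fun y => (L y + Θ y) (cext (α z) (bframe s₀ k (α z)) (α y))) with hc
  have h3 : c ∈ T01 (α z) := by
    refine Submodule.sub_mem _ (corr_bframe_mem hs k ?_) (corr_bframe_mem hs l ?_) <;>
    · rw [h.dC_add (hL.2.2 z hz)]
      exact p01_mem _
  have h4 : dC (ES := ES) α z (β.C z (G z (bframe s₀ k (α z)) (bframe s₀ l (α z)))
      - bracket (fun y => (L y + Θ y) (cext (α z) (bframe s₀ k (α z)) (α y)))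
          (fun y => (L y + Θ y) (cext (α z) (bframe s₀ l (α z)) (α y))) z) = 0 :=
    h.rel.conj_le_ker z h1
  have h5 : dC (ES := ES) α z (β.C z (G z (bframe s₀ k (α z)) (bframe s₀ l (α z)))) = 0 :=
    h.rel.le_ker z (β.C_mem (hG.1 _ _ _))
  rw [map_sub, h5, zero_sub, neg_eq_zero] at h4
  have h6 := h.dC_bracket_bframe hL hz hs k l
  rw [h2, map_sub, h4, zero_sub, neg_eq_zero, h.dC_add (hL.2.2 z hz), p01_of_mem_T01 h3] at h6
  rw [h2, h6, map_zero, sub_zero]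
  exact h1

/-- The bracket of two fields preserving T̄_B preserves T̄_B by Jacobi, and βG differs from it by a
section of T̄_B. For smoothness, βG is the T_B-component of this smooth vertical bracket. -/
theorem presAt_bframe (h : IsVerticallyHolPair α TB D Θ) (hG : IsBracketTensor β D Θ G) {s₀ : S}
    (hs : α z ∈ (chartAt ES s₀).source) (k l : CIdx ES ⊕ CIdx ES) :
    PresAt (cj TB) (fun y => β.C y (G y (bframe s₀ k (α y)) (bframe s₀ l (α y)))) z := by
  have := FiniteDimensional.complete ℝ EZ
  obtain ⟨U, L, hz, hL⟩ := h.exists_lift z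
  have hs' : ∀ᶠ y in 𝓝 z, α y ∈ (chartAt ES s₀).source :=
    h.smooth.continuous.continuousAt.eventually ((chartAt ES s₀).open_source.mem_nhds hs)
  have h1 : ∀ k : CIdx ES ⊕ CIdx ES, ∀ᶠ y in 𝓝 z,
      PresAt (cj TB) (fun y => (L y + Θ y) (bframe s₀ k (α y))) y := by
    intro k
    filter_upwards [hs', hL.mem_nhds hz] with y h2 h3
      using h.homPresAt_add hL h3 _ (smAt_bframe h2 k)
  have h2 := PresAt.bracket (h1 k) (h1 l)
  have h3 : ∀ᶠ y in 𝓝 z, β.C y (G y (bframe s₀ k (α y)) (bframe s₀ l (α y)))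
      - bracket (fun y => (L y + Θ y) (bframe s₀ k (α y)))
          (fun y => (L y + Θ y) (bframe s₀ l (α y))) y ∈ conjSub (TB y) := by
    filter_upwards [hs', hL.mem_nhds hz] with y h4 h5
      using h.sub_bracket_bframe_mem hG hL h5 h4 k l
  choose π hπT hπ hπ' using fun w => exists_proj (h.rel.disjoint w)
  have h4 : SmAt (fun y => π y (bracket (fun y => (L y + Θ y) (bframe s₀ k (α y)))
      (fun y => (L y + Θ y) (bframe s₀ l (α y))) y)) z := by
    refine SmAt.proj h.rel.smooth h.rel.disjoint hπ hπ' ⟨h2.1, ?_⟩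
    filter_upwards [hs', hL.mem_nhds hz] with y h4 h5
    rw [h.rel.sup_eq]
    exact h.dC_bracket_bframe hL h5 h4 k l
  have h5 : SmAt (fun y => β.C y (G y (bframe s₀ k (α y)) (bframe s₀ l (α y)))) z := by
    refine h4.congr ?_
    filter_upwards [h3] with y hy
    have h6 := hπ' y _ hy
    rw [map_sub, hπ y _ (β.C_mem (hG.1 _ _ _)), sub_eq_zero] at h6
    exact h6.symm
  exact (h2.add (PresAt.of_sectAt h.rel.involutive.cj ⟨h5.sub h2.1, h3⟩)).congr
    (Eventually.of_forall fun y => by abel)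

theorem presAt_bracketTensor (h : IsVerticallyHolPair α TB D Θ) (hG : IsBracketTensor β D Θ G)
    {a b : ∀ s : S, TC ES s} (ha : SmAt a (α z)) (hb : SmAt b (α z)) :
    PresAt (cj TB) (fun y => β.C y (G y (a (α y)) (b (α y)))) z := by
  have := FiniteDimensional.complete ℝ EZ
  have : FiniteDimensional ℝ ES := FiniteDimensional.complexToReal ES
  have hs := mem_chart_source ES (α z)
  have h1 := PresAt.sum (P := cj TB) Finset.univ fun (k : CIdx ES ⊕ CIdx ES) _ =>
    PresAt.sum (P := cj TB) Finset.univ fun (l : CIdx ES ⊕ CIdx ES) _ =>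
      ((fSmAt_bcoord hs k).cD ha).presAt_smul h.smooth h.rel
        (((fSmAt_bcoord hs l).cD hb).presAt_smul h.smooth h.rel (h.presAt_bframe hG hs k l))
  refine h1.congr ?_
  filter_upwards [h.smooth.continuous.continuousAt.eventually (chart_source_mem ES (α z))] with y hy
  conv_rhs => rw [eq_sum_bframe hy (a (α y)), eq_sum_bframe hy (b (α y))]
  simp only [map_sum, map_smul, LinearMap.sum_apply, LinearMap.smul_apply, Finset.smul_sum]
  rw [Finset.sum_comm]
  exact Finset.sum_congr rfl fun l _ => Finset.sum_congr rfl fun k _ => smul_comm _ _ _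

end IsVerticallyHolPair

end Fibration

/-! ### Transfer to `TA`, uniqueness, and vanishing for Higgs bundles. -/

section Fibration

variable {ES : Type*} [NormedAddCommGroup ES] [NormedSpace ℂ ES]
  {S : Type*} [TopologicalSpace S] [ChartedSpace ES S] [IsManifold 𝓘(ℂ, ES) ω S]
  {EZ : Type*} [NormedAddCommGroup EZ] [NormedSpace ℝ EZ]
  {Z : Type*} [TopologicalSpace Z] [ChartedSpace EZ Z] [IsManifold 𝓘(ℝ, EZ) ∞ Z]
  {α : Z → S} {z : Z} {TA TB : ∀ z : Z, Submodule ℂ (TC EZ z)}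
  [FiniteDimensional ℂ ES] [FiniteDimensional ℝ EZ]

/-- A smooth field near a point agrees near that point with a smooth field on the whole manifold. -/
theorem SmAt.exists_global [T2Space S] {b : ∀ s : S, TC ES s} {s : S} (hb : SmAt b s) :
    ∃ b' : ∀ s : S, TC ES s, (∀ s', SmAt b' s') ∧ ∀ᶠ y in 𝓝 s, b' y = b y := by
  have : FiniteDimensional ℝ ES := FiniteDimensional.complexToReal ES
  -- The bump function has its support where b is smooth, so the product extends by zero.
  obtain ⟨f, -, hf⟩ := (SmoothBumpFunction.nhds_basis_tsupport (I := 𝓘(ℝ, ES)) s).mem_iff.1 hb.eventually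
  refine ⟨fun y => (f y : ℂ) • b y, fun y => ?_, ?_⟩
  · by_cases hy : y ∈ tsupport f
    · exact SmAt.smul (f := fun y => (f y : ℂ))
        ⟨Eventually.of_forall fun y => f.contMDiff y, .const _⟩ (hf hy)
    · refine SmAt.zero.congr ?_
      filter_upwards [(isClosed_tsupport f).isOpen_compl.mem_nhds hy] with w hw
      rw [image_eq_zero_of_notMem_tsupport hw, Complex.ofReal_zero, zero_smul]
  · filter_upwards [f.eventuallyEq_one] with y hy
    rw [hy, Pi.one_apply, Complex.ofReal_one, one_smul]

/-- A vertical morphism is holomorphic along the fibres if it is so after applying `β`. -/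
theorem BundleAut.PreservesLocalLifting.homPresAt_of_comp {β : BundleAut (ES := ES) α TA TB}
    (hβ : β.PreservesLocalLifting) (hα : Continuous α)
    (hTA : IsRelComplexStructure (ES := ES) α TA) (hTB : Involutive TB)
    {p : ∀ s : S, TC ES s →ₗ[ℂ] TC ES s} (hp : p = p01 ∨ p = p10)
    {D : PreQuotHom (ES := ES) α TA} (hD : IsSplitting α TA p D) (hl : LocalLifting α TA D)
    {K : PreHom (ES := ES) (EZ := EZ) α} (hKp : ∀ z v, K z (p (α z) v) = K z v)
    (hKv : ∀ z v, K z v ∈ TA z) (hK : ∀ z, HomSmAt K z)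
    (hKB : ∀ z, HomPresAt TB (fun z => β.C z ∘ₗ K z) z) (z : Z) : HomPresAt TA K z := by
  have := FiniteDimensional.complete ℝ EZ
  have hor : ∀ D : PreQuotHom (ES := ES) α TA, IsSplitting α TA p D →
      IsDbarOperator α TA D ∨ IsAlmostConnection α TA D := by
    intro D hD
    rcases hp with rfl | rfl
    · exact .inl hD
    · exact .inr hD
  -- K is not a splitting, so the hypothesis on β does not apply to it. D + K is a splitting of the
  -- same type as D, and β ∘ (D + K) satisfies the local lifting condition.
  let D' : PreQuotHom (ES := ES) α TA := fun z => D z + toQuot TA K z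
  have hlift : ∀ {U : Set Z} {L : PreHom (ES := ES) (EZ := EZ) α}, IsLiftOn α TA D U L →
      IsLiftOn α TA D' U (fun z => L z + K z) := by
    intro U L hL
    refine ⟨hL.1, (smoothHomOn_iff hα hL.1).2 fun z hz a ha =>
      (hL.homSmAt hα hz a ha).add (hK z a ha), fun z hz => ?_⟩
    change _ = D z + toQuot TA K z
    rw [← hL.2.2 z hz]
    ext v
    exact map_add (Submodule.mkQ _) _ _
  have hD' : IsSplitting α TA p D' := by
    refine IsSplitting.of_lifts hTA.conj_le_ker (fun z v => ?_) fun z => ?_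
    · change D z _ + Submodule.mkQ _ (K z _) = D z _ + Submodule.mkQ _ (K z _)
      rw [hD.comp_proj, hKp]
    · obtain ⟨U, L, hz, hL⟩ := hD.smooth z
      refine ⟨U, _, hz, hlift hL, fun v => ?_⟩
      rw [LinearMap.add_apply, map_add, hD.dC_lift (hL.2.2 z hz), hTA.le_ker z (hKv z v), add_zero]
  have hl' : LocalLifting α TA D' := by
    refine (hβ D' (hor D' hD')).2 (localLifting_of_homPresAt hα fun z => ?_)
    obtain ⟨U, L, hz, hL⟩ := hD.smooth z
    refine ⟨U, _, hz, β.isLiftOn hα (hlift hL), fun y hy => ?_⟩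
    have h1 := (hβ.homPresAt hα hTB (hor D hD) hl hL hy).add (hKB y)
    have h2 : (fun z => β.C z ∘ₗ L z + β.C z ∘ₗ K z) = fun z => β.C z ∘ₗ (L z + K z) := by
      funext z
      rw [LinearMap.comp_add]
    exact h2 ▸ h1
  obtain ⟨U, L, hz, hL⟩ := hD.smooth z
  -- K is the difference of the liftings L + K and L, both holomorphic along the fibres for T_A.
  have h1 := (hl'.homPresAt hα hTA.involutive (hlift hL) hz).sub
    (hl.homPresAt hα hTA.involutive hL hz)
  simpa only [add_sub_cancel_left] using h1

variable {β : BundleAut (ES := ES) α TA TB} {D : PreQuotHom (ES := ES) α TB}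
  {Θ L L' : PreHom (ES := ES) (EZ := EZ) α}
  {G G' : ∀ z : Z, TC ES (α z) →ₗ[ℂ] TC ES (α z) →ₗ[ℂ] TC EZ z}

namespace IsVerticallyHolPair

/-- Freezing the first argument of G leaves a one-form, to be split into types: the ∂̄-operator D₀
carries its (0,1)-part through β, and the almost connection D₁ its (1,0)-part. -/
theorem presAt_of_bracketTensor [T2Space S] (h : IsVerticallyHolPair α TB D Θ)
    (hG : IsBracketTensor β D Θ G) (hβ : β.PreservesLocalLifting)
    (hTA : IsRelComplexStructure (ES := ES) α TA)
    {D₀ D₁ : PreQuotHom (ES := ES) α TA} (hD₀ : IsDbarOperator α TA D₀) (hl₀ : LocalLifting α TA D₀)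
    (hD₁ : IsAlmostConnection α TA D₁) (hl₁ : LocalLifting α TA D₁)
    {a b : ∀ s : S, TC ES s} (ha : SmAt a (α z)) (hb : SmAt b (α z)) :
    PresAt (cj TA) (fun y => G y (a (α y)) (b (α y))) z := by
  have := FiniteDimensional.complete ℝ EZ
  have hc := h.smooth.continuous
  -- The one-form G(a', ·) is added to operators defined on all of Z, so a must be made global.
  obtain ⟨a', ha', haa⟩ := ha.exists_global
  have key : ∀ {p : ∀ s : S, TC ES s →ₗ[ℂ] TC ES s}, (p = NLHodge.p01 ∨ p = NLHodge.p10) →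
      (∀ {s} {b : ∀ s : S, TC ES s}, SmAt b s → SmAt (fun s => p s (b s)) s) →
      (∀ s v, p s (p s v) = p s v) →
      ∀ {D : PreQuotHom (ES := ES) α TA}, IsSplitting α TA p D → LocalLifting α TA D →
      HomPresAt TA (fun y => G y (a' (α y)) ∘ₗ p (α y)) z := by
    intro p hp hsm hpp D hD hl
    let K : PreHom (ES := ES) (EZ := EZ) α := fun y => G y (a' (α y)) ∘ₗ p (α y)
    have h1 : ∀ z, HomPresAt TB (fun y => β.C y ∘ₗ K y) z :=
      fun z b hb => h.presAt_bracketTensor hG (ha' _) (hsm hb)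
    have h2 : ∀ z v, K z (p (α z) v) = K z v := fun z v => congrArg (G z (a' (α z))) (hpp _ v)
    have h3 : ∀ z v, K z v ∈ TA z := fun z v => hG.1 _ _ _
    have h4 : ∀ z, HomSmAt K z := fun z b hb => β.smAt_of_C (h1 z b hb).1
    exact hβ.homPresAt_of_comp hc hTA h.rel.involutive hp hD hl h2 h3 h4 h1 z
  have h1 := key (.inl rfl) SmAt.p01 (fun s v => p01_of_mem_T01 (p01_mem v)) hD₀ hl₀ b hb
  have h2 := key (.inr rfl) SmAt.p10 (fun s v => p10_of_mem_T10 (p10_mem v)) hD₁ hl₁ b hb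
  refine (h2.add h1).congr ?_
  filter_upwards [hc.continuousAt.eventually haa] with y hy
  change G y (a' (α y)) (NLHodge.p10 _ (b (α y))) + G y (a' (α y)) (NLHodge.p01 _ (b (α y))) = _
  rw [← map_add, p10_add_p01, hy]

theorem isCurvatureTensor [T2Space S] (h : IsVerticallyHolPair α TB D Θ)
    (hG : IsBracketTensor β D Θ G) (hβ : β.PreservesLocalLifting)
    (hTA : IsRelComplexStructure (ES := ES) α TA)
    {D₀ D₁ : PreQuotHom (ES := ES) α TA} (hD₀ : IsDbarOperator α TA D₀) (hl₀ : LocalLifting α TA D₀)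
    (hD₁ : IsAlmostConnection α TA D₁) (hl₁ : LocalLifting α TA D₁) :
    IsCurvatureTensor β D Θ G := by
  have hc := h.smooth.continuous
  have h1 : ∀ {V : Set S} {a b : ∀ s : S, TC ES s}, IsOpen V → SmoothOn V a → SmoothOn V b →
      ∀ z ∈ α ⁻¹' V, PresAt (cj TA) (fun y => G y (a (α y)) (b (α y))) z := fun hV ha hb z hz =>
    h.presAt_of_bracketTensor hG hβ hTA hD₀ hl₀ hD₁ hl₁ ((smoothOn_iff hV).1 ha _ hz)
      ((smoothOn_iff hV).1 hb _ hz)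
  refine ⟨⟨hG.2.1, hG.1, fun V a b hV ha hb => (smoothOn_iff (hV.preimage hc)).2 fun z hz =>
      (h1 hV ha hb z hz).1, fun V a b hV ha hb => (bracketPreservesConj_iff (hV.preimage hc)
      fun z hz => (h1 hV ha hb z hz).1).2 (h1 hV ha hb)⟩, ?_, ?_, ?_⟩
  · intro U L hL V a b hV ha hb z hz
    exact h.type02 hG hL hz.1 ((isSectionOn_iff hV).1 ha _ hz.2) ((isSectionOn_iff hV).1 hb _ hz.2)
  · intro U L hL V a b hV ha hb z hz
    exact h.type11 hG hL hz.1 hV hz.2 ha ((isSectionOn_iff hV).1 hb _ hz.2)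
  · intro V a b hV ha hb z hz
    exact h.type20 hG ((isSectionOn_iff hV).1 ha _ hz) ((isSectionOn_iff hV).1 hb _ hz)

end IsVerticallyHolPair

/-- An alternating form that vanishes on vectors of pure types is zero. -/
theorem eq_zero_of_types {s : S} {V : Type*} [AddCommGroup V] [Module ℂ V]
    {H : TC ES s →ₗ[ℂ] TC ES s →ₗ[ℂ] V} (h0 : ∀ v, H v v = 0)
    (h02 : ∀ v ∈ T01 s, ∀ w ∈ T01 s, H v w = 0) (h11 : ∀ v ∈ T10 s, ∀ w ∈ T01 s, H v w = 0)
    (h20 : ∀ v ∈ T10 s, ∀ w ∈ T10 s, H v w = 0) : H = 0 := by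
  have h11' : ∀ v ∈ T01 s, ∀ w ∈ T10 s, H v w = 0 := by
    intro v hv w hw
    have h1 := h0 (v + w)
    simpa only [map_add, LinearMap.add_apply, h0, h11 w hw v hv, zero_add, add_zero] using h1
  ext1 v
  ext1 w
  rw [← p10_add_p01 v, ← p10_add_p01 w]
  simp only [map_add, LinearMap.add_apply, h02 _ (p01_mem v) _ (p01_mem w),
    h11 _ (p10_mem v) _ (p01_mem w), h11' _ (p01_mem v) _ (p10_mem w),
    h20 _ (p10_mem v) _ (p10_mem w), add_zero, LinearMap.zero_apply]

theorem isSectionOn_cext {s₀ : S} {P : ∀ s : S, Submodule ℂ (TC ES s)} {v : TC ES s₀}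
    (h : ∀ s, cext s₀ v s ∈ P s) : IsSectionOn P (chartAt ES s₀).source (cext s₀ v) :=
  (isSectionOn_iff (chartAt ES s₀).open_source).2 fun s hs =>
    ⟨smAt_cext hs v, Eventually.of_forall h⟩

/-- The value at a point of a curvature tensor in terms of fields with constant coefficients. -/
theorem IsCurvatureTensor.types (hG : IsCurvatureTensor β D Θ G) {U : Set Z}
    (hL : IsLiftOn α TB D U L) (hz : z ∈ U) :
    (∀ v ∈ T01 (α z), ∀ w ∈ T01 (α z), β.C z (G z v w)
      - bracket (fun y => L y (cext (α z) v (α y))) (fun y => L y (cext (α z) w (α y))) z ∈ Tbar D z) ∧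
    (∀ v ∈ T10 (α z), ∀ w ∈ T01 (α z), β.C z (G z v w)
      - bracket (fun y => Θ y (cext (α z) v (α y))) (fun y => L y (cext (α z) w (α y))) z
        ∈ conjSub (TB z)) ∧
    (∀ v ∈ T10 (α z), ∀ w ∈ T10 (α z), β.C z (G z v w)
      = bracket (fun y => Θ y (cext (α z) v (α y))) (fun y => Θ y (cext (α z) w (α y))) z) := by
  have ho := (chartAt ES (α z)).open_source
  have hs : α z ∈ (chartAt ES (α z)).source := mem_chart_source ES (α z)
  refine ⟨fun v hv w hw => ?_, fun v hv w hw => ?_, fun v hv w hw => ?_⟩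
  · have h1 := hG.type02 U L hL _ _ _ ho (isSectionOn_cext (cext_mem_T01 hv))
      (isSectionOn_cext (cext_mem_T01 hw)) z ⟨hz, hs⟩
    rwa [cext_self, cext_self] at h1
  · have h1 := hG.type11 U L hL _ _ _ ho (isHolFieldOn_cext hv)
      (isSectionOn_cext (cext_mem_T01 hw)) z ⟨hz, hs⟩
    rwa [cext_self, cext_self] at h1
  · have h1 := hG.type20 _ _ _ ho (isSectionOn_cext (cext_mem_T10 hv))
      (isSectionOn_cext (cext_mem_T10 hw)) z hs
    rwa [cext_self, cext_self] at h1

namespace IsVerticallyHolPair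

/-- For each pure type the two values of β differ by an element of T_B that also lies in T̄_D or
T̄_B, hence by 0. -/
theorem curvatureTensor_unique (h : IsVerticallyHolPair α TB D Θ) (hG : IsCurvatureTensor β D Θ G)
    (hG' : IsCurvatureTensor β D Θ G') : G = G' := by
  funext z
  obtain ⟨U, L, hz, hL⟩ := h.exists_lift z
  obtain ⟨h02, h11, h20⟩ := hG.types hL hz
  obtain ⟨h02', h11', h20'⟩ := hG'.types hL hz
  have h1 : ∀ v w, β.C z (G z v w) - β.C z (G' z v w) ∈ TB z := fun v w =>
    Submodule.sub_mem _ (β.C_mem (hG.isSection.mem z v w)) (β.C_mem (hG'.isSection.mem z v w))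
  have h2 : ∀ v w, β.C z (G z v w) - β.C z (G' z v w) = 0 → (G z - G' z) v w = 0 := by
    intro v w h3
    rw [LinearMap.sub_apply, LinearMap.sub_apply, β.C_injective z (sub_eq_zero.1 h3), sub_self]
  rw [← sub_eq_zero]
  refine eq_zero_of_types (fun v => ?_) (fun v hv w hw => h2 v w ?_) (fun v hv w hw => h2 v w ?_)
    fun v hv w hw => h2 v w ?_
  · rw [LinearMap.sub_apply, LinearMap.sub_apply, hG.isSection.alternating,
      hG'.isSection.alternating, sub_self]
  · refine h.eq_zero_of_mem_Tbar (h1 v w) ?_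
    have h3 := Submodule.sub_mem _ (h02 v hv w hw) (h02' v hv w hw)
    rwa [sub_sub_sub_cancel_right] at h3
  · refine h.eq_zero_of_mem_conj (h1 v w) ?_
    have h3 := Submodule.sub_mem _ (h11 v hv w hw) (h11' v hv w hw)
    rwa [sub_sub_sub_cancel_right] at h3
  · rw [h20 v hv w hw, h20' v hv w hw, sub_self]

/-- If T̄_D is involutive and Θ is holomorphic, the brackets in types (0,2) and (1,1) lie in T̄_D.
So βG lies in T_B ∩ T̄_D = 0. -/
theorem curvatureTensor_eq_zero (h : IsVerticallyHolPair α TB D Θ) (hG : IsCurvatureTensor β D Θ G)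
    (hH : IsHolHiggsBundle α TB D Θ) (z : Z) : G z = 0 := by
  have := FiniteDimensional.complete ℝ EZ
  have hc := h.smooth.continuous
  obtain ⟨U, L, hz, hL⟩ := h.exists_lift z
  obtain ⟨h02, h11, h20⟩ := hG.types hL hz
  have hi : Involutive (Tbar D) := cj_almostCx (D := D) ▸ hH.fibration.2.involutive.cj
  have h1 : ∀ v w, β.C z (G z v w) ∈ Tbar D z → G z v w = 0 := fun v w h3 =>
    β.C_injective z ((h.eq_zero_of_mem_Tbar (β.C_mem (hG.isSection.mem z v w)) h3).trans
      (map_zero _).symm)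
  have hs : ∀ v : TC ES (α z), SectAt (Tbar D) (fun y => L y (cext (α z) v (α y))) z := by
    intro v
    refine ⟨hL.homSmAt hc hz _ (smAt_cext_self _ v), ?_⟩
    filter_upwards [hL.mem_nhds hz] with y hy using lift_mem_Tbar (hL.2.2 y hy) _
  have ho := (chartAt ES (α z)).open_source
  refine eq_zero_of_types (hG.isSection.alternating z) (fun v hv w hw => h1 v w ?_)
    (fun v hv w hw => h1 v w ?_) fun v hv w hw => β.C_injective z ?_
  · exact (Submodule.sub_mem_iff_left _ (hi.bracket_mem (hs v) (hs w))).1 (h02 v hv w hw)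
  · have h2 := hH.holomorphic _ _ ho (isHolFieldOn_cext hv)
    have h3 := (bracketPreservesConj_iff (ho.preimage hc)
      fun y hy => ((isSectionOn_iff (ho.preimage hc)).1 h2.1 y hy).1).1 h2.2 z
      (mem_chart_source ES (α z))
    rw [cj_almostCx] at h3
    exact (Submodule.sub_mem_iff_left _ (h3.swap (hs w))).1 (conjSub_le_Tbar (h11 v hv w hw))
  · rw [h20 v hv w hw, map_zero]
    exact hH.integrable _ _ _ ho (isHolFieldOn_cext hv) (isHolFieldOn_cext hw) z
      (mem_chart_source ES (α z))

end IsVerticallyHolPair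

end Fibration

/-! ### From vanishing curvature to a holomorphic Higgs bundle. -/

section Fibration

variable {ES : Type*} [NormedAddCommGroup ES] [NormedSpace ℂ ES]
  {S : Type*} [TopologicalSpace S] [ChartedSpace ES S] [IsManifold 𝓘(ℂ, ES) ω S]
  {EZ : Type*} [NormedAddCommGroup EZ] [NormedSpace ℝ EZ]
  {Z : Type*} [TopologicalSpace Z] [ChartedSpace EZ Z] [IsManifold 𝓘(ℝ, EZ) ∞ Z]
  {α : Z → S} {z : Z} {TA TB : ∀ z : Z, Submodule ℂ (TC EZ z)}
  [FiniteDimensional ℂ ES] [FiniteDimensional ℝ EZ]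
  {β : BundleAut (ES := ES) α TA TB} {D : PreQuotHom (ES := ES) α TB}
  {Θ L : PreHom (ES := ES) (EZ := EZ) α}
  {G : ∀ z : Z, TC ES (α z) →ₗ[ℂ] TC ES (α z) →ₗ[ℂ] TC EZ z}

theorem linearIndependent_bframe_inr {s₀ s : S} (hs : s ∈ (chartAt ES s₀).source) :
    LinearIndependent ℂ (fun i : CIdx ES => bframe s₀ (.inr i) s) := by
  rw [Fintype.linearIndependent_iff]
  intro g hg i
  have h1 := congrArg (cDL (bcoord s₀ (.inr i)) s) hg
  simp only [map_sum, map_smul, map_zero] at h1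
  simp only [cDL_apply, cD_bcoord_bframe hs] at h1
  simpa using h1

theorem mem_T01_eq_sum {s₀ s : S} (hs : s ∈ (chartAt ES s₀).source) {v : TC ES s} (hv : v ∈ T01 s) :
    v = ∑ i : CIdx ES, cD (bcoord s₀ (.inr i)) s v • bframe s₀ (.inr i) s := by
  conv_lhs => rw [eq_sum_bframe hs v, Fintype.sum_sum_type]
  simp only [cD_bcoord_inl hs _ hv, zero_smul, Finset.sum_const_zero, zero_add]

namespace IsVerticallyHolPair

/-- A frame of the subbundle of a `∂̄`-operator. -/
theorem exists_frameAt_Tbar (h : IsVerticallyHolPair α TB D Θ) {U : Set Z}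
    (hL : IsLiftOn α TB D U L) (hz : z ∈ U) : ∃ (k : ℕ) (e : Fin k → ∀ z : Z, TC EZ z),
      FrameAt (cj TB) e z ∧ FrameAt (Tbar D) (Sum.elim e
        fun (i : CIdx ES) y => L y (bframe (α z) (.inr i) (α y))) z := by
  have hc := h.smooth.continuous
  have hs := mem_chart_source ES (α z)
  have hs' := hc.continuousAt.eventually (chart_source_mem ES (α z))
  obtain ⟨k, e, he⟩ := h.rel.smooth.exists_frameAt z
  refine ⟨k, _, he.conj, ?_⟩
  let Q : ∀ y : Z, Submodule ℂ (TC EZ y) := fun y =>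
    Submodule.span ℂ (range fun i : CIdx ES => L y (bframe (α z) (.inr i) (α y)))
  have hd : ∀ y ∈ U, ∀ i : CIdx ES, dC (ES := ES) α y (L y (bframe (α z) (.inr i) (α y)))
      = bframe (α z) (.inr i) (α y) := by
    intro y hy i
    rw [IsSplitting.dC_lift h.dbar (hL.2.2 y hy), p01_of_mem_T01 (bframe_inr_mem _ _ i)]
  have hQ : FrameAt Q (fun (i : CIdx ES) y => L y (bframe (α z) (.inr i) (α y))) z := by
    refine ⟨fun i => hL.homSmAt hc hz _ (smAt_bframe hs _), ?_⟩
    filter_upwards [hL.mem_nhds hz, hs'] with y hy hy'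
    -- The projection dα returns the fields ∂̄ᵢ from their lifts, so independence on S suffices.
    refine ⟨LinearIndependent.of_comp (dC (ES := ES) α y) ?_, rfl⟩
    have h1 : (dC (ES := ES) α y ∘ fun i : CIdx ES => L y (bframe (α z) (.inr i) (α y)))
        = fun i : CIdx ES => bframe (α z) (.inr i) (α y) := funext (hd y hy)
    rw [h1]
    exact linearIndependent_bframe_inr hy'
  have hdis : ∀ᶠ y in 𝓝 z, Disjoint (cj TB y) (Q y) := by
    filter_upwards [hL.mem_nhds hz] with y hy
    rw [Submodule.disjoint_def]
    intro w hw hwQ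
    obtain ⟨c, rfl⟩ := (Submodule.mem_span_range_iff_exists_fun ℂ).1 hwQ
    have h1 : dC (ES := ES) α y (∑ i, c i • L y (bframe (α z) (.inr i) (α y))) = 0 :=
      h.rel.conj_le_ker y hw
    simp only [map_sum, map_smul, hd y hy] at h1
    -- The combination of lifts is L of the combination on S, which is zero because the vector is
    -- vertical.
    have h2 := congrArg (L y) h1
    simpa only [map_sum, map_smul, map_zero] using h2
  have h1 := he.conj.sup hQ hdis
  refine ⟨h1.1, ?_⟩
  filter_upwards [h1.2, hL.mem_nhds hz, hs'] with y h2 hy hy'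
  refine ⟨h2.1, h2.2.trans (le_antisymm (sup_le conjSub_le_Tbar (Submodule.span_le.2 ?_))
    fun w hw => ?_)⟩
  · rintro _ ⟨i, rfl⟩
    exact lift_mem_Tbar (hL.2.2 y hy) _
  · rw [← sub_add_cancel w (L y (dC (ES := ES) α y w))]
    refine Submodule.add_mem_sup (h.dbar.sub_lift_mem (hL.2.2 y hy) hw) ?_
    rw [mem_T01_eq_sum hy' (h.dbar.dC_mem hw), map_sum]
    refine Submodule.sum_mem _ fun i _ => ?_
    rw [map_smul]
    exact Submodule.smul_mem _ _ (Submodule.subset_span ⟨i, rfl⟩)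

/-- A vector of T_D ∩ T̄_D projects to a vector of both types, so it is vertical and lies in T_B ∩
T̄_B. Conversely, subtracting from w lifts of the two types of dα(w) leaves a vertical vector, and
T_B ⊕ T̄_B is contained in T_D + T̄_D. -/
theorem isCompl_almostCx (h : IsVerticallyHolPair α TB D Θ) (z : Z) :
    IsCompl (almostCx D z) (conjSub (almostCx D z)) := by
  obtain ⟨U, L, hz, hL⟩ := h.exists_lift z
  have h1 : conjSub (almostCx D z) = Tbar D z := conjSub_conjSub _
  rw [h1]
  constructor
  · rw [Submodule.disjoint_def]
    intro w hw hw'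
    have h2 : dC (ES := ES) α z (Cx.conj w) ∈ T01 (α z) := h.dbar.dC_mem hw
    rw [dC_conj, conj_mem_T01] at h2
    have h3 := eq_zero_of_mem_T10_of_mem_T01 h2 (h.dbar.dC_mem hw')
    refine h.eq_zero_of_mem_conj ?_ (h.dbar.mem_of_vertical hw' h3)
    have h4 := h.dbar.mem_of_vertical hw (by rw [dC_conj, h3]; exact conj_zero)
    rwa [mem_conjSub, conj_conj] at h4
  · rw [codisjoint_iff, eq_top_iff]
    intro w _
    let v := dC (ES := ES) α z w
    let p := Cx.conj (L z (Cx.conj (p10 _ v)))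
    let q := L z (p01 _ v)
    have hp : p ∈ almostCx D z := by
      change Cx.conj (Cx.conj _) ∈ Tbar D z
      rw [conj_conj]
      exact lift_mem_Tbar (hL.2.2 z hz) _
    have hq : q ∈ Tbar D z := lift_mem_Tbar (hL.2.2 z hz) _
    have h2 : dC (ES := ES) α z (w - (p + q)) = 0 := by
      have h3 := conj_mem_T01.2 (p10_mem v)
      simp only [p, q]
      rw [map_sub, map_add, dC_conj, IsSplitting.dC_lift h.dbar (hL.2.2 z hz),
        IsSplitting.dC_lift h.dbar (hL.2.2 z hz), p01_of_mem_T01 h3, conj_conj,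
        p01_of_mem_T01 (p01_mem v), p10_add_p01, sub_self]
    have h3 : w - (p + q) ∈ TB z ⊔ conjSub (TB z) := by
      rw [h.rel.sup_eq]
      exact h2
    have h4 : TB z ≤ almostCx D z := fun x hx =>
      conjSub_le_Tbar (by rwa [mem_conjSub, conj_conj])
    rw [← sub_add_cancel w (p + q)]
    exact Submodule.add_mem _ (sup_le_sup h4 conjSub_le_Tbar h3) (Submodule.add_mem_sup hp hq)

/-- Everything is tested on the frame of T̄_D formed by a frame of T̄_B and the lifts of the ∂̄ᵢ.
Brackets involving T̄_B are controlled by holomorphy along the fibres, the remaining ones by the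
vanishing of G in types (0,2) and (1,1). -/
theorem isHolHiggsBundle (h : IsVerticallyHolPair α TB D Θ) (hG : IsCurvatureTensor β D Θ G)
    (h0 : ∀ z, G z = 0) : IsHolHiggsBundle α TB D Θ := by
  have := FiniteDimensional.complete ℝ EZ
  have hc := h.smooth.continuous
  have hle : ∀ z, TB z ≤ almostCx D z := fun z x hx =>
    conjSub_le_Tbar (by rwa [mem_conjSub, conj_conj])
  have hβ0 : ∀ z v w, β.C z (G z v w) = 0 := fun z v w => by
    rw [h0, LinearMap.zero_apply, LinearMap.zero_apply, map_zero]
  have hinv : Involutive (Tbar D) := by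
    refine involutive_of_frameAt fun z => ?_
    obtain ⟨U, L, hz, hL⟩ := h.exists_lift z
    obtain ⟨k, e, he, hf⟩ := h.exists_frameAt_Tbar hL hz
    refine ⟨_, inferInstance, _, hf, ?_⟩
    have hp := h.homPresAt_lift hL hz
    have hs := mem_chart_source ES (α z)
    have ho := (chartAt ES (α z)).open_source
    have h1 : ∀ i (j : CIdx ES), bracket (e i) (fun y => L y (bframe (α z) (.inr j) (α y))) z ∈ Tbar D z := fun i j =>
      conjSub_le_Tbar ((hp _ (smAt_bframe hs _)).2 _ (he.sectAt i))
    rintro (i | i) (j | j)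
    · exact conjSub_le_Tbar (h.rel.involutive.cj.bracket_mem (he.sectAt i) (he.sectAt j))
    · exact h1 i j
    · rw [bracket_swap]
      exact Submodule.neg_mem _ (h1 j i)
    -- For two lifts of (0,1)-fields, the (0,2)-part of G is exactly the obstruction to
    -- integrability.
    · have h2 : ∀ i : CIdx ES, IsSectionOn T01 (chartAt ES (α z)).source (bframe (α z) (.inr i)) :=
        fun i => (isSectionOn_iff ho).2 fun s hs =>
          ⟨smAt_bframe hs _, Eventually.of_forall fun s => bframe_inr_mem _ s i⟩
      have h3 := hG.type02 _ _ hL _ _ _ ho (h2 i) (h2 j) z ⟨hz, hs⟩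
      rwa [hβ0, zero_sub, neg_mem_iff] at h3
  refine ⟨⟨h.dbar, ?_, hle, h.isCompl_almostCx, ?_, involutive_cj_iff.1 (by rwa [cj_almostCx])⟩,
    h.higgs, ?_, ?_⟩
  · refine isSmoothSubbundle_of_frameAt fun z => ?_
    obtain ⟨U, L, hz, hL⟩ := h.exists_lift z
    obtain ⟨k, e, -, hf⟩ := h.exists_frameAt_Tbar hL hz
    exact ⟨_, inferInstance, _, hf.conj⟩
  · rintro z _ ⟨w, hw, rfl⟩
    have h2 : dC (ES := ES) α z (Cx.conj w) ∈ T01 (α z) := h.dbar.dC_mem hw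
    rwa [dC_conj, conj_mem_T01] at h2
  · intro V a hV ha
    have ho := hV.preimage hc
    have hs : ∀ z ∈ α ⁻¹' V, SmAt (fun y => Θ y (a (α y))) z := fun z hz =>
      h.higgs.homSmAt hc z a (ha.smAt hV hz)
    refine ⟨(isSectionOn_iff ho).2 fun z hz =>
      ⟨hs z hz, Eventually.of_forall fun y => hle y (h.higgs.mem y _)⟩,
      (bracketPreservesConj_iff ho hs).2 fun z hz => ?_⟩
    rw [cj_almostCx]
    obtain ⟨U, L, hzU, hL⟩ := h.exists_lift z
    obtain ⟨k, e, he, hf⟩ := h.exists_frameAt_Tbar hL hzU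
    have hop := (chartAt ES (α z)).open_source
    refine hf.presAt (hs z hz) ?_
    rintro (i | i)
    · exact conjSub_le_Tbar ((h.higgs_pres z a (ha.smAt hV hz)).2 _ (he.sectAt i))
    · have h2 : IsSectionOn T01 (V ∩ (chartAt ES (α z)).source) (bframe (α z) (.inr i)) :=
        (isSectionOn_iff (hV.inter hop)).2 fun s hs =>
          ⟨smAt_bframe hs.2 _, Eventually.of_forall fun s => bframe_inr_mem _ s i⟩
      have h3 := hG.type11 _ _ hL _ a _ (hV.inter hop)
        ⟨fun s hs => ha.1 s hs.1, ha.2.mono inter_subset_left⟩ h2 z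
        ⟨hzU, hz, mem_chart_source ES (α z)⟩
      rw [hβ0, zero_sub, ← bracket_swap] at h3
      exact conjSub_le_Tbar h3
  · intro V a b hV ha hb z hz
    have h2 : ∀ {a : ∀ s : S, TC ES s}, IsHolFieldOn V a → IsSectionOn T10 V a := fun ha =>
      ⟨(smoothOn_iff hV).2 fun s hs => ha.smAt hV hs, ha.1⟩
    rw [← hG.type20 V a b hV (h2 ha) (h2 hb) z hz, hβ0]

end IsVerticallyHolPair

end Fibration

end NLHodge

end

end

theorem proposition5p3
    {ES : Type*} [NormedAddCommGroup ES] [NormedSpace ℂ ES] [FiniteDimensional ℂ ES]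
    {S : Type*} [TopologicalSpace S] [T2Space S] [SecondCountableTopology S]
    [ChartedSpace ES S] [IsManifold 𝓘(ℂ, ES) ω S]
    {EZ : Type*} [NormedAddCommGroup EZ] [NormedSpace ℝ EZ] [FiniteDimensional ℝ EZ]
    {Z : Type*} [TopologicalSpace Z] [T2Space Z] [SecondCountableTopology Z]
    [ChartedSpace EZ Z] [IsManifold 𝓘(ℝ, EZ) ∞ Z]
    {EF : Type*} [NormedAddCommGroup EF] [NormedSpace ℝ EF] [FiniteDimensional ℝ EF]
    {F : Type*} [TopologicalSpace F] [ChartedSpace EF F] [IsManifold 𝓘(ℝ, EF) ∞ F]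
    (α : Z → S) (hα : IsSmoothFiberBundle (ES := ES) (EZ := EZ) EF F α)
    (TA TB : ∀ z : Z, Submodule ℂ (TC EZ z))
    (hTA : IsRelComplexStructure (ES := ES) α TA) (hTB : IsRelComplexStructure (ES := ES) α TB)
    (β : BundleAut (ES := ES) α TA TB) (hβ : β.PreservesLocalLifting)
    (dbarf : PreQuotHom (ES := ES) α TA) (hf : IsHolomorphicFibration α TA dbarf)
    (N : PreHom (ES := ES) (EZ := EZ) α) (hN : IsFlatHolConnection α (almostCx dbarf) N)
    (om : ∀ z : Z, TangentSpace 𝓘(ℝ, EZ) z →ₗ[ℝ] TangentSpace 𝓘(ℝ, EZ) z →ₗ[ℝ] ℝ)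
    (hom : IsHermitianMetric α TA om)
    (C : PreHom (ES := ES) (EZ := EZ) α) (hC : IsChernConnection α TA (almostCx dbarf) om C)
    (hallow : IsAllowable β N C om)
    (Θbar : PreHom (ES := ES) (EZ := EZ) α) (hΘbar : IsComplexConjugation α TB om (higgsField β N C) Θbar) :
    (∃! G : ∀ z : Z, TC ES (α z) →ₗ[ℂ] TC ES (α z) →ₗ[ℂ] TC EZ z,
      IsCurvatureTensor β (dbarOmega β dbarf Θbar) (higgsField β N C) G) ∧
    ∀ G : ∀ z : Z, TC ES (α z) →ₗ[ℂ] TC ES (α z) →ₗ[ℂ] TC EZ z,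
      IsCurvatureTensor β (dbarOmega β dbarf Θbar) (higgsField β N C) G →
      ((∀ z, G z = 0) ↔
        IsHolHiggsBundle α TB (dbarOmega β dbarf Θbar) (higgsField β N C)) := by
  have hs := hα.1
  have hc := hs.continuous
  have h : IsVerticallyHolPair α TB (dbarOmega β dbarf Θbar) (higgsField β N C) :=
    { smooth := hs
      rel := hTB
      dbar := isDbarOperator_dbarOmega hc hTB hf.1 hΘbar
      lifting := localLifting_dbarOmega hs hTA hTB hβ hf hΘbar
      higgs := isAlmostHiggs_higgsField hc hTA β hf.1 hN.connection hC.1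
      higgs_pres := homPresAt_higgsField hs hTA hTB.involutive hβ hf.1 hN hC.1 hallow.chern }
  obtain ⟨G, hG⟩ := exists_isBracketTensor (β := β) hs hTB h.dbar h.lifting h.higgs h.higgs_pres
  -- The reference operators for the transfer through β are ∂̄_f for type (0,1) and ∇ modulo T̄_A
  -- for type (1,0).
  have hG' := h.isCurvatureTensor hG hβ hTA hf.1 (hf.localLifting hs hTA)
    (hN.connection.isAlmostConnection hTA)
    (hN.connection.localLifting hc fun z => hN.homPresAt hs hTA hf.1 z)
  exact ⟨⟨G, hG', fun G₁ hG₁ => h.curvatureTensor_unique hG₁ hG'⟩,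
    fun G hG => ⟨h.isHolHiggsBundle hG, fun hH => h.curvatureTensor_eq_zero hG hH⟩⟩
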